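/- **Setting.** Manifolds and maps are smooth; repeated indices are summed. Let $E\to M$ and $F\to N$ be vector bundles over finite-dimensional manifolds, $r=\operatorname{rank}E$, $p=\operatorname{rank}F$, let $\pi:E^*\to M$ be the dual bundle of $E$, and let $h:M\to N$, $\eta:N\to M$ be diffeomorphisms. Let $F$ carry a *generalized Lie algebroid* structure: a vector bundle morphism $\rho:F\to TM$ over $\eta$ and a Lie bracket $[\cdot,\cdot]$ on the sections of $F$ such that, with $\theta(u)(y)=Th\big(\rho(u((h\circ\eta)^{-1}y))\big)$, one has $[u,fv]=f[u,v]+\theta(u)(f)\,v$ and $\theta([u,v])=[\theta(u),\theta(v)]$ for all sections $u,v$ of $F$ and all smooth functions $f$ on $N$. For $x\in M$ regard $\rho$ as a linear map $\rho_x:F_{h(x)}\to T_xM$ (if $\eta(h(x))\ne x$, the axioms force $\rho=0$ on $F_{h(x)}$, and then $\rho_x=0$). The *generalized tangent bundle* $(\rho,\eta)TE^*\to E^*$ has fibre $\{(z,w)\in F_{h(\pi u)}\times T_uE^*:\ d\pi(w)=\rho_{\pi u}(z)\}$ at $u$ and anchor $\tilde\rho(z,w)=w$; for $X\in(\rho,\eta)T_uE^*$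 write $\tilde\rho(X)f$ for the derivative of $f$ along $\tilde\rho(X)$. A chart consists of an open set $U\subset M$ with local frames of $E^*$ over $U$ (giving fibre coordinates $p_a$) and $(t_\alpha)$ of $F$ over $h(U)$; write $[t_\alpha,t_\beta]=L^\gamma_{\alpha\beta}t_\gamma$. Over $\pi^{-1}(U)$ there is the natural base $\tilde\partial_\alpha=\big(t_\alpha,\ (\rho^i_\alpha\circ h\circ\pi)\,\partial/\partial x^i\big)$, $\dot\partial^a=(0,\partial/\partial p_a)$; the $\dot\partial^a$ span the vertical subbundle $V$. Let $\Gamma$ be a $(\rho,\eta)$-connection, i.e. a smooth vector bundle projection $(\rho,\eta)TE^*\to V$, with components given by $\Gamma(\tilde\partial_\alpha)=-\Gamma_{b\alpha}\dot\partial^b$, horizontal subbundle $H=\ker\Gamma$ and adapted base $\tilde\delta_\alpha=\tilde\partial_\alpha+\Gamma_{b\alpha}\dot\partial^b$, $\dot\partial^a$. A *distinguished linear $(\rho,\eta)$-connection* is a covariant derivative $D$ on $(\rho,\eta)TE^*$ along $\tilde\rho$ which preserves $H$ and $V$. Its components in a chart are the functions $(H^\alpha_{\beta\gamma},H^a_{b\gamma},V^{\alpha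 c}_\beta,V^{ac}_b)$ with $$D_{\tilde\delta_\gamma}\tilde\delta_\beta=H^\alpha_{\beta\gamma}\tilde\delta_\alpha,\quad D_{\tilde\delta_\gamma}\dot\partial^a=H^a_{b\gamma}\dot\partial^b,\quad D_{\dot\partial^c}\tilde\delta_\beta=V^{\alpha c}_\beta\tilde\delta_\alpha,\quad D_{\dot\partial^c}\dot\partial^a=V^{ac}_b\dot\partial^b .$$ Let $G=g_{\alpha\beta}\,d\tilde z^\alpha\otimes d\tilde z^\beta+g^{ab}\,\delta\tilde p_a\otimes\delta\tilde p_b$ (where $d\tilde z^\alpha,\delta\tilde p_a$ is the dual of the adapted base) be a *pseudometrical structure*: a smooth symmetric bilinear form on $(\rho,\eta)TE^*$ for which $H\perp V$ and whose restrictions to $H$ and $V$ are nondegenerate. Let $(\tilde g^{\alpha\beta})$ and $(\tilde g_{ab})$ be the inverse matrices of $(g_{\alpha\beta})$ and $(g^{ab})$. Put $B^a_{b\gamma}=-\partial\Gamma_{b\gamma}/\partial p_a$ (the Berwald component, that is the coefficient of $\dot\partial^b$ in the Berwald derivative of $\dot\partial^a$ along $\tilde\delta_\gamma$; the components $V$ of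 the Berwald connection are $0$) and $g^{ea}{}_{\overset{0}{|}\gamma}=\tilde\rho(\tilde\delta_\gamma)g^{ea}-B^e_{d\gamma}g^{da}-B^a_{d\gamma}g^{ed}$. **Theorem.** (1) There is a distinguished linear $(\rho,\eta)$-connection $D$ whose components in every chart are $$\begin{aligned} H^\alpha_{\beta\gamma}&=\tfrac12\tilde g^{\alpha\varepsilon}\big(\tilde\rho(\tilde\delta_\gamma)g_{\varepsilon\beta}+\tilde\rho(\tilde\delta_\beta)g_{\varepsilon\gamma}-\tilde\rho(\tilde\delta_\varepsilon)g_{\beta\gamma}+g_{\theta\varepsilon}L^\theta_{\gamma\beta}\circ h\circ\pi-g_{\beta\theta}L^\theta_{\gamma\varepsilon}\circ h\circ\pi-g_{\theta\gamma}L^\theta_{\beta\varepsilon}\circ h\circ\pi\big),\\ H^a_{b\gamma}&=-\frac{\partial\Gamma_{b\gamma}}{\partial p_a}+\tfrac12\tilde g_{be}\,g^{ea}{}_{\overset{0}{|}\gamma},\qquad V^{\alpha c}_\beta=\tfrac12\tilde g^{\alpha\varepsilon}\frac{\partial g_{\varepsilon\beta}}{\partial p_c},\qquad V^{ac}_b=\tfrac12\tilde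 g_{be}\Big(\frac{\partial g^{ea}}{\partial p_c}+\frac{\partial g^{ec}}{\partial p_a}-\frac{\partial g^{ac}}{\partial p_e}\Big), \end{aligned}$$ and $D_XG=0$ for all sections $X$ of $(\rho,\eta)TE^*$. Thus $(\rho,\eta)TE^*$ is $(\rho,\eta)$-pseudometrizable (and $(\rho,\eta)$-metrizable if $G$ has constant signatures). (2) Suppose moreover that $G$ is $\mathcal H$- and $\mathcal V$-Riemannian: around each point of $M$ there is a chart in which the $g_{\alpha\beta}$ depend only on the base point $x$, and a chart in which the $g^{ab}$ depend only on $x$. Then there is a distinguished linear $(\rho,\eta)$-connection $D$ with $D_XG=0$ for all $X$ whose components in every chart are $$\begin{aligned} H^\alpha_{\beta\gamma}&=\tfrac12\tilde g^{\alpha\varepsilon}\Big(\rho^k_\gamma\circ h\circ\pi\,\frac{\partial g_{\varepsilon\beta}}{\partial x^k}+\rho^j_\beta\circ h\circ\pi\,\frac{\partial g_{\varepsilon\gamma}}{\partial x^j}-\rho^l_\varepsilon\circ h\circ\pi\,\frac{\partial g_{\beta\gamma}}{\partial x^l}+g_{\theta\varepsilon}L^\theta_{\gamma\beta}\circ h\circ\pi-g_{\beta\theta}L^\theta_{\gamma\varepsilon}\circ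 h\circ\pi-g_{\theta\gamma}L^\theta_{\beta\varepsilon}\circ h\circ\pi\Big),\\ H^a_{b\gamma}&=-\frac{\partial\Gamma_{b\gamma}}{\partial p_a}+\tfrac12\tilde g_{be}\Big(\rho^i_\gamma\circ h\circ\pi\,\frac{\partial g^{ea}}{\partial x^i}+\frac{\partial\Gamma_{d\gamma}}{\partial p_e}g^{da}+\frac{\partial\Gamma_{d\gamma}}{\partial p_a}g^{ed}\Big),\qquad V^{\alpha c}_\beta=0,\qquad V^{ac}_b=0 . \end{aligned}$$ -/

import Mathlib

open Bundle Set
open scoped Manifold ContDiff Topology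

noncomputable section

set_option linter.unusedSectionVars false

namespace GenTangent

/-- Identification of the tangent spaces at two points that are equal. -/
def transport {E B : Type*} [NormedAddCommGroup E] [NormedSpace ℝ E] {H : Type*}
    [TopologicalSpace H] {I : ModelWithCorners ℝ E H} [TopologicalSpace B] [ChartedSpace H B]
    {x y : B} (e : x = y) : TangentSpace I x →ₗ[ℝ] TangentSpace I y :=
  e ▸ LinearMap.id

section Defs

/- `M`, `N` are smooth manifolds, `F → N` is the vector bundle carrying the generalized Lie
algebroid, and `P → M` is the vector bundle with coordinates `(x, p)`; the bundle `P` plays the role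
of the dual bundle `E*`. -/
variable {EM EN FF FP : Type*}
  [NormedAddCommGroup EM] [NormedSpace ℝ EM]
  [NormedAddCommGroup EN] [NormedSpace ℝ EN]
  [NormedAddCommGroup FF] [NormedSpace ℝ FF]
  [NormedAddCommGroup FP] [NormedSpace ℝ FP]
  {M N : Type*}
  [TopologicalSpace M] [ChartedSpace EM M] [IsManifold 𝓘(ℝ, EM) ∞ M]
  [TopologicalSpace N] [ChartedSpace EN N] [IsManifold 𝓘(ℝ, EN) ∞ N]
  {F : N → Type*} [TopologicalSpace (TotalSpace FF F)]
  [∀ y, AddCommGroup (F y)] [∀ y, Module ℝ (F y)] [∀ y, TopologicalSpace (F y)]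
  [FiberBundle FF F] [VectorBundle ℝ FF F] [ContMDiffVectorBundle ∞ FF F 𝓘(ℝ, EN)]
  {P : M → Type*} [TopologicalSpace (TotalSpace FP P)]
  [∀ x, AddCommGroup (P x)] [∀ x, Module ℝ (P x)] [∀ x, TopologicalSpace (P x)]
  [FiberBundle FP P] [VectorBundle ℝ FP P] [ContMDiffVectorBundle ∞ FP P 𝓘(ℝ, EM)]

/-! ### Generalized Lie algebroids -/

/-- The vector field `y ↦ Th (ρ (u (φ⁻¹ y)))` on `N`, where `φ = h ∘ η`. -/
def anchorFieldOf (h : M ≃ₘ^∞⟮𝓘(ℝ, EM), 𝓘(ℝ, EN)⟯ N) (η : N ≃ₘ^∞⟮𝓘(ℝ, EN), 𝓘(ℝ, EM)⟯ M)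
    (ρ : ∀ n : N, F n →ₗ[ℝ] TangentSpace 𝓘(ℝ, EM) (η n)) (u : ∀ n : N, F n) (y : N) :
    TangentSpace 𝓘(ℝ, EN) y :=
  let n := η.symm (h.symm y)
  transport (show h (η n) = y by simp [n])
    (mfderiv 𝓘(ℝ, EM) 𝓘(ℝ, EN) h (η n) (ρ n (u n)))

/-- The derivative at `y` of a function `f` on `N` along a tangent vector `X`. -/
def dirDeriv (f : N → ℝ) (y : N) (X : TangentSpace 𝓘(ℝ, EN) y) : ℝ :=
  mfderiv 𝓘(ℝ, EN) 𝓘(ℝ, ℝ) f y X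

variable (FF F) in
/-- A generalized Lie algebroid structure on `F → N`, for diffeomorphisms `h : M → N` and
`η : N → M`: a vector bundle morphism `(ρ, η) : F → TM` and a Lie bracket on the smooth sections of
`F` which satisfies the Leibniz rule with respect to `Γ(Th ∘ ρ, h ∘ η)` and which this map sends to
the bracket of vector fields on `N`. -/
structure GenLieAlgebroid (h : M ≃ₘ^∞⟮𝓘(ℝ, EM), 𝓘(ℝ, EN)⟯ N)
    (η : N ≃ₘ^∞⟮𝓘(ℝ, EN), 𝓘(ℝ, EM)⟯ M) where
  /-- the morphism `ρ`, covering `η` -/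
  ρ : ∀ n : N, F n →ₗ[ℝ] TangentSpace 𝓘(ℝ, EM) (η n)
  contMDiff_ρ : ContMDiff (𝓘(ℝ, EN).prod 𝓘(ℝ, FF)) 𝓘(ℝ, EM).tangent ∞
    (fun v : TotalSpace FF F => (⟨η v.proj, ρ v.proj v.2⟩ : TangentBundle 𝓘(ℝ, EM) M))
  /-- the bracket of sections -/
  bracket : Cₛ^∞⟮𝓘(ℝ, EN); FF, F⟯ → Cₛ^∞⟮𝓘(ℝ, EN); FF, F⟯ → Cₛ^∞⟮𝓘(ℝ, EN); FF, F⟯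
  bracket_add : ∀ u v w, bracket u (v + w) = bracket u v + bracket u w
  bracket_skew : ∀ u v, bracket u v = -bracket v u
  jacobi : ∀ u v w,
    bracket u (bracket v w) + bracket v (bracket w u) + bracket w (bracket u v) = 0
  leibniz : ∀ (u v w : Cₛ^∞⟮𝓘(ℝ, EN); FF, F⟯) (f : N → ℝ), ContMDiff 𝓘(ℝ, EN) 𝓘(ℝ, ℝ) ∞ f →
    (∀ y, w y = f y • v y) → ∀ y, bracket u w y =
      f y • bracket u v y +
        dirDeriv f y (anchorFieldOf h η ρ (fun n => u n) y) • v y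
  anchor_bracket : ∀ (u v : Cₛ^∞⟮𝓘(ℝ, EN); FF, F⟯) (y : N),
    anchorFieldOf h η ρ (fun n => bracket u v n) y =
      VectorField.mlieBracket 𝓘(ℝ, EN) (anchorFieldOf h η ρ (fun n => u n))
        (anchorFieldOf h η ρ (fun n => v n)) y

variable {h : M ≃ₘ^∞⟮𝓘(ℝ, EM), 𝓘(ℝ, EN)⟯ N} {η : N ≃ₘ^∞⟮𝓘(ℝ, EN), 𝓘(ℝ, EM)⟯ M}

/-- The anchor `F_{h x} → T_x M`, `t_α ↦ (ρ_α^i ∘ h) ∂_i`, of the pulled back bundle `h^* F`.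
The morphism `ρ` maps `F_{h x}` to the tangent space at `η (h x)`. The axioms of a generalized Lie
algebroid force `ρ` to vanish on `F_{h x}` when `η (h x) ≠ x`, whence the value `0` there. -/
def GenLieAlgebroid.anchorAt (A : GenLieAlgebroid FF F h η) (x : M) :
    F (h x) →ₗ[ℝ] TangentSpace 𝓘(ℝ, EM) x :=
  open Classical in if e : η (h x) = x then (transport e).comp (A.ρ (h x)) else 0

/-! ### The generalized tangent bundle -/

/-- The differential of the bundle projection `π : P → M`. -/
def dproj (u : TotalSpace FP P) :
    TangentSpace (𝓘(ℝ, EM).prod 𝓘(ℝ, FP)) u →ₗ[ℝ] TangentSpace 𝓘(ℝ, EM) u.proj :=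
  (mfderiv (𝓘(ℝ, EM).prod 𝓘(ℝ, FP)) 𝓘(ℝ, EM) (π FP P) u).toLinearMap

/-- The fibre at `u ∈ P` of the generalized tangent bundle `(ρ, η)TP`: the pairs
`(z, w) ∈ F_{h (π u)} × T_u P` with `dπ w = ρ z`. This is the span of the natural base
`T_α ⊕ (ρ_α^i ∘ h ∘ π) ∂_i`, `0 ⊕ ∂/∂p_a`. -/
def gtb (A : GenLieAlgebroid FF F h η) (u : TotalSpace FP P) :
    Submodule ℝ (F (h u.proj) × TangentSpace (𝓘(ℝ, EM).prod 𝓘(ℝ, FP)) u) :=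
  LinearMap.eqLocus ((dproj u).comp (LinearMap.snd ℝ _ _))
    ((A.anchorAt u.proj).comp (LinearMap.fst ℝ _ _))

/-- A (not necessarily smooth) section of the generalized tangent bundle. -/
abbrev GSection (A : GenLieAlgebroid FF F h η) (FP : Type*) (P : M → Type*)
    [NormedAddCommGroup FP] [NormedSpace ℝ FP] [TopologicalSpace (TotalSpace FP P)]
    [∀ x, AddCommGroup (P x)] [∀ x, Module ℝ (P x)] [∀ x, TopologicalSpace (P x)]
    [FiberBundle FP P] [VectorBundle ℝ FP P] :=
  ∀ u : TotalSpace FP P, gtb A u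

/-- Smoothness of a section on a set: both of its components in `π^*(h^*F) ⊕ TP` are smooth. -/
structure SmoothOn {A : GenLieAlgebroid FF F h η} (X : GSection A FP P)
    (O : Set (TotalSpace FP P)) : Prop where
  fst : ContMDiffOn (𝓘(ℝ, EM).prod 𝓘(ℝ, FP)) (𝓘(ℝ, EN).prod 𝓘(ℝ, FF)) ∞
    (fun u => (⟨h u.proj, (X u).1.1⟩ : TotalSpace FF F)) O
  snd : ContMDiffOn (𝓘(ℝ, EM).prod 𝓘(ℝ, FP)) (𝓘(ℝ, EM).prod 𝓘(ℝ, FP)).tangent ∞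
    (fun u => (⟨u, (X u).1.2⟩ :
      TangentBundle (𝓘(ℝ, EM).prod 𝓘(ℝ, FP)) (TotalSpace FP P))) O

/-- The derivative `Γ(ρ̃, Id)(X) f` at `u` of a function `f` on `P` along `X ∈ (ρ, η)T_uP`, where
`ρ̃ (z, w) = w` is the anchor of the generalized tangent bundle. -/
def anchorDeriv {A : GenLieAlgebroid FF F h η} (f : TotalSpace FP P → ℝ) {u : TotalSpace FP P}
    (X : gtb A u) : ℝ :=
  mfderiv (𝓘(ℝ, EM).prod 𝓘(ℝ, FP)) 𝓘(ℝ, ℝ) f u X.1.2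

/-! ### Vertical vectors -/

/-- The tangent vector at `u` of the curve `τ ↦ u + τ w` in the fibre of `P` through `u`. -/
def vlift (u : TotalSpace FP P) (w : P u.proj) :
    TangentSpace (𝓘(ℝ, EM).prod 𝓘(ℝ, FP)) u :=
  transport (show (⟨u.proj, u.2 + (0 : ℝ) • w⟩ : TotalSpace FP P) = u by simp)
    (mfderiv 𝓘(ℝ, ℝ) (𝓘(ℝ, EM).prod 𝓘(ℝ, FP))
      (fun τ : ℝ => (⟨u.proj, u.2 + τ • w⟩ : TotalSpace FP P)) 0 (1 : ℝ))

theorem dproj_transport {u v : TotalSpace FP P} (e : u = v)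
    (X : TangentSpace (𝓘(ℝ, EM).prod 𝓘(ℝ, FP)) u) :
    dproj v (transport e X) = transport (congrArg (fun q => q.proj) e) (dproj u X) := by
  subst e; rfl

theorem dproj_vlift (u : TotalSpace FP P) (w : P u.proj) :
    dproj (EM := EM) u (vlift u w) = 0 := by
  have hc : (π FP P) ∘ (fun τ : ℝ => (⟨u.proj, u.2 + τ • w⟩ : TotalSpace FP P)) =
      fun _ => u.proj := rfl
  unfold vlift
  rw [dproj_transport]
  by_cases hd : MDifferentiableAt 𝓘(ℝ, ℝ) (𝓘(ℝ, EM).prod 𝓘(ℝ, FP))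
      (fun τ : ℝ => (⟨u.proj, u.2 + τ • w⟩ : TotalSpace FP P)) 0
  · have h1 := mfderiv_comp (I := 𝓘(ℝ, ℝ)) (I' := 𝓘(ℝ, EM).prod 𝓘(ℝ, FP)) (I'' := 𝓘(ℝ, EM))
      (0 : ℝ) (mdifferentiableAt_proj P) hd
    rw [hc, mfderiv_const] at h1
    have h2 := DFunLike.congr_fun h1 (1 : ℝ)
    refine (congrArg (transport _) h2.symm).trans ?_
    exact map_zero _
  · rw [mfderiv_zero_of_not_mdifferentiableAt hd]
    have : ∀ (z : TotalSpace FP P) (c : ℝ), dproj (EM := EM) z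
        ((0 : TangentSpace 𝓘(ℝ, ℝ) (0 : ℝ) →L[ℝ]
          TangentSpace (𝓘(ℝ, EM).prod 𝓘(ℝ, FP)) z) c) = 0 := fun z c => map_zero _
    rw [this]
    exact map_zero _

/-- The vertical element `0 ⊕ w` of `(ρ, η)T_uP` defined by `w ∈ P_{π u}`. This identifies the
fibre `P_{π u}` with the fibre at `u` of the vertical subbundle. -/
def vert (A : GenLieAlgebroid FF F h η) (u : TotalSpace FP P) (w : P u.proj) : gtb A u :=
  ⟨(0, vlift u w), by simp [gtb, dproj_vlift]⟩

/-- The vertical subbundle `V(ρ, η)TP`: the kernel of `(z, w) ↦ z`. -/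
def vertical (A : GenLieAlgebroid FF F h η) (u : TotalSpace FP P) : Submodule ℝ (gtb A u) :=
  LinearMap.ker ((LinearMap.fst ℝ _ _).comp (gtb A u).subtype)

/-! ### Local charts and the natural base -/

variable (FF F FP P) in
/-- The data that give the local components: a local frame `s` of `P` on an open set `U ⊆ M`
(whence the fibre coordinates `p_a` on `π⁻¹(U)`), and a local frame `t` of `F` on `h(U)`. -/
structure VChart (h : M ≃ₘ^∞⟮𝓘(ℝ, EM), 𝓘(ℝ, EN)⟯ N) (p r : ℕ) where
  U : Set M
  isOpen_U : IsOpen U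
  s : Fin r → ∀ x : M, P x
  t : Fin p → ∀ y : N, F y
  frame_s : IsLocalFrameOn 𝓘(ℝ, EM) FP ∞ s U
  frame_t : IsLocalFrameOn 𝓘(ℝ, EN) FF ∞ t (h '' U)

variable {p r : ℕ}

namespace VChart

/-- The fibre coordinates `p_a`. -/
def coord (C : VChart FF FP F P h p r) (a : Fin r) (u : TotalSpace FP P) : ℝ :=
  C.frame_s.coeff a u.proj u.2

/-- The local section of `P` through `u` along which the fibre coordinates are constant. -/
def constSection (C : VChart FF FP F P h p r) (u : TotalSpace FP P) (x : M) : TotalSpace FP P :=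
  ⟨x, ∑ a, C.coord a u • C.s a x⟩

theorem constSection_self (C : VChart FF FP F P h p r) (u : TotalSpace FP P) (hu : u.proj ∈ C.U) :
    C.constSection u u.proj = u := by
  have h1 := (C.frame_s.toBasisAt hu).sum_repr u.2
  simp only [IsLocalFrameOn.toBasisAt_coe] at h1
  unfold constSection coord
  simp only [IsLocalFrameOn.coeff, hu, dif_pos, Module.Basis.coord_apply, h1]

/-- For `w = w^i ∂_i` in `T_{π u}M`, the vector `w^i ∂/∂x^i` in `T_uP`, where the coordinate field
`∂/∂x^i` on `π⁻¹(U)` is taken at constant fibre coordinates `p_a`. -/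
def hlift (C : VChart FF FP F P h p r) (u : TotalSpace FP P) (hu : u.proj ∈ C.U)
    (w : TangentSpace 𝓘(ℝ, EM) u.proj) : TangentSpace (𝓘(ℝ, EM).prod 𝓘(ℝ, FP)) u :=
  transport (C.constSection_self u hu)
    (mfderiv 𝓘(ℝ, EM) (𝓘(ℝ, EM).prod 𝓘(ℝ, FP)) (C.constSection u) u.proj w)

theorem dproj_hlift (C : VChart FF FP F P h p r) (u : TotalSpace FP P) (hu : u.proj ∈ C.U)
    (w : TangentSpace 𝓘(ℝ, EM) u.proj) : dproj u (C.hlift u hu w) = w := by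
  have hc : (π FP P) ∘ (C.constSection u) = id := rfl
  have hs : ContMDiffAt 𝓘(ℝ, EM) (𝓘(ℝ, EM).prod 𝓘(ℝ, FP)) ∞ (C.constSection u) u.proj :=
    ContMDiffAt.sum_section fun a _ =>
      ContMDiffAt.const_smul_section (C.frame_s.contMDiffAt C.isOpen_U hu a)
  have h1 := mfderiv_comp (I := 𝓘(ℝ, EM)) (I' := 𝓘(ℝ, EM).prod 𝓘(ℝ, FP)) (I'' := 𝓘(ℝ, EM))
    u.proj (mdifferentiableAt_proj P) (hs.mdifferentiableAt (by simp))
  rw [hc, mfderiv_id] at h1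
  have h2 := DFunLike.congr_fun h1 w
  unfold hlift
  rw [dproj_transport]
  exact h2.symm

/-- The natural base, first part: `∂_α = T_α ⊕ (ρ_α^i ∘ h ∘ π) ∂/∂x^i` on `π⁻¹(U)`. -/
def natH (C : VChart FF FP F P h p r) (A : GenLieAlgebroid FF F h η) (α : Fin p) :
    GSection A FP P := fun u =>
  open Classical in
  if hu : u.proj ∈ C.U then
    ⟨(C.t α (h u.proj), C.hlift u hu (A.anchorAt u.proj (C.t α (h u.proj)))), by
      simp [gtb, dproj_hlift]⟩
  else 0

/-- The natural base, second part: `∂^a = 0 ⊕ ∂/∂p_a`. -/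
def natV (C : VChart FF FP F P h p r) (A : GenLieAlgebroid FF F h η) (a : Fin r) :
    GSection A FP P := fun u => vert A u (C.s a u.proj)

/-- The structure functions `L^γ_{αβ}` of the generalized Lie algebroid in the frame `t`,
`[t_α, t_β] = L^γ_{αβ} t_γ` on `h(U)`. By the Leibniz rule the value of a bracket at `y` depends
only on the germs at `y`, so `t_α` and `t_β` are replaced by smooth global sections with the same
germs at `y`. -/
def structFun (C : VChart FF FP F P h p r) (A : GenLieAlgebroid FF F h η) (γ α β : Fin p)
    (y : N) : ℝ :=
  open Classical in
  if e : ∃ σ τ : Cₛ^∞⟮𝓘(ℝ, EN); FF, F⟯,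
      (∀ᶠ z in 𝓝 y, σ z = C.t α z) ∧ (∀ᶠ z in 𝓝 y, τ z = C.t β z) then
    C.frame_t.coeff γ y (A.bracket e.choose e.choose_spec.choose y)
  else 0

end VChart

/-! ### Connections and the adapted base -/

variable (FP P) in
/-- A `(ρ, η)`-connection: a smooth left splitting of the inclusion of the vertical subbundle in
`(ρ, η)TP`, the vertical fibre at `u` being identified with `P_{π u}`. -/
structure RhoConnection (A : GenLieAlgebroid FF F h η) where
  toFun : ∀ u : TotalSpace FP P, gtb A u →ₗ[ℝ] P u.proj
  toFun_vert : ∀ u w, toFun u (vert A u w) = w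
  smooth : ∀ (O : Set (TotalSpace FP P)) (X : GSection A FP P), IsOpen O → SmoothOn X O →
    ContMDiffOn (𝓘(ℝ, EM).prod 𝓘(ℝ, FP)) (𝓘(ℝ, EM).prod 𝓘(ℝ, FP)) ∞
      (fun u => (⟨u.proj, toFun u (X u)⟩ : TotalSpace FP P)) O

variable {A : GenLieAlgebroid FF F h η}

/-- The horizontal subbundle `H(ρ, η)TP`, the kernel of the connection. -/
def RhoConnection.horizontal (Γ : RhoConnection FP P A) (u : TotalSpace FP P) :
    Submodule ℝ (gtb A u) :=
  LinearMap.ker (Γ.toFun u)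

namespace VChart

/-- The components `Γ_{bα}` of a connection, determined by `Γ(∂_α) = -Γ_{bα} ∂^b`. -/
def gam (C : VChart FF FP F P h p r) (Γ : RhoConnection FP P A) (b : Fin r) (α : Fin p)
    (u : TotalSpace FP P) : ℝ :=
  -C.frame_s.coeff b u.proj (Γ.toFun u (C.natH A α u))

/-- The adapted base, horizontal part: `δ_α = ∂_α + Γ_{bα} ∂^b`. -/
def delta (C : VChart FF FP F P h p r) (Γ : RhoConnection FP P A) (α : Fin p) :
    GSection A FP P := fun u =>
  C.natH A α u + ∑ b, C.gam Γ b α u • C.natV A b u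

end VChart

/-! ### Distinguished linear connections -/

/-- A distinguished linear `(ρ, η)`-connection: a covariant derivative on `(ρ, η)TP`, along the
anchor `ρ̃`, which preserves the horizontal and the vertical subbundle by parallelism.
`D Y u X` is `D_X Y` at `u`; the values of `D` at sections that are not smooth are irrelevant. -/
structure DistLinConnection (Γ : RhoConnection FP P A) where
  D : GSection A FP P → ∀ u : TotalSpace FP P, gtb A u →ₗ[ℝ] gtb A u
  add : ∀ (O : Set (TotalSpace FP P)) (Y Z : GSection A FP P), IsOpen O → SmoothOn Y O →
    SmoothOn Z O → ∀ u ∈ O, D (fun v => Y v + Z v) u = D Y u + D Z u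
  leibniz : ∀ (O : Set (TotalSpace FP P)) (f : TotalSpace FP P → ℝ) (Y : GSection A FP P),
    IsOpen O → ContMDiffOn (𝓘(ℝ, EM).prod 𝓘(ℝ, FP)) 𝓘(ℝ, ℝ) ∞ f O → SmoothOn Y O →
    ∀ u ∈ O, ∀ X : gtb A u,
      D (fun v => f v • Y v) u X = f u • D Y u X + anchorDeriv f X • Y u
  smooth : ∀ (O : Set (TotalSpace FP P)) (X Y : GSection A FP P), IsOpen O → SmoothOn X O →
    SmoothOn Y O → SmoothOn (fun u => D Y u (X u)) O
  horizontal : ∀ (O : Set (TotalSpace FP P)) (Y : GSection A FP P), IsOpen O → SmoothOn Y O →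
    (∀ u ∈ O, Y u ∈ Γ.horizontal u) → ∀ u ∈ O, ∀ X, D Y u X ∈ Γ.horizontal u
  vertical : ∀ (O : Set (TotalSpace FP P)) (Y : GSection A FP P), IsOpen O → SmoothOn Y O →
    (∀ u ∈ O, Y u ∈ vertical A u) → ∀ u ∈ O, ∀ X, D Y u X ∈ vertical A u

/-- The functions `H^α_{βγ}`, `H^a_{bγ}`, `V^{αc}_β`, `V^{ac}_b` (the arguments are, in this order,
`α β γ`, `a b γ`, `α β c`, `a b c`) are the components of `D` in the chart `C`:
`D_{δ_γ} δ_β = H^α_{βγ} δ_α`, `D_{δ_γ} ∂^a = H^a_{bγ} ∂^b`, `D_{∂^c} δ_β = V^{αc}_β δ_α` and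
`D_{∂^c} ∂^a = V^{ac}_b ∂^b` on `π⁻¹(U)`. -/
structure DistLinConnection.HasComponents {Γ : RhoConnection FP P A} (D : DistLinConnection Γ)
    (C : VChart FF FP F P h p r)
    (Hh : Fin p → Fin p → Fin p → TotalSpace FP P → ℝ)
    (Hv : Fin r → Fin r → Fin p → TotalSpace FP P → ℝ)
    (Vh : Fin p → Fin p → Fin r → TotalSpace FP P → ℝ)
    (Vv : Fin r → Fin r → Fin r → TotalSpace FP P → ℝ) : Prop where
  hh : ∀ u : TotalSpace FP P, u.proj ∈ C.U → ∀ β γ,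
    D.D (C.delta Γ β) u (C.delta Γ γ u) = ∑ α, Hh α β γ u • C.delta Γ α u
  hv : ∀ u : TotalSpace FP P, u.proj ∈ C.U → ∀ a γ,
    D.D (C.natV A a) u (C.delta Γ γ u) = ∑ b, Hv a b γ u • C.natV A b u
  vh : ∀ u : TotalSpace FP P, u.proj ∈ C.U → ∀ β c,
    D.D (C.delta Γ β) u (C.natV A c u) = ∑ α, Vh α β c u • C.delta Γ α u
  vv : ∀ u : TotalSpace FP P, u.proj ∈ C.U → ∀ a c,
    D.D (C.natV A a) u (C.natV A c u) = ∑ b, Vv a b c u • C.natV A b u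

/-! ### Pseudometrical structures -/

/-- A pseudometrical structure `G = g_{αβ} dz^α ⊗ dz^β + g^{ab} δp_a ⊗ δp_b`: a smooth symmetric
bilinear form on `(ρ, η)TP` for which the horizontal and the vertical subbundle are orthogonal, and
which is nondegenerate on each of them. -/
structure PseudoMetric (Γ : RhoConnection FP P A) where
  form : ∀ u : TotalSpace FP P, gtb A u →ₗ[ℝ] gtb A u →ₗ[ℝ] ℝ
  smooth : ∀ (O : Set (TotalSpace FP P)) (X Y : GSection A FP P), IsOpen O → SmoothOn X O →
    SmoothOn Y O →
    ContMDiffOn (𝓘(ℝ, EM).prod 𝓘(ℝ, FP)) 𝓘(ℝ, ℝ) ∞ (fun u => form u (X u) (Y u)) O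
  symm : ∀ u X Y, form u X Y = form u Y X
  distinguished : ∀ u, ∀ X ∈ Γ.horizontal u, ∀ Y ∈ vertical A u, form u X Y = 0
  nondeg_horizontal : ∀ u, ∀ X ∈ Γ.horizontal u,
    (∀ Y ∈ Γ.horizontal u, form u X Y = 0) → X = 0
  nondeg_vertical : ∀ u, ∀ X ∈ vertical A u, (∀ Y ∈ vertical A u, form u X Y = 0) → X = 0

/-- `D_X G = 0` for all `X`, where
`(D_X G)(Y, Z) = ρ̃(X)(G(Y, Z)) - G(D_X Y, Z) - G(Y, D_X Z)`. -/
def PseudoMetric.IsParallel {Γ : RhoConnection FP P A} (G : PseudoMetric Γ)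
    (D : DistLinConnection Γ) : Prop :=
  ∀ (O : Set (TotalSpace FP P)) (Y Z : GSection A FP P), IsOpen O → SmoothOn Y O → SmoothOn Z O →
    ∀ u ∈ O, ∀ X : gtb A u,
      anchorDeriv (fun v => G.form v (Y v) (Z v)) X - G.form u (D.D Y u X) (Z u)
        - G.form u (Y u) (D.D Z u X) = 0

namespace VChart

variable {Γ : RhoConnection FP P A}

/-- `g_{αβ}` -/
def gH (C : VChart FF FP F P h p r) (G : PseudoMetric Γ) (α β : Fin p) (u : TotalSpace FP P) : ℝ :=
  G.form u (C.delta Γ α u) (C.delta Γ β u)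

/-- `g^{ab}` -/
def gV (C : VChart FF FP F P h p r) (G : PseudoMetric Γ) (a b : Fin r) (u : TotalSpace FP P) : ℝ :=
  G.form u (C.natV A a u) (C.natV A b u)

/-- `g̃^{αβ}`, the inverse of the matrix `g_{αβ}` -/
def gHinv (C : VChart FF FP F P h p r) (G : PseudoMetric Γ) (α β : Fin p)
    (u : TotalSpace FP P) : ℝ :=
  ((Matrix.of fun α β => C.gH G α β u)⁻¹ : Matrix (Fin p) (Fin p) ℝ) α β

/-- `g̃_{ab}`, the inverse of the matrix `g^{ab}` -/
def gVinv (C : VChart FF FP F P h p r) (G : PseudoMetric Γ) (a b : Fin r)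
    (u : TotalSpace FP P) : ℝ :=
  ((Matrix.of fun a b => C.gV G a b u)⁻¹ : Matrix (Fin r) (Fin r) ℝ) a b

/-- The derivative `ρ̃(δ_γ) f`. -/
def dDelta (C : VChart FF FP F P h p r) (Γ : RhoConnection FP P A) (γ : Fin p)
    (f : TotalSpace FP P → ℝ) (u : TotalSpace FP P) : ℝ :=
  anchorDeriv f (C.delta Γ γ u)

/-- The derivative `∂f/∂p_c`. -/
def dP (C : VChart FF FP F P h p r) (A : GenLieAlgebroid FF F h η) (c : Fin r)
    (f : TotalSpace FP P → ℝ) (u : TotalSpace FP P) : ℝ :=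
  anchorDeriv f (C.natV A c u)

/-- The derivative `(ρ_γ^i ∘ h ∘ π) ∂f/∂x^i`. -/
def dX (C : VChart FF FP F P h p r) (A : GenLieAlgebroid FF F h η) (γ : Fin p)
    (f : TotalSpace FP P → ℝ) (u : TotalSpace FP P) : ℝ :=
  anchorDeriv f (C.natH A γ u)

/-- The component `-∂Γ_{bγ}/∂p_a` of the Berwald connection, the coefficient of `∂^b` in the
derivative of `∂^a` along `δ_γ`. -/
def berwald (C : VChart FF FP F P h p r) (Γ : RhoConnection FP P A) (a b : Fin r) (γ : Fin p)
    (u : TotalSpace FP P) : ℝ :=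
  -C.dP A a (C.gam Γ b γ) u

/-- The horizontal covariant derivative `g^{ea}_{|γ}` with respect to the Berwald connection. -/
def gVBerwald (C : VChart FF FP F P h p r) (G : PseudoMetric Γ) (e a : Fin r) (γ : Fin p)
    (u : TotalSpace FP P) : ℝ :=
  C.dDelta Γ γ (C.gV G e a) u - ∑ d, C.berwald Γ e d γ u * C.gV G d a u
    - ∑ d, C.berwald Γ a d γ u * C.gV G e d u

/-- The terms `g_{θε} L^θ_{γβ} - g_{βθ} L^θ_{γε} - g_{θγ} L^θ_{βε}`. -/
def bracketTerm (C : VChart FF FP F P h p r) (G : PseudoMetric Γ) (ε β γ : Fin p)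
    (u : TotalSpace FP P) : ℝ :=
  ∑ θ, (C.gH G θ ε u * C.structFun A θ γ β (h u.proj)
    - C.gH G β θ u * C.structFun A θ γ ε (h u.proj)
    - C.gH G θ γ u * C.structFun A θ β ε (h u.proj))

/-- `H^α_{βγ}`, general case -/
def cHh (C : VChart FF FP F P h p r) (G : PseudoMetric Γ) (α β γ : Fin p)
    (u : TotalSpace FP P) : ℝ :=
  1 / 2 * ∑ ε, C.gHinv G α ε u *
    (C.dDelta Γ γ (C.gH G ε β) u + C.dDelta Γ β (C.gH G ε γ) u - C.dDelta Γ ε (C.gH G β γ) u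
      + C.bracketTerm G ε β γ u)

/-- `H^a_{bγ}`, general case -/
def cHv (C : VChart FF FP F P h p r) (G : PseudoMetric Γ) (a b : Fin r) (γ : Fin p)
    (u : TotalSpace FP P) : ℝ :=
  C.berwald Γ a b γ u + 1 / 2 * ∑ e, C.gVinv G b e u * C.gVBerwald G e a γ u

/-- `V^{αc}_β`, general case -/
def cVh (C : VChart FF FP F P h p r) (G : PseudoMetric Γ) (α β : Fin p) (c : Fin r)
    (u : TotalSpace FP P) : ℝ :=
  1 / 2 * ∑ ε, C.gHinv G α ε u * C.dP A c (C.gH G ε β) u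

/-- `V^{ac}_b`, general case -/
def cVv (C : VChart FF FP F P h p r) (G : PseudoMetric Γ) (a b c : Fin r)
    (u : TotalSpace FP P) : ℝ :=
  1 / 2 * ∑ e, C.gVinv G b e u *
    (C.dP A c (C.gV G e a) u + C.dP A a (C.gV G e c) u - C.dP A e (C.gV G a c) u)

/-- `H^α_{βγ}`, Riemannian case -/
def rHh (C : VChart FF FP F P h p r) (G : PseudoMetric Γ) (α β γ : Fin p)
    (u : TotalSpace FP P) : ℝ :=
  1 / 2 * ∑ ε, C.gHinv G α ε u *
    (C.dX A γ (C.gH G ε β) u + C.dX A β (C.gH G ε γ) u - C.dX A ε (C.gH G β γ) u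
      + C.bracketTerm G ε β γ u)

/-- `H^a_{bγ}`, Riemannian case -/
def rHv (C : VChart FF FP F P h p r) (G : PseudoMetric Γ) (a b : Fin r) (γ : Fin p)
    (u : TotalSpace FP P) : ℝ :=
  -C.dP A a (C.gam Γ b γ) u + 1 / 2 * ∑ e, C.gVinv G b e u *
    (C.dX A γ (C.gV G e a) u + ∑ d, C.dP A e (C.gam Γ d γ) u * C.gV G d a u
      + ∑ d, C.dP A a (C.gam Γ d γ) u * C.gV G e d u)

end VChart

/-- `G` is a Riemannian `H`-pseudometrical structure: around each point of `M` there is a chart in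
which the components `g_{αβ}` depend only on the base point. -/
def PseudoMetric.IsHRiemannian {Γ : RhoConnection FP P A} (G : PseudoMetric Γ) : Prop :=
  ∀ x : M, ∃ (p r : ℕ) (C : VChart FF FP F P h p r), x ∈ C.U ∧
    ∀ u v : TotalSpace FP P, u.proj ∈ C.U → u.proj = v.proj → ∀ α β, C.gH G α β u = C.gH G α β v

/-- `G` is a Riemannian `V`-pseudometrical structure: around each point of `M` there is a chart in
which the components `g^{ab}` depend only on the base point. -/
def PseudoMetric.IsVRiemannian {Γ : RhoConnection FP P A} (G : PseudoMetric Γ) : Prop :=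
  ∀ x : M, ∃ (p r : ℕ) (C : VChart FF FP F P h p r), x ∈ C.U ∧
    ∀ u v : TotalSpace FP P, u.proj ∈ C.U → u.proj = v.proj → ∀ a b, C.gV G a b u = C.gV G a b v

end Defs
end GenTangent

/-!
In a chart the prescribed components are the entries of two matrices of one-forms along the
anchor: a form `κ_H` for the frame `δ_α` of the horizontal subbundle and a form `κ_V` for the
frame `∂^a` of the vertical subbundle. The covariant derivative of a section with coefficients `y`
has the coefficients `dy + κ y`. Everything follows from two properties of these forms.

* Under a change of chart with transition matrix `Λ` they satisfy `Λ κ' = dΛ + κ Λ`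
  (`VChart.formH_change`, `VChart.formV_change`). Hence the covariant derivatives of the single
  charts agree on overlaps and define one distinguished linear connection.
* They satisfy `κᵀ g + g κ = dg` (`VChart.formH_metric`, `VChart.formV_metric`), which is the
  condition `D_X G = 0`.

Both properties are checked on the adapted base, where the four families of components are of two
kinds.

* `H^α_{βγ}` and `V^{ac}_b` are given by the Koszul formula (`leviCivita`). The matrices given by
  this formula are the only ones that are compatible with the metric and have torsion zero
  (`eq_leviCivita`). These conditions can be transported along a change of frame, so uniqueness
  yields the transformation law (`leviCivita_change`). For `H^α_{βγ}` this rests on the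
  transformation law of the structure functions `L^γ_{αβ}` (`VChart.structFun_change`). For
  `V^{ac}_b` there are no structure functions, and `dΛ` vanishes along the fibres.
* `H^a_{bγ}` and `V^{αc}_β` have the form `B + ½ g⁻¹ (dg - Bᵀ g - g B)` (`metrize`), where `B` is
  the Berwald connection, respectively `0`. This makes any connection metric, and it commutes with
  changes of frame (`metrize_change`), so it remains to see that `B` obeys the transformation law.
  For `B = 0` this is the vanishing of `dΛ` along the fibres. For the Berwald connection the law
  is the derivative along the fibres of the law for `Γ_{bγ}`, which in turn is the derivative
  along `δ'_γ` of the relation `p_b = Λ_{ba} p'_a` (`VChart.matB_change`).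

The morphism `ρ` maps `F_{h x}` to the tangent space at `η (h x)`, which may differ from `x`. The
Leibniz rule forces `ρ` to vanish on `F_{h x}` in this case (`GenLieAlgebroid.rho_eq_zero`),
whence `GenLieAlgebroid.anchorAt` is smooth and computes the derivatives that occur in the Leibniz
rule.

In the Riemannian case the transition functions depend only on the base point. So if the
components of `G` do so in one chart around each point, they do so in every chart, the derivatives
`∂g/∂p_c` vanish, `ρ̃(δ_γ) g` reduces to `(ρ_γ^i ∘ h ∘ π) ∂g/∂x^i`, and the connection of the
general case has the required components.
-/

namespace GenTangent

/-! ### Sections of a vector bundle along a map -/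

section Along

variable {EB EQ FB : Type*}
  [NormedAddCommGroup EB] [NormedSpace ℝ EB]
  [NormedAddCommGroup EQ] [NormedSpace ℝ EQ]
  [NormedAddCommGroup FB] [NormedSpace ℝ FB]
  {HB HQ : Type*} [TopologicalSpace HB] [TopologicalSpace HQ]
  {IB : ModelWithCorners ℝ EB HB} {IQ : ModelWithCorners ℝ EQ HQ}
  {B Q : Type*} [TopologicalSpace B] [ChartedSpace HB B]
  [TopologicalSpace Q] [ChartedSpace HQ Q]
  {V : B → Type*} [TopologicalSpace (TotalSpace FB V)]
  [∀ y, AddCommGroup (V y)] [∀ y, Module ℝ (V y)] [∀ y, TopologicalSpace (V y)]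
  [FiberBundle FB V] [VectorBundle ℝ FB V]
  {f : Q → B} {O : Set Q}

theorem contMDiffOn_add_along {g₁ g₂ : ∀ q, V (f q)}
    (h₁ : ContMDiffOn IQ (IB.prod 𝓘(ℝ, FB)) ∞ (fun q => (⟨f q, g₁ q⟩ : TotalSpace FB V)) O)
    (h₂ : ContMDiffOn IQ (IB.prod 𝓘(ℝ, FB)) ∞ (fun q => (⟨f q, g₂ q⟩ : TotalSpace FB V)) O) :
    ContMDiffOn IQ (IB.prod 𝓘(ℝ, FB)) ∞
      (fun q => (⟨f q, g₁ q + g₂ q⟩ : TotalSpace FB V)) O := by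
  intro q hq
  have h1 := contMDiffWithinAt_totalSpace.1 (h₁ q hq)
  have h2 := contMDiffWithinAt_totalSpace.1 (h₂ q hq)
  refine contMDiffWithinAt_totalSpace.2 ⟨h1.1, ?_⟩
  set e := trivializationAt FB V (f q)
  refine (h1.2.add h2.2).congr_of_eventuallyEq ?_ ?_
  · filter_upwards [h1.1.continuousWithinAt (e.open_baseSet.mem_nhds
      (mem_baseSet_trivializationAt FB V (f q)))] with q' hq'
    exact (e.linear ℝ hq').1 _ _
  · exact (e.linear ℝ (mem_baseSet_trivializationAt FB V (f q))).1 _ _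

theorem contMDiffOn_smul_along {g : ∀ q, V (f q)} {c : Q → ℝ}
    (hc : ContMDiffOn IQ 𝓘(ℝ, ℝ) ∞ c O)
    (hg : ContMDiffOn IQ (IB.prod 𝓘(ℝ, FB)) ∞ (fun q => (⟨f q, g q⟩ : TotalSpace FB V)) O) :
    ContMDiffOn IQ (IB.prod 𝓘(ℝ, FB)) ∞
      (fun q => (⟨f q, c q • g q⟩ : TotalSpace FB V)) O := by
  intro q hq
  have h1 := contMDiffWithinAt_totalSpace.1 (hg q hq)
  refine contMDiffWithinAt_totalSpace.2 ⟨h1.1, ?_⟩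
  set e := trivializationAt FB V (f q)
  refine ((hc q hq).smul h1.2).congr_of_eventuallyEq ?_ ?_
  · filter_upwards [h1.1.continuousWithinAt (e.open_baseSet.mem_nhds
      (mem_baseSet_trivializationAt FB V (f q)))] with q' hq'
    exact (e.linear ℝ hq').2 _ _
  · exact (e.linear ℝ (mem_baseSet_trivializationAt FB V (f q))).2 _ _

theorem contMDiffOn_zero_along (hf : ContMDiffOn IQ IB ∞ f O) [ContMDiffVectorBundle ∞ FB V IB] :
    ContMDiffOn IQ (IB.prod 𝓘(ℝ, FB)) ∞ (fun q => (⟨f q, 0⟩ : TotalSpace FB V)) O :=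
  (contMDiff_zeroSection ℝ V).comp_contMDiffOn hf

theorem contMDiffOn_sum_along {ι : Type*} (S : Finset ι) (hf : ContMDiffOn IQ IB ∞ f O)
    [ContMDiffVectorBundle ∞ FB V IB] {g : ι → ∀ q, V (f q)}
    (hg : ∀ i, ContMDiffOn IQ (IB.prod 𝓘(ℝ, FB)) ∞
      (fun q => (⟨f q, g i q⟩ : TotalSpace FB V)) O) :
    ContMDiffOn IQ (IB.prod 𝓘(ℝ, FB)) ∞
      (fun q => (⟨f q, ∑ i ∈ S, g i q⟩ : TotalSpace FB V)) O := by
  classical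
  induction S using Finset.induction_on with
  | empty => simpa using contMDiffOn_zero_along hf
  | insert i S hi ih => simpa [Finset.sum_insert hi] using contMDiffOn_add_along (hg i) ih

theorem coeff_frame {ι : Type*} [DecidableEq ι] {s : ι → ∀ y, V y} {U : Set B} {n : ℕ∞ω}
    (hs : IsLocalFrameOn IB FB n s U)
    {x : B} (hx : x ∈ U) (i j : ι) : hs.coeff i x (s j x) = if i = j then 1 else 0 := by
  rw [hs.coeff_apply_of_mem hx (s j)]
  have : s j x = hs.toBasisAt hx j := by simp
  rw [this, Module.Basis.repr_self, Finsupp.single_apply]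
  simp [eq_comm]

/-- The coefficients, in a smooth local frame, of a section along a map depend smoothly on the
point: in a trivialization they are obtained by inverting a smooth family of isomorphisms. -/
theorem contMDiffOn_coeff_along [FiniteDimensional ℝ FB] [ContMDiffVectorBundle ∞ FB V IB]
    {r : ℕ} {s : Fin r → ∀ y, V y} {U : Set B}
    (hs : IsLocalFrameOn IB FB ∞ s U) (hU : IsOpen U) {g : ∀ q, V (f q)}
    (hfU : ∀ q ∈ O, f q ∈ U)
    (hg : ContMDiffOn IQ (IB.prod 𝓘(ℝ, FB)) ∞ (fun q => (⟨f q, g q⟩ : TotalSpace FB V)) O)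
    (a : Fin r) : ContMDiffOn IQ 𝓘(ℝ, ℝ) ∞ (fun q => hs.coeff a (f q) (g q)) O := by
  intro q hq
  have h1 := contMDiffWithinAt_totalSpace.1 (hg q hq)
  set e := trivializationAt FB V (f q) with he
  have hx0 : f q ∈ e.baseSet := mem_baseSet_trivializationAt FB V (f q)
  -- `T x` sends coefficients to the vector of the fibre at `x`, read in the trivialization `e`.
  let T : B → (Fin r → ℝ) →L[ℝ] FB := fun x =>
    ∑ b, (ContinuousLinearMap.proj (R := ℝ) (φ := fun _ : Fin r => ℝ) b).smulRight
      (e ⟨x, s b x⟩).2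
  let Te : ∀ x, x ∈ U → x ∈ e.baseSet → (Fin r → ℝ) ≃L[ℝ] FB := fun x hx hxe =>
    ((hs.toBasisAt hx).equivFun.symm.trans (e.linearEquivAt ℝ x hxe)).toContinuousLinearEquiv
  have hTe : ∀ x (hx : x ∈ U) (hxe : x ∈ e.baseSet),
      (Te x hx hxe : (Fin r → ℝ) →L[ℝ] FB) = T x := by
    intro x hx hxe
    ext v
    simp [T, Te, Module.Basis.equivFun_symm_apply, map_sum]
  have hsm : ContMDiffAt IB 𝓘(ℝ, (Fin r → ℝ) →L[ℝ] FB) ∞ T (f q) := by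
    refine contMDiffAt_finsetSum fun b _ => ?_
    have hb : ContMDiffAt IB 𝓘(ℝ, FB) ∞ (fun x => (e ⟨x, s b x⟩).2) (f q) :=
      (contMDiffAt_section (f q)).1 (hs.contMDiffAt hU (hfU q hq) b)
    exact ((ContinuousLinearMap.smulRightL ℝ (Fin r → ℝ) FB
      (ContinuousLinearMap.proj b)).contMDiff.contMDiffAt).comp (f q) hb
  have hinv : ContMDiffAt IB 𝓘(ℝ, FB →L[ℝ] (Fin r → ℝ)) ∞
      (fun x => ContinuousLinearMap.inverse (T x)) (f q) := by
    have hmi := contDiffAt_map_inverse (𝕜 := ℝ) (n := ∞) (Te (f q) (hfU q hq) hx0)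
    rw [hTe] at hmi
    exact hmi.contMDiffAt.comp (f q) hsm
  have hall := ((hinv.comp_contMDiffWithinAt q h1.1).clm_apply h1.2)
  have key : ∀ q', f q' ∈ U → f q' ∈ e.baseSet →
      hs.coeff a (f q') (g q') =
        (ContinuousLinearMap.inverse (T (f q')) (e ⟨f q', g q'⟩).2) a := by
    intro q' h1 h2
    rw [← hTe _ h1 h2, ContinuousLinearMap.inverse_equiv]
    simp only [IsLocalFrameOn.coeff, h1, dif_pos, Module.Basis.coord_apply]
    have : (e ⟨f q', g q'⟩).2 = Te _ h1 h2 ((hs.toBasisAt h1).equivFun (g q')) := by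
      change _ = e.linearEquivAt ℝ _ h2 ((hs.toBasisAt h1).equivFun.symm _)
      rw [LinearEquiv.symm_apply_apply]
      rfl
    rw [this]
    simp
  have hp : ContMDiffWithinAt IQ 𝓘(ℝ, ℝ) ∞
      (fun q' => (ContinuousLinearMap.inverse (T (f q')) (e ⟨f q', g q'⟩).2) a) O q :=
    ((ContinuousLinearMap.proj (R := ℝ) (φ := fun _ : Fin r => ℝ) a).contMDiff.contMDiffAt
      |>.comp_contMDiffWithinAt q hall)
  refine hp.congr_of_eventuallyEq ?_ (key q (hfU q hq) hx0)
  filter_upwards [h1.1.continuousWithinAt (e.open_baseSet.mem_nhds hx0), self_mem_nhdsWithin]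
    with q' hq' hqO
  exact key q' (hfU q' hqO) hq'

end Along

/-! ### Tangent vectors at equal points -/

section Transport

variable {E H B : Type*} [NormedAddCommGroup E] [NormedSpace ℝ E] [TopologicalSpace H]
  {I : ModelWithCorners ℝ E H} [TopologicalSpace B] [ChartedSpace H B]

theorem mfderiv_transport_real (f : B → ℝ) {x y : B} (e : x = y) (X : TangentSpace I x) :
    (mfderiv I 𝓘(ℝ, ℝ) f y (transport e X) : ℝ) = mfderiv I 𝓘(ℝ, ℝ) f x X := by
  subst e; rfl

theorem mk_transport {x y : B} (e : x = y) (X : TangentSpace I x) :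
    (⟨y, transport e X⟩ : TangentBundle I B) = ⟨x, X⟩ := by
  subst e; rfl

@[simp]
theorem transport_rfl {x : B} (X : TangentSpace I x) : transport (rfl : x = x) X = X := rfl

theorem transport_eq_of_mk_eq {x y : B} (e : x = y) {X : TangentSpace I x} {Y : TangentSpace I y}
    (h : (⟨x, X⟩ : TangentBundle I B) = ⟨y, Y⟩) : transport e X = Y := by
  subst e
  simpa using h

end Transport

/-! ### Extending local sections and functions -/

section GlobalSections

variable {EB FB : Type*}
  [NormedAddCommGroup EB] [NormedSpace ℝ EB] [FiniteDimensional ℝ EB]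
  [NormedAddCommGroup FB] [NormedSpace ℝ FB]
  {B : Type*} [TopologicalSpace B] [T2Space B] [ChartedSpace EB B] [IsManifold 𝓘(ℝ, EB) ∞ B]
  {V : B → Type*} [TopologicalSpace (TotalSpace FB V)]
  [∀ y, AddCommGroup (V y)] [∀ y, Module ℝ (V y)] [∀ y, TopologicalSpace (V y)]
  [FiberBundle FB V] [VectorBundle ℝ FB V] [ContMDiffVectorBundle ∞ FB V 𝓘(ℝ, EB)]

theorem exists_smooth_bump {y : B} {U : Set B} (hU : U ∈ 𝓝 y) :
    ∃ χ : B → ℝ, ContMDiff 𝓘(ℝ, EB) 𝓘(ℝ, ℝ) ∞ χ ∧ (∀ᶠ z in 𝓝 y, χ z = 1) ∧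
      tsupport χ ⊆ U := by
  obtain ⟨f, -, hf⟩ := (SmoothBumpFunction.nhds_basis_tsupport (I := 𝓘(ℝ, EB)) y).mem_iff.1 hU
  exact ⟨f, f.contMDiff, f.eventuallyEq_one, hf⟩

theorem exists_section_eventuallyEq {U : Set B} (hU : IsOpen U) {y : B} (hy : y ∈ U)
    {t : ∀ z, V z} (ht : ContMDiffOn 𝓘(ℝ, EB) (𝓘(ℝ, EB).prod 𝓘(ℝ, FB)) ∞
      (fun z => (⟨z, t z⟩ : TotalSpace FB V)) U) :
    ∃ σ : Cₛ^∞⟮𝓘(ℝ, EB); FB, V⟯, ∀ᶠ z in 𝓝 y, σ z = t z := by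
  obtain ⟨χ, hχ, h1, hs⟩ := exists_smooth_bump (EB := EB) (hU.mem_nhds hy)
  refine ⟨⟨fun z => χ z • t z, ContMDiffOn.smul_section_of_tsupport hχ.contMDiffOn hU hs ht⟩, ?_⟩
  filter_upwards [h1] with z hz
  change χ z • t z = t z
  rw [hz, one_smul]

theorem exists_function_eventuallyEq {U : Set B} (hU : IsOpen U) {y : B} (hy : y ∈ U)
    {f : B → ℝ} (hf : ContMDiffOn 𝓘(ℝ, EB) 𝓘(ℝ, ℝ) ∞ f U) :
    ∃ g : B → ℝ, ContMDiff 𝓘(ℝ, EB) 𝓘(ℝ, ℝ) ∞ g ∧ ∀ᶠ z in 𝓝 y, g z = f z := by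
  obtain ⟨χ, hχ, h1, hs⟩ := exists_smooth_bump (EB := EB) (hU.mem_nhds hy)
  refine ⟨fun z => χ z * f z, ?_, ?_⟩
  · refine contMDiff_of_tsupport fun z hz => ?_
    have hz' : z ∈ U := hs (closure_mono (fun w hw => left_ne_zero_of_mul hw) hz)
    exact hχ.contMDiffAt.mul (hf.contMDiffAt (hU.mem_nhds hz'))
  · filter_upwards [h1] with z hz
    rw [hz, one_mul]

theorem exists_section_apply_eq (y : B) (z : V y) :
    ∃ σ : Cₛ^∞⟮𝓘(ℝ, EB); FB, V⟯, σ y = z := by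
  set e := trivializationAt FB V y with he
  have hy : y ∈ e.baseSet := mem_baseSet_trivializationAt FB V y
  have ht : ContMDiffOn 𝓘(ℝ, EB) (𝓘(ℝ, EB).prod 𝓘(ℝ, FB)) ∞
      (fun w => (⟨w, e.symm w (e ⟨y, z⟩).2⟩ : TotalSpace FB V)) e.baseSet := by
    rw [e.contMDiffOn_section_baseSet_iff]
    refine (contMDiffOn_const (c := (e ⟨y, z⟩).2)).congr fun w hw => ?_
    rw [e.apply_mk_symm hw]
  obtain ⟨σ, hσ⟩ := exists_section_eventuallyEq e.open_baseSet hy ht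
  exact ⟨σ, by rw [hσ.self_of_nhds]; exact e.symm_apply_apply_mk hy z⟩

/-- Tangent vectors are separated by the differentials of globally defined smooth functions. -/
theorem eq_zero_of_mfderiv_eq_zero (y : B) (X : TangentSpace 𝓘(ℝ, EB) y)
    (h : ∀ g : B → ℝ, ContMDiff 𝓘(ℝ, EB) 𝓘(ℝ, ℝ) ∞ g →
      (mfderiv 𝓘(ℝ, EB) 𝓘(ℝ, ℝ) g y X : ℝ) = 0) : X = 0 := by
  have hmd : MDifferentiableAt 𝓘(ℝ, EB) 𝓘(ℝ, EB) (extChartAt 𝓘(ℝ, EB) y) y :=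
    mdifferentiableAt_extChartAt (mem_chart_source EB y)
  have h0 : (mfderiv 𝓘(ℝ, EB) 𝓘(ℝ, EB) (extChartAt 𝓘(ℝ, EB) y) y X : EB) = 0 := by
    refine (Module.forall_dual_apply_eq_zero_iff ℝ (V := EB) _).1 fun (ℓ : EB →ₗ[ℝ] ℝ) => ?_
    have hl : ContMDiffOn 𝓘(ℝ, EB) 𝓘(ℝ, ℝ) ∞
        (fun z => ℓ.toContinuousLinearMap (extChartAt 𝓘(ℝ, EB) y z)) (chartAt EB y).source :=
      ℓ.toContinuousLinearMap.contMDiff.comp_contMDiffOn contMDiffOn_extChartAt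
    obtain ⟨g, hg, hge⟩ := exists_function_eventuallyEq (chartAt EB y).open_source
      (mem_chart_source EB y) hl
    have h1 := h g hg
    rw [Filter.EventuallyEq.mfderiv_eq hge] at h1
    have h2 := mfderiv_comp (I := 𝓘(ℝ, EB)) (I' := 𝓘(ℝ, EB)) (I'' := 𝓘(ℝ, ℝ)) y
      (ℓ.toContinuousLinearMap.contMDiff (n := ∞) |>.mdifferentiableAt (by simp)) hmd
    have h3 := DFunLike.congr_fun h2 X
    have h4 := h3.symm.trans h1
    rw [mfderiv_eq_fderiv, ContinuousLinearMap.fderiv] at h4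
    exact h4
  have hinj := (isInvertible_mfderiv_extChartAt (I := 𝓘(ℝ, EB))
    (mem_extChartAt_source (I := 𝓘(ℝ, EB)) y)).injective
  exact hinj (h0.trans (map_zero _).symm)

end GlobalSections

/-! ### Metric connections on a vector space with a frame -/

section Algebra

open Matrix

variable {n : ℕ}

/-- The matrix `B + ½ g⁻¹ (dg - Bᵀ g - g B)` of the connection which is obtained from the connection
with matrix `B` by adding the term that makes it compatible with the metric `g`. -/
def metrize (g dg B : Matrix (Fin n) (Fin n) ℝ) : Matrix (Fin n) (Fin n) ℝ :=
  B + (1 / 2 : ℝ) • (g⁻¹ * (dg - Bᵀ * g - g * B))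

variable {g dg B g' dg' B' Λ dΛ κ κ' : Matrix (Fin n) (Fin n) ℝ}

theorem mul_metrize (hg : IsUnit g.det) :
    g * metrize g dg B = g * B + (1 / 2 : ℝ) • (dg - Bᵀ * g - g * B) := by
  rw [metrize, Matrix.mul_add, Matrix.mul_smul, Matrix.mul_nonsing_inv_cancel_left _ _ hg]

/-- The connection `metrize g dg B` is compatible with the metric `g`. -/
theorem metrize_metric (hg : IsUnit g.det) (hs : gᵀ = g) (hds : dgᵀ = dg) :
    (metrize g dg B)ᵀ * g + g * metrize g dg B = dg := by
  have h1 : (metrize g dg B)ᵀ * g = (g * metrize g dg B)ᵀ := by rw [transpose_mul, hs]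
  rw [h1, mul_metrize hg]
  simp only [transpose_add, transpose_smul, transpose_sub, transpose_mul, transpose_transpose, hs,
    hds]
  ext i j
  simp only [Matrix.add_apply, Matrix.smul_apply, Matrix.sub_apply, smul_eq_mul]
  ring

/-- Making a connection metric commutes with a change of frame `Λ`: if the matrices `B`, `B'` obey
the transformation law of a connection, then so do their metrizations. -/
theorem metrize_change (hg : IsUnit g.det) (hs : gᵀ = g) (hΛ : IsUnit Λ.det)
    (hg' : g' = Λᵀ * g * Λ) (hdg' : dg' = dΛᵀ * g * Λ + Λᵀ * dg * Λ + Λᵀ * g * dΛ)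
    (hB : Λ * B' = dΛ + B * Λ) :
    Λ * metrize g' dg' B' = dΛ + metrize g dg B * Λ := by
  have hu' : IsUnit g'.det := by
    rw [hg', det_mul, det_mul, det_transpose]
    exact (hΛ.mul hg).mul hΛ
  have hu : IsUnit (Λᵀ * g).det := by
    rw [det_mul, det_transpose]
    exact hΛ.mul hg
  have hgB : g' * B' = Λᵀ * g * dΛ + Λᵀ * (g * B) * Λ := by
    rw [hg', Matrix.mul_assoc, hB, Matrix.mul_add]
    simp only [Matrix.mul_assoc]
  have hs' : g'ᵀ = g' := by
    rw [hg']
    simp only [transpose_mul, transpose_transpose, hs, Matrix.mul_assoc]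
  have hBg : B'ᵀ * g' = dΛᵀ * g * Λ + Λᵀ * (Bᵀ * g) * Λ := by
    have h1 : B'ᵀ * g' = (g' * B')ᵀ := by rw [transpose_mul, hs']
    rw [h1, hgB]
    simp only [transpose_add, transpose_mul, transpose_transpose, hs, Matrix.mul_assoc]
  have key : (Λᵀ * g) * (Λ * metrize g' dg' B') = (Λᵀ * g) * (dΛ + metrize g dg B * Λ) := by
    rw [← Matrix.mul_assoc, ← hg', mul_metrize hu', hgB, hBg, hdg', Matrix.mul_add,
      Matrix.mul_assoc Λᵀ g (_ * Λ), ← Matrix.mul_assoc g, mul_metrize hg]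
    ext i j
    simp only [Matrix.mul_add, Matrix.add_mul, Matrix.mul_sub, Matrix.sub_mul, Matrix.mul_smul,
      Matrix.smul_mul, Matrix.mul_assoc, Matrix.add_apply, Matrix.smul_apply, Matrix.sub_apply,
      smul_eq_mul]
    ring
  have h2 := congrArg (fun Z => (Λᵀ * g)⁻¹ * Z) key
  simpa only [Matrix.nonsing_inv_mul_cancel_left _ _ hu] using h2

/-- Compatibility with the metric does not depend on the frame. -/
theorem metric_change (hs : gᵀ = g)
    (hg' : g' = Λᵀ * g * Λ) (hdg' : dg' = dΛᵀ * g * Λ + Λᵀ * dg * Λ + Λᵀ * g * dΛ)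
    (hm : κᵀ * g + g * κ = dg) (hκ : Λ * κ' = dΛ + κ * Λ) :
    κ'ᵀ * g' + g' * κ' = dg' := by
  have h1 : g' * κ' = Λᵀ * g * dΛ + Λᵀ * (g * κ) * Λ := by
    rw [hg', Matrix.mul_assoc, hκ, Matrix.mul_add]
    simp only [Matrix.mul_assoc]
  have hs' : g'ᵀ = g' := by
    rw [hg']
    simp only [transpose_mul, transpose_transpose, hs, Matrix.mul_assoc]
  have h2 : κ'ᵀ * g' = dΛᵀ * g * Λ + Λᵀ * (κᵀ * g) * Λ := by
    have h3 : κ'ᵀ * g' = (g' * κ')ᵀ := by rw [transpose_mul, hs']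
    rw [h3, h1]
    simp only [transpose_add, transpose_mul, transpose_transpose, hs, Matrix.mul_assoc]
  rw [h1, h2, hdg', ← hm]
  simp only [Matrix.mul_add, Matrix.add_mul]
  abel

/-- The matrices of the Levi-Civita connection, given by the Koszul formula in a frame with
structure functions `L`; here `dg γ` is the derivative of `g` along the `γ`-th vector of the
frame. -/
def leviCivita (g : Matrix (Fin n) (Fin n) ℝ) (dg : Fin n → Matrix (Fin n) (Fin n) ℝ)
    (L : Fin n → Fin n → Fin n → ℝ) (γ : Fin n) : Matrix (Fin n) (Fin n) ℝ :=
  Matrix.of fun α β => 1 / 2 * ∑ ε, g⁻¹ α ε *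
    (dg γ ε β + dg β ε γ - dg ε β γ +
      ∑ θ, (g θ ε * L θ γ β - g β θ * L θ γ ε - g θ γ * L θ β ε))

variable {dgs dgs' : Fin n → Matrix (Fin n) (Fin n) ℝ} {L L' : Fin n → Fin n → Fin n → ℝ}

theorem mul_leviCivita (hg : IsUnit g.det) (ε β γ : Fin n) :
    (g * leviCivita g dgs L γ) ε β = 1 / 2 * (dgs γ ε β + dgs β ε γ - dgs ε β γ +
      ∑ θ, (g θ ε * L θ γ β - g β θ * L θ γ ε - g θ γ * L θ β ε)) := by
  have h1 : leviCivita g dgs L γ = (1 / 2 : ℝ) • (g⁻¹ * Matrix.of fun ε β =>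
      (dgs γ ε β + dgs β ε γ - dgs ε β γ +
        ∑ θ, (g θ ε * L θ γ β - g β θ * L θ γ ε - g θ γ * L θ β ε))) := by
    ext α β
    simp [leviCivita, Matrix.mul_apply]
  rw [h1, Matrix.mul_smul, Matrix.mul_nonsing_inv_cancel_left _ _ hg]
  simp

/-- The connection given by the Koszul formula is compatible with the metric. -/
theorem leviCivita_metric (hg : IsUnit g.det) (hs : gᵀ = g) (hds : ∀ γ, (dgs γ)ᵀ = dgs γ)
    (hL : ∀ θ α β, L θ α β = -L θ β α) (γ : Fin n) :
    (leviCivita g dgs L γ)ᵀ * g + g * leviCivita g dgs L γ = dgs γ := by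
  have h1 : (leviCivita g dgs L γ)ᵀ * g = (g * leviCivita g dgs L γ)ᵀ := by
    rw [transpose_mul, hs]
  have hs' : ∀ i j, g i j = g j i := fun i j => congrFun (congrFun hs j) i
  have hds' : ∀ γ i j, dgs γ i j = dgs γ j i := fun γ i j => congrFun (congrFun (hds γ) j) i
  ext ε β
  rw [h1, Matrix.add_apply, transpose_apply, mul_leviCivita hg, mul_leviCivita hg]
  have h2 : ∑ θ, (g θ β * L θ γ ε - g ε θ * L θ γ β - g θ γ * L θ ε β) =
      -∑ θ, (g θ ε * L θ γ β - g β θ * L θ γ ε - g θ γ * L θ β ε) := by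
    rw [← Finset.sum_neg_distrib]
    refine Finset.sum_congr rfl fun θ _ => ?_
    rw [hs' θ β, hs' θ ε, hL θ ε β]
    ring
  rw [h2, hds' γ β ε, hds' ε β γ, hds' β ε γ]
  ring

/-- The connection given by the Koszul formula has torsion zero. -/
theorem leviCivita_torsion (hg : IsUnit g.det) (hs : gᵀ = g) (hds : ∀ γ, (dgs γ)ᵀ = dgs γ)
    (hL : ∀ θ α β, L θ α β = -L θ β α) (α β γ : Fin n) :
    leviCivita g dgs L γ α β - leviCivita g dgs L β α γ = L α γ β := by
  have hs' : ∀ i j, g i j = g j i := fun i j => congrFun (congrFun hs j) i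
  have hds' : ∀ γ i j, dgs γ i j = dgs γ j i := fun γ i j => congrFun (congrFun (hds γ) j) i
  have key : g *ᵥ (fun α => leviCivita g dgs L γ α β - leviCivita g dgs L β α γ) =
      g *ᵥ fun α => L α γ β := by
    funext ε
    have h1 : (g *ᵥ fun α => leviCivita g dgs L γ α β - leviCivita g dgs L β α γ) ε =
        (g * leviCivita g dgs L γ) ε β - (g * leviCivita g dgs L β) ε γ := by
      simp only [mulVec, dotProduct, mul_sub, Finset.sum_sub_distrib, Matrix.mul_apply]
    rw [h1, mul_leviCivita hg, mul_leviCivita hg, hds' ε β γ]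
    have h2 : (g *ᵥ fun α => L α γ β) ε = (1 / 2 : ℝ) *
        (∑ θ, (g θ ε * L θ γ β - g β θ * L θ γ ε - g θ γ * L θ β ε) -
          ∑ θ, (g θ ε * L θ β γ - g γ θ * L θ β ε - g θ β * L θ γ ε)) := by
      rw [← Finset.sum_sub_distrib, Finset.mul_sum, mulVec, dotProduct]
      refine Finset.sum_congr rfl fun θ _ => ?_
      rw [hL θ β γ, hs' ε θ, hs' γ θ, hs' β θ]
      ring
    rw [h2]
    ring
  exact congrFun
    (Matrix.mulVec_injective_iff_isUnit.2 ((Matrix.isUnit_iff_isUnit_det _).2 hg) key) α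

/-- The connection that is metric and has torsion zero is unique. -/
theorem eq_leviCivita (hg : IsUnit g.det) (hs : gᵀ = g)
    {κ : Fin n → Matrix (Fin n) (Fin n) ℝ} (hm : ∀ γ, (κ γ)ᵀ * g + g * κ γ = dgs γ)
    (ht : ∀ α β γ, κ γ α β - κ β α γ = L α γ β) (γ : Fin n) :
    κ γ = leviCivita g dgs L γ := by
  have hs' : ∀ i j, g i j = g j i := fun i j => congrFun (congrFun hs j) i
  have hm' : ∀ γ ε β, (g * κ γ) β ε + (g * κ γ) ε β = dgs γ ε β := by
    intro γ ε β
    have h1 : (κ γ)ᵀ * g = (g * κ γ)ᵀ := by rw [transpose_mul, hs]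
    have h2 := hm γ
    rw [h1] at h2
    exact congrFun (congrFun h2 ε) β
  have ht' : ∀ ε β γ, (g * κ γ) ε β - (g * κ β) ε γ = ∑ θ, g θ ε * L θ γ β := by
    intro ε β γ
    simp only [Matrix.mul_apply, ← Finset.sum_sub_distrib, ← mul_sub, ht, hs' ε]
  have key : g * κ γ = g * leviCivita g dgs L γ := by
    ext ε β
    rw [mul_leviCivita hg]
    have h1 : ∑ θ, g β θ * L θ γ ε = ∑ θ, g θ β * L θ γ ε :=
      Finset.sum_congr rfl fun θ _ => by rw [hs']
    rw [Finset.sum_sub_distrib, Finset.sum_sub_distrib, h1, ← ht' ε β γ, ← ht' β ε γ,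
      ← ht' γ ε β, ← hm' γ, ← hm' β, ← hm' ε]
    ring
  have h2 := congrArg (fun Z => g⁻¹ * Z) key
  simpa only [Matrix.nonsing_inv_mul_cancel_left _ _ hg] using h2

/-- The Koszul formula is independent of the frame. The hypothesis `hL'` is the transformation law
of structure functions; `dΛs γ` is the derivative of `Λ` along the `γ`-th vector of the new frame,
so the directions of differentiation change by `Λ` too. -/
theorem leviCivita_change {dΛs : Fin n → Matrix (Fin n) (Fin n) ℝ}
    (hg : IsUnit g.det) (hs : gᵀ = g) (hds : ∀ γ, (dgs γ)ᵀ = dgs γ)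
    (hL : ∀ θ α β, L θ α β = -L θ β α) (hΛ : IsUnit Λ.det) (hg' : g' = Λᵀ * g * Λ)
    (hdg' : ∀ γ, dgs' γ = (dΛs γ)ᵀ * g * Λ + Λᵀ * (∑ ν, Λ ν γ • dgs ν) * Λ + Λᵀ * g * dΛs γ)
    (hL' : ∀ μ γ β, ∑ θ, Λ μ θ * L' θ γ β =
      ∑ α, ∑ ν, Λ α γ * Λ ν β * L μ α ν + dΛs γ μ β - dΛs β μ γ) (γ : Fin n) :
    Λ * leviCivita g' dgs' L' γ = dΛs γ + (∑ ν, Λ ν γ • leviCivita g dgs L ν) * Λ := by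
  have hu' : IsUnit g'.det := by
    rw [hg', det_mul, det_mul, det_transpose]
    exact (hΛ.mul hg).mul hΛ
  have hs' : g'ᵀ = g' := by
    rw [hg']
    simp only [transpose_mul, transpose_transpose, hs, Matrix.mul_assoc]
  -- `Λ⁻¹ τ` is the old connection in the new frame. By uniqueness it suffices that it is metric and
  -- has torsion zero.
  set τ : Fin n → Matrix (Fin n) (Fin n) ℝ := fun γ =>
    dΛs γ + (∑ ν, Λ ν γ • leviCivita g dgs L ν) * Λ with hτ
  have hΛκ : ∀ γ, Λ * (Λ⁻¹ * τ γ) = τ γ := fun γ => Matrix.mul_nonsing_inv_cancel_left _ _ hΛ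
  have hmet : ∀ γ, (Λ⁻¹ * τ γ)ᵀ * g' + g' * (Λ⁻¹ * τ γ) = dgs' γ := by
    intro γ
    refine metric_change hs hg' (hdg' γ) ?_ (hΛκ γ)
    simp only [transpose_sum, transpose_smul, Finset.sum_mul, Finset.mul_sum, Matrix.smul_mul,
      Matrix.mul_smul, ← Finset.sum_add_distrib, ← smul_add]
    exact Finset.sum_congr rfl fun ν _ => by rw [leviCivita_metric hg hs hds hL]
  have htor : ∀ α β γ, (Λ⁻¹ * τ γ) α β - (Λ⁻¹ * τ β) α γ = L' α γ β := by
    intro α β γ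
    have key : Λ *ᵥ (fun α => (Λ⁻¹ * τ γ) α β - (Λ⁻¹ * τ β) α γ) = Λ *ᵥ fun α => L' α γ β := by
      funext μ
      have h1 : (Λ *ᵥ fun α => (Λ⁻¹ * τ γ) α β - (Λ⁻¹ * τ β) α γ) μ =
          (Λ * (Λ⁻¹ * τ γ)) μ β - (Λ * (Λ⁻¹ * τ β)) μ γ := by
        simp only [mulVec, dotProduct, mul_sub, Finset.sum_sub_distrib, Matrix.mul_apply]
      have h2 : (Λ *ᵥ fun α => L' α γ β) μ = ∑ θ, Λ μ θ * L' θ γ β := rfl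
      have h3 : ∀ γ β, ((∑ ν, Λ ν γ • leviCivita g dgs L ν) * Λ) μ β =
          ∑ α, ∑ ν, Λ α γ * Λ ν β * leviCivita g dgs L α μ ν := by
        intro γ β
        simp only [Matrix.mul_apply, Matrix.sum_apply, Matrix.smul_apply, smul_eq_mul,
          Finset.sum_mul]
        rw [Finset.sum_comm]
        exact Finset.sum_congr rfl fun _ _ => Finset.sum_congr rfl fun _ _ => by ring
      have h4 : ∑ α, ∑ ν, Λ α β * Λ ν γ * leviCivita g dgs L α μ ν =
          ∑ α, ∑ ν, Λ α γ * Λ ν β * leviCivita g dgs L ν μ α := by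
        rw [Finset.sum_comm]
        exact Finset.sum_congr rfl fun _ _ => Finset.sum_congr rfl fun _ _ => by ring
      rw [h1, hΛκ, hΛκ, h2, hL', hτ]
      simp only [Matrix.add_apply, h3]
      rw [h4]
      have h5 : ∑ α, ∑ ν, Λ α γ * Λ ν β * leviCivita g dgs L α μ ν -
          ∑ α, ∑ ν, Λ α γ * Λ ν β * leviCivita g dgs L ν μ α =
          ∑ α, ∑ ν, Λ α γ * Λ ν β * L μ α ν := by
        simp only [← Finset.sum_sub_distrib, ← mul_sub, leviCivita_torsion hg hs hds hL]
      linarith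
    exact congrFun
      (Matrix.mulVec_injective_iff_isUnit.2 ((Matrix.isUnit_iff_isUnit_det _).2 hΛ) key) α
  rw [← eq_leviCivita hu' hs' hmet htor γ, hΛκ]

theorem metrize_sum {ι : Type*} [Fintype ι] (g : Matrix (Fin n) (Fin n) ℝ) (c : ι → ℝ)
    (dg B : ι → Matrix (Fin n) (Fin n) ℝ) :
    metrize g (∑ i, c i • dg i) (∑ i, c i • B i) = ∑ i, c i • metrize g (dg i) (B i) := by
  simp only [metrize, smul_add, Finset.sum_add_distrib, transpose_sum, transpose_smul,
    Matrix.sum_mul, Matrix.mul_sum, Matrix.smul_mul, Matrix.mul_smul, Matrix.mul_sub,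
    Finset.smul_sum, smul_sub, Finset.sum_sub_distrib]
  simp only [smul_comm (1 / 2 : ℝ)]

end Algebra

section GeneralizedTangentBundle

variable {EM EN FF FP : Type*}
  [NormedAddCommGroup EM] [NormedSpace ℝ EM] [FiniteDimensional ℝ EM]
  [NormedAddCommGroup EN] [NormedSpace ℝ EN] [FiniteDimensional ℝ EN]
  [NormedAddCommGroup FF] [NormedSpace ℝ FF] [FiniteDimensional ℝ FF]
  [NormedAddCommGroup FP] [NormedSpace ℝ FP] [FiniteDimensional ℝ FP]
  {M N : Type*}
  [TopologicalSpace M] [ChartedSpace EM M] [IsManifold 𝓘(ℝ, EM) ∞ M]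
  [TopologicalSpace N] [T2Space N] [ChartedSpace EN N] [IsManifold 𝓘(ℝ, EN) ∞ N]
  {F : N → Type*} [TopologicalSpace (TotalSpace FF F)]
  [∀ y, AddCommGroup (F y)] [∀ y, Module ℝ (F y)] [∀ y, TopologicalSpace (F y)]
  [FiberBundle FF F] [VectorBundle ℝ FF F] [ContMDiffVectorBundle ∞ FF F 𝓘(ℝ, EN)]
  {P : M → Type*} [TopologicalSpace (TotalSpace FP P)]
  [∀ x, AddCommGroup (P x)] [∀ x, Module ℝ (P x)] [∀ x, TopologicalSpace (P x)]
  [FiberBundle FP P] [VectorBundle ℝ FP P] [ContMDiffVectorBundle ∞ FP P 𝓘(ℝ, EM)]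
  {h : M ≃ₘ^∞⟮𝓘(ℝ, EM), 𝓘(ℝ, EN)⟯ N} {η : N ≃ₘ^∞⟮𝓘(ℝ, EN), 𝓘(ℝ, EM)⟯ M}

/-! ### Locality of the bracket and the anchor -/

section Algebroid

namespace GenLieAlgebroid

/-- The product of a smooth function and a smooth section. -/
def fsmul (f : N → ℝ) (hf : ContMDiff 𝓘(ℝ, EN) 𝓘(ℝ, ℝ) ∞ f) (σ : Cₛ^∞⟮𝓘(ℝ, EN); FF, F⟯) :
    Cₛ^∞⟮𝓘(ℝ, EN); FF, F⟯ :=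
  ⟨fun z => f z • σ z, hf.smul_section σ.contMDiff⟩

@[simp]
theorem fsmul_apply (f : N → ℝ) (hf : ContMDiff 𝓘(ℝ, EN) 𝓘(ℝ, ℝ) ∞ f)
    (σ : Cₛ^∞⟮𝓘(ℝ, EN); FF, F⟯) (z : N) : fsmul f hf σ z = f z • σ z := rfl

theorem section_sum_apply {ι : Type*} (S : Finset ι) (v : ι → Cₛ^∞⟮𝓘(ℝ, EN); FF, F⟯) (y : N) :
    (∑ i ∈ S, v i) y = ∑ i ∈ S, v i y := by
  classical
  induction S using Finset.induction_on with
  | empty => rfl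
  | insert i S hi ih => rw [Finset.sum_insert hi, Finset.sum_insert hi, ← ih]; rfl

variable (A : GenLieAlgebroid FF F h η)

/-- The bracket is local: multiply `σ` by a function that is `1` on its support and `0` at `y`,
and use the Leibniz rule. -/
theorem bracket_apply_eq_zero {u σ : Cₛ^∞⟮𝓘(ℝ, EN); FF, F⟯} {y : N}
    (hσ : ∀ᶠ z in 𝓝 y, σ z = 0) : A.bracket u σ y = 0 := by
  obtain ⟨χ, hχ, h1, hs⟩ := exists_smooth_bump (EB := EN) hσ
  have hl := A.leibniz u σ σ (fun z => 1 - χ z) (contMDiff_const.sub hχ) (fun z => by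
    by_cases hz : χ z = 0
    · simp [hz]
    · have : σ z = 0 := hs (subset_tsupport _ hz)
      simp [this]) y
  simpa [h1.self_of_nhds, hσ.self_of_nhds] using hl

theorem bracket_congr {u u' σ σ' : Cₛ^∞⟮𝓘(ℝ, EN); FF, F⟯} {y : N}
    (hu : ∀ᶠ z in 𝓝 y, u z = u' z) (hσ : ∀ᶠ z in 𝓝 y, σ z = σ' z) :
    A.bracket u σ y = A.bracket u' σ' y := by
  have key : ∀ (u σ σ' : Cₛ^∞⟮𝓘(ℝ, EN); FF, F⟯), (∀ᶠ z in 𝓝 y, σ z = σ' z) →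
      A.bracket u σ y = A.bracket u σ' y := by
    intro u σ σ' hσ
    have h1 : σ = σ' + (σ - σ') := by abel
    have h2 : A.bracket u (σ - σ') y = 0 := A.bracket_apply_eq_zero (by
      filter_upwards [hσ] with z hz
      simp [hz])
    rw [h1, A.bracket_add]
    simp [h2]
  rw [key u σ σ' hσ, A.bracket_skew u, A.bracket_skew u']
  simp [key σ' u u' hu]

theorem bracket_sum {ι : Type*} (S : Finset ι) (u : Cₛ^∞⟮𝓘(ℝ, EN); FF, F⟯)
    (v : ι → Cₛ^∞⟮𝓘(ℝ, EN); FF, F⟯) (y : N) :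
    A.bracket u (∑ i ∈ S, v i) y = ∑ i ∈ S, A.bracket u (v i) y := by
  have h1 : A.bracket u (∑ i ∈ S, v i) = ∑ i ∈ S, A.bracket u (v i) :=
    map_sum (AddMonoidHom.mk' (A.bracket u) (A.bracket_add u)) v S
  rw [h1, section_sum_apply]

/-- The Leibniz rule for a section that is near `y` a combination of the sections `σ i`. -/
theorem bracket_eq_sum_of_eventuallyEq {ι : Type*} [Fintype ι] {u v : Cₛ^∞⟮𝓘(ℝ, EN); FF, F⟯}
    {σ : ι → Cₛ^∞⟮𝓘(ℝ, EN); FF, F⟯} {g : ι → N → ℝ}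
    (hg : ∀ i, ContMDiff 𝓘(ℝ, EN) 𝓘(ℝ, ℝ) ∞ (g i)) {y : N}
    (hv : ∀ᶠ z in 𝓝 y, v z = ∑ i, g i z • σ i z) :
    A.bracket u v y = ∑ i, (g i y • A.bracket u (σ i) y +
      dirDeriv (g i) y (anchorFieldOf h η A.ρ (fun n => u n) y) • σ i y) := by
  have h1 : A.bracket u v y = A.bracket u (∑ i, fsmul (g i) (hg i) (σ i)) y := by
    refine A.bracket_congr (Filter.Eventually.of_forall fun _ => rfl) ?_
    filter_upwards [hv] with z hz
    rw [hz, section_sum_apply]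
    rfl
  rw [h1, A.bracket_sum]
  exact Finset.sum_congr rfl fun i _ => A.leibniz u (σ i) _ (g i) (hg i) (fun _ => rfl) y

theorem anchorFieldOf_apply (ρ : ∀ n : N, F n →ₗ[ℝ] TangentSpace 𝓘(ℝ, EM) (η n))
    (u : ∀ n : N, F n) (n : N) :
    anchorFieldOf h η ρ u (h (η n)) =
      mfderiv 𝓘(ℝ, EM) 𝓘(ℝ, EN) h (η n) (ρ n (u n)) := by
  refine transport_eq_of_mk_eq _ ?_
  have : η.symm (h.symm (h (η n))) = n := by simp
  rw [this]

theorem mfderiv_h_eq_zero {x : M} {X : TangentSpace 𝓘(ℝ, EM) x}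
    (hX : mfderiv 𝓘(ℝ, EM) 𝓘(ℝ, EN) h x X = 0) : X = 0 :=
  (h.mfderivToContinuousLinearEquiv (by simp) x).injective (hX.trans (map_zero _).symm)

/-- Where `h ∘ η` moves the base point, the anchor vanishes: a section with a given value at `n`
can be chosen to be zero near `h (η n)`. Then its brackets vanish at `h (η n)`, and the Leibniz
rule leaves only the derivative along the anchor, which involves the value at `n`. -/
theorem rho_eq_zero {n : N} (hn : h (η n) ≠ n) : A.ρ n = 0 := by
  ext z
  by_cases hz : z = 0
  · simp [hz]
  set y := h (η n) with hy
  obtain ⟨w, hw⟩ := exists_section_apply_eq (EB := EN) (FB := FF) (V := F) n z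
  obtain ⟨χ, hχ, h1, hs⟩ := exists_smooth_bump (EB := EN) (isOpen_ne.mem_nhds hn.symm)
  have hw0 : ∀ᶠ z in 𝓝 y, fsmul χ hχ w z = 0 := by
    have : (tsupport χ)ᶜ ∈ 𝓝 y := (isClosed_tsupport χ).isOpen_compl.mem_nhds fun hc => hs hc rfl
    filter_upwards [this] with z hz
    simp [image_eq_zero_of_notMem_tsupport hz]
  -- The Leibniz rule says something only where the fibre is not zero.
  obtain ⟨v₀, hv₀⟩ : ∃ v₀ : F y, v₀ ≠ 0 := by
    let e₁ := (trivializationAt FF F n).linearEquivAt ℝ n (mem_baseSet_trivializationAt FF F n)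
    let e₂ := (trivializationAt FF F y).linearEquivAt ℝ y (mem_baseSet_trivializationAt FF F y)
    exact ⟨e₂.symm (e₁ z), by simpa using hz⟩
  obtain ⟨v, hv⟩ := exists_section_apply_eq (EB := EN) (FB := FF) (V := F) y v₀
  have hbr : ∀ σ, A.bracket (fsmul χ hχ w) σ y = 0 := fun σ => by
    rw [A.bracket_skew]
    simp [A.bracket_apply_eq_zero hw0]
  have hzero : anchorFieldOf h η A.ρ (fun n => fsmul χ hχ w n) y = 0 := by
    refine eq_zero_of_mfderiv_eq_zero y _ fun g hg => ?_
    have hl := A.leibniz (fsmul χ hχ w) v (fsmul g hg v) g hg (fun _ => rfl) y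
    rw [hbr, hbr, smul_zero, zero_add, hv] at hl
    exact (smul_eq_zero.1 hl.symm).resolve_right hv₀
  rw [hy, anchorFieldOf_apply] at hzero
  have := mfderiv_h_eq_zero hzero
  simpa [h1.self_of_nhds, hw] using this

/-- The anchor of `h^* F` is given by `ρ` on the fibre over `η⁻¹ x`. -/
theorem mk_anchorAt (u : ∀ n : N, F n) (x : M) :
    (⟨x, A.anchorAt x (u (h x))⟩ : TangentBundle 𝓘(ℝ, EM) M) =
      ⟨η (η.symm x), A.ρ (η.symm x) (u (η.symm x))⟩ := by
  unfold anchorAt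
  by_cases e : η (h x) = x
  · have e' : η.symm x = h x := η.injective (by simp [e])
    rw [dif_pos e, e']
    exact mk_transport e _
  · have hn : h (η (η.symm x)) ≠ η.symm x := by
      intro hc
      simp only [Diffeomorph.apply_symm_apply] at hc
      exact e (by rw [hc]; simp)
    rw [dif_neg e, A.rho_eq_zero hn]
    have hx : η (η.symm x) = x := by simp
    rw [hx]
    rfl

theorem anchorAt_apply (u : ∀ n : N, F n) (n : N) :
    A.anchorAt (η n) (u (h (η n))) = A.ρ n (u n) := by
  have h1 := A.mk_anchorAt u (η n)
  rw [Diffeomorph.symm_apply_apply] at h1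
  simpa using h1

/-- The derivative along `Γ(Th ∘ ρ, h ∘ η)(u)` is the derivative on `M` along the anchor. -/
theorem dirDeriv_anchorFieldOf (u : ∀ n : N, F n) {f : N → ℝ} {x : M}
    (hf : MDifferentiableAt 𝓘(ℝ, EN) 𝓘(ℝ, ℝ) f (h x)) :
    dirDeriv f (h x) (anchorFieldOf h η A.ρ u (h x)) =
      (mfderiv 𝓘(ℝ, EM) 𝓘(ℝ, ℝ) (fun x => f (h x)) x (A.anchorAt x (u (h x))) : ℝ) := by
  obtain ⟨n, rfl⟩ : ∃ n, η n = x := ⟨η.symm x, by simp⟩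
  rw [anchorFieldOf_apply, A.anchorAt_apply]
  have h1 := mfderiv_comp (I := 𝓘(ℝ, EM)) (I' := 𝓘(ℝ, EN)) (I'' := 𝓘(ℝ, ℝ)) (η n) hf
    (h.contMDiff.mdifferentiableAt (by simp))
  exact (DFunLike.congr_fun h1 _).symm

/-- The derivative at `x` of a function on `M` along the anchor of `z ∈ F_{h x}`. -/
def baseDeriv (f : M → ℝ) (x : M) : F (h x) →ₗ[ℝ] ℝ :=
  (mfderiv 𝓘(ℝ, EM) 𝓘(ℝ, ℝ) f x).toLinearMap.comp (A.anchorAt x)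

theorem dirDeriv_eq_baseDeriv {u : ∀ n : N, F n} {f g : N → ℝ} {x : M}
    (hf : ContMDiff 𝓘(ℝ, EN) 𝓘(ℝ, ℝ) ∞ f) (hfg : ∀ᶠ z in 𝓝 (h x), f z = g z) :
    dirDeriv f (h x) (anchorFieldOf h η A.ρ u (h x)) =
      A.baseDeriv (fun x => g (h x)) x (u (h x)) := by
  rw [A.dirDeriv_anchorFieldOf u (hf.mdifferentiableAt (by simp))]
  have h1 : (fun x => f (h x)) =ᶠ[𝓝 x] fun x => g (h x) :=
    h.continuous.continuousAt.eventually hfg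
  rw [h1.mfderiv_eq]
  rfl

/-- The anchor of `h^* F` is smooth, since it is smooth as a map over `η⁻¹`. -/
theorem contMDiffOn_anchorAt {U : Set M} (hU : IsOpen U) {t : ∀ y, F y}
    (ht : ContMDiffOn 𝓘(ℝ, EN) (𝓘(ℝ, EN).prod 𝓘(ℝ, FF)) ∞
      (fun y => (⟨y, t y⟩ : TotalSpace FF F)) (h '' U)) :
    ContMDiffOn 𝓘(ℝ, EM) 𝓘(ℝ, EM).tangent ∞
      (fun x => (⟨x, A.anchorAt x (t (h x))⟩ : TangentBundle 𝓘(ℝ, EM) M)) U := by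
  intro x hx
  have hhU : IsOpen (h '' U) := h.toHomeomorph.isOpenMap U hU
  obtain ⟨σ, hσ⟩ := exists_section_eventuallyEq hhU (mem_image_of_mem h hx) ht
  have h1 : ContMDiff 𝓘(ℝ, EM) 𝓘(ℝ, EM).tangent ∞
      (fun x => (⟨x, A.anchorAt x (σ (h x))⟩ : TangentBundle 𝓘(ℝ, EM) M)) := by
    have h2 := (A.contMDiff_ρ.comp σ.contMDiff).comp η.symm.contMDiff
    convert! h2 using 1
    funext x
    exact A.mk_anchorAt (fun n => σ n) x
  refine ((h1 x).congr_of_eventuallyEq ?_).contMDiffWithinAt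
  have h3 := h.continuous.continuousAt.eventually hσ
  filter_upwards [h3] with z hz
  rw [hz]

end GenLieAlgebroid

/-! ### Structure functions -/

variable {p r : ℕ} (A : GenLieAlgebroid FF F h η)

namespace VChart

variable (C : VChart FF FP F P h p r)

theorem isOpen_image : IsOpen (h '' C.U) := h.toHomeomorph.isOpenMap _ C.isOpen_U

theorem exists_section (α : Fin p) {y : N} (hy : y ∈ h '' C.U) :
    ∃ σ : Cₛ^∞⟮𝓘(ℝ, EN); FF, F⟯, ∀ᶠ z in 𝓝 y, σ z = C.t α z :=
  exists_section_eventuallyEq C.isOpen_image hy (C.frame_t.contMDiffOn α)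

/-- The structure functions do not depend on the sections that represent the germs of the frame. -/
theorem structFun_eq (γ α β : Fin p) {y : N}
    {σ τ : Cₛ^∞⟮𝓘(ℝ, EN); FF, F⟯} (hσ : ∀ᶠ z in 𝓝 y, σ z = C.t α z)
    (hτ : ∀ᶠ z in 𝓝 y, τ z = C.t β z) :
    C.structFun A γ α β y = C.frame_t.coeff γ y (A.bracket σ τ y) := by
  have e : ∃ σ τ : Cₛ^∞⟮𝓘(ℝ, EN); FF, F⟯,
      (∀ᶠ z in 𝓝 y, σ z = C.t α z) ∧ (∀ᶠ z in 𝓝 y, τ z = C.t β z) := ⟨σ, τ, hσ, hτ⟩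
  unfold structFun
  rw [dif_pos e]
  congr 1
  refine A.bracket_congr ?_ ?_
  · filter_upwards [hσ, e.choose_spec.choose_spec.1] with z h1 h2
    rw [h1, h2]
  · filter_upwards [hτ, e.choose_spec.choose_spec.2] with z h1 h2
    rw [h1, h2]

theorem bracket_eq_sum (α β : Fin p) {y : N} (hy : y ∈ h '' C.U)
    {σ τ : Cₛ^∞⟮𝓘(ℝ, EN); FF, F⟯} (hσ : ∀ᶠ z in 𝓝 y, σ z = C.t α z)
    (hτ : ∀ᶠ z in 𝓝 y, τ z = C.t β z) :
    A.bracket σ τ y = ∑ γ, C.structFun A γ α β y • C.t γ y := by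
  simp only [C.structFun_eq A _ α β hσ hτ]
  exact C.frame_t.coeff_sum_eq (fun z => A.bracket σ τ z) hy

theorem structFun_skew (γ α β : Fin p) {y : N} (hy : y ∈ h '' C.U) :
    C.structFun A γ α β y = -C.structFun A γ β α y := by
  obtain ⟨σ, hσ⟩ := C.exists_section α hy
  obtain ⟨τ, hτ⟩ := C.exists_section β hy
  rw [C.structFun_eq A γ α β hσ hτ, C.structFun_eq A γ β α hτ hσ, A.bracket_skew]
  simp

theorem contMDiffOn_structFun (γ α β : Fin p) :
    ContMDiffOn 𝓘(ℝ, EN) 𝓘(ℝ, ℝ) ∞ (C.structFun A γ α β) (h '' C.U) := by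
  intro y hy
  obtain ⟨σ, hσ⟩ := C.exists_section α hy
  obtain ⟨τ, hτ⟩ := C.exists_section β hy
  have h1 := contMDiffOn_coeff_along (f := fun y : N => y) C.frame_t C.isOpen_image
    (fun q hq => hq) (A.bracket σ τ).contMDiff.contMDiffOn γ
  refine ((h1.contMDiffAt (C.isOpen_image.mem_nhds hy)).congr_of_eventuallyEq
    ?_).contMDiffWithinAt
  filter_upwards [hσ.eventually_nhds, hτ.eventually_nhds] with z h1 h2
  exact C.structFun_eq A γ α β h1 h2

/-- The matrix `Λ` of a change of frames of `F`, `t'_γ = Λ^α_γ t_α`. -/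
def tTrans {r' : ℕ} (C : VChart FF FP F P h p r) (C' : VChart FF FP F P h p r') (α γ : Fin p)
    (y : N) : ℝ :=
  C.frame_t.coeff α y (C'.t γ y)

variable {r' : ℕ} (C' : VChart FF FP F P h p r')

theorem contMDiffOn_tTrans (α γ : Fin p) :
    ContMDiffOn 𝓘(ℝ, EN) 𝓘(ℝ, ℝ) ∞ (C.tTrans C' α γ) (h '' C.U ∩ h '' C'.U) :=
  contMDiffOn_coeff_along (f := fun y : N => y) C.frame_t C.isOpen_image
    (fun _ hq => hq.1) ((C'.frame_t.contMDiffOn γ).mono inter_subset_right) α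

theorem t_eq_sum (γ : Fin p) {y : N} (hy : y ∈ h '' C.U) :
    C'.t γ y = ∑ α, C.tTrans C' α γ y • C.t α y :=
  C.frame_t.coeff_sum_eq (C'.t γ) hy

/-- The transformation law of the structure functions under a change of frames of `F`: expand
`[t'_γ, t'_β]` by the Leibniz rule in both arguments. -/
theorem structFun_change (μ γ β : Fin p) {x : M} (hx : x ∈ C.U) (hx' : x ∈ C'.U) :
    ∑ θ, C.tTrans C' μ θ (h x) * C'.structFun A θ γ β (h x) =
      ∑ α, ∑ ν, C.tTrans C' α γ (h x) * C.tTrans C' ν β (h x) * C.structFun A μ α ν (h x)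
      + A.baseDeriv (fun x => C.tTrans C' μ β (h x)) x (C'.t γ (h x))
      - A.baseDeriv (fun x => C.tTrans C' μ γ (h x)) x (C'.t β (h x)) := by
  have hy : h x ∈ h '' C.U := mem_image_of_mem h hx
  have hy' : h x ∈ h '' C'.U := mem_image_of_mem h hx'
  have hO : IsOpen (h '' C.U ∩ h '' C'.U) := C.isOpen_image.inter C'.isOpen_image
  choose σ hσ using fun α => C.exists_section α hy
  have hglob := fun α γ => exists_function_eventuallyEq hO ⟨hy, hy'⟩ (C.contMDiffOn_tTrans C' α γ)
  choose g hg hge using hglob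
  obtain ⟨u, hu⟩ := C'.exists_section γ hy'
  obtain ⟨v, hv⟩ := C'.exists_section β hy'
  have hexp : ∀ (γ : Fin p) (w : Cₛ^∞⟮𝓘(ℝ, EN); FF, F⟯), (∀ᶠ z in 𝓝 (h x), w z = C'.t γ z) →
      ∀ᶠ z in 𝓝 (h x), w z = ∑ α, g α γ z • σ α z := by
    intro γ w hw
    filter_upwards [hw, Filter.eventually_all.2 hσ, Filter.eventually_all.2 fun α => hge α γ,
      C.isOpen_image.mem_nhds hy] with z h1 h2 h3 h4
    rw [h1, C.t_eq_sum C' γ h4]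
    simp only [h2, h3]
  have hL : ∀ ν α, C.frame_t.coeff μ (h x) (A.bracket (σ ν) (σ α) (h x)) =
      -C.structFun A μ α ν (h x) := fun ν α => by
    rw [← C.structFun_eq A μ ν α (hσ ν) (hσ α), C.structFun_skew A μ ν α hy]
  have hδ : ∀ α, C.frame_t.coeff μ (h x) (σ α (h x)) = if μ = α then 1 else 0 := fun α => by
    rw [(hσ α).self_of_nhds, coeff_frame C.frame_t hy]
  have h1 := A.bracket_eq_sum_of_eventuallyEq (u := u) (fun ν => hg ν β) (hexp β v hv)
  have h2 : ∀ ν, A.bracket u (σ ν) (h x) = _ := fun ν =>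
    (congrArg (fun s : Cₛ^∞⟮𝓘(ℝ, EN); FF, F⟯ => s (h x)) (A.bracket_skew u (σ ν))).trans
      (congrArg Neg.neg
        (A.bracket_eq_sum_of_eventuallyEq (u := σ ν) (fun α => hg α γ) (hexp γ u hu)))
  have h3 := congrArg (C.frame_t.coeff μ (h x)) h1
  rw [C'.bracket_eq_sum A γ β hy' hu hv] at h3
  simp only [map_sum, map_add, map_smul, map_neg, h2, hL, hδ, smul_eq_mul, mul_ite, mul_one,
    mul_zero, Finset.sum_add_distrib, Finset.sum_ite_eq, Finset.mem_univ, if_true] at h3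
  have hd : ∀ (w : Cₛ^∞⟮𝓘(ℝ, EN); FF, F⟯) (α γ : Fin p),
      dirDeriv (g α γ) (h x) (anchorFieldOf h η A.ρ (fun n => w n) (h x)) =
        A.baseDeriv (fun x => C.tTrans C' α γ (h x)) x (w (h x)) :=
    fun w α γ => A.dirDeriv_eq_baseDeriv (hg α γ) (hge α γ)
  have hg0 : ∀ α γ, g α γ (h x) = C.tTrans C' α γ (h x) := fun α γ => (hge α γ).self_of_nhds
  have hvx : C'.t β (h x) = ∑ ν, C.tTrans C' ν β (h x) • σ ν (h x) := by
    have := (hexp β v hv).self_of_nhds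
    rw [hv.self_of_nhds] at this
    simpa only [hg0] using this
  rw [hvx, map_sum]
  simp only [hd, hg0, hu.self_of_nhds] at h3
  simp only [map_smul, smul_eq_mul]
  have hc : ∀ θ, C.frame_t.coeff μ (h x) (C'.t θ (h x)) = C.tTrans C' μ θ (h x) := fun _ => rfl
  simp only [hc] at h3
  rw [Finset.sum_congr rfl fun θ _ => mul_comm (C.tTrans C' μ θ (h x)) _, h3, Finset.sum_comm,
    ← sub_eq_zero]
  simp only [mul_add, neg_add, mul_neg, Finset.sum_add_distrib, Finset.mul_sum,
    Finset.sum_neg_distrib, neg_neg]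
  have h5 : ∀ α ν : Fin p,
      C.tTrans C' ν β (h x) * (C.tTrans C' α γ (h x) * C.structFun A μ α ν (h x))
      = C.tTrans C' α γ (h x) * C.tTrans C' ν β (h x) * C.structFun A μ α ν (h x) :=
    fun _ _ => by ring
  simp only [h5]
  ring_nf

end VChart

end Algebroid

/-! ### Horizontal and vertical lifts in a chart -/

section Lifts

variable {p r : ℕ} (A : GenLieAlgebroid FF F h η)

namespace VChart

variable (C : VChart FF FP F P h p r)

/-- The part `π⁻¹(U)` of `P` over the domain of a chart. -/
def dom : Set (TotalSpace FP P) := {u | u.proj ∈ C.U}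

theorem isOpen_dom : IsOpen C.dom :=
  C.isOpen_U.preimage (FiberBundle.continuous_proj FP P)

theorem eventually_dom {u : TotalSpace FP P} (hu : u.proj ∈ C.U) :
    ∀ᶠ v in 𝓝 u, v.proj ∈ C.U := C.isOpen_dom.mem_nhds hu

/-- The fibre coordinates of a point of `P`, as a vector. -/
def coordVec (u : TotalSpace FP P) : Fin r → ℝ := fun a => C.coord a u

/-- The parametrization `(x, p) ↦ p_a s^a(x)` of `π⁻¹(U)`. -/
def param (q : M × (Fin r → ℝ)) : TotalSpace FP P := ⟨q.1, ∑ a, q.2 a • C.s a q.1⟩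

theorem contMDiffOn_param :
    ContMDiffOn (𝓘(ℝ, EM).prod 𝓘(ℝ, Fin r → ℝ)) (𝓘(ℝ, EM).prod 𝓘(ℝ, FP)) ∞ C.param
      (C.U ×ˢ univ) := by
  refine contMDiffOn_sum_along (f := Prod.fst) (V := P) Finset.univ contMDiff_fst.contMDiffOn
    fun a => contMDiffOn_smul_along ?_ ?_
  · exact ((ContinuousLinearMap.proj (R := ℝ) (φ := fun _ : Fin r => ℝ) a).contMDiff.comp
      contMDiff_snd).contMDiffOn
  · exact (C.frame_s.contMDiffOn a).comp contMDiff_fst.contMDiffOn fun q hq => hq.1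

theorem isOpen_param_source : IsOpen (C.U ×ˢ (univ : Set (Fin r → ℝ))) :=
  C.isOpen_U.prod isOpen_univ

theorem mdifferentiableAt_param {q : M × (Fin r → ℝ)} (hq : q.1 ∈ C.U) :
    MDifferentiableAt (𝓘(ℝ, EM).prod 𝓘(ℝ, Fin r → ℝ)) (𝓘(ℝ, EM).prod 𝓘(ℝ, FP)) C.param q :=
  (C.contMDiffOn_param.contMDiffAt (C.isOpen_param_source.mem_nhds ⟨hq, mem_univ _⟩)
    ).mdifferentiableAt (by simp)

theorem sum_coeff_s {x : M} (hx : x ∈ C.U) (w : P x) :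
    ∑ a, C.frame_s.coeff a x w • C.s a x = w := by
  have h1 := (C.frame_s.toBasisAt hx).sum_repr w
  simpa [IsLocalFrameOn.coeff, hx] using h1

theorem sum_coeff_t {y : N} (hy : y ∈ h '' C.U) (w : F y) :
    ∑ α, C.frame_t.coeff α y w • C.t α y = w := by
  have h1 := (C.frame_t.toBasisAt hy).sum_repr w
  simpa [IsLocalFrameOn.coeff, hy] using h1

/-- The horizontal lift of `w` is the image of `(w, 0)` under the parametrization. -/
theorem mk_hlift {u : TotalSpace FP P} (hu : u.proj ∈ C.U) (w : TangentSpace 𝓘(ℝ, EM) u.proj) :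
    (⟨u, C.hlift u hu w⟩ : TangentBundle (𝓘(ℝ, EM).prod 𝓘(ℝ, FP)) (TotalSpace FP P)) =
      tangentMap (𝓘(ℝ, EM).prod 𝓘(ℝ, Fin r → ℝ)) (𝓘(ℝ, EM).prod 𝓘(ℝ, FP)) C.param
        ⟨(u.proj, C.coordVec u), (w, (0 : Fin r → ℝ))⟩ := by
  unfold hlift
  rw [mk_transport]
  have h1 := mfderiv_comp (I := 𝓘(ℝ, EM)) (I' := 𝓘(ℝ, EM).prod 𝓘(ℝ, Fin r → ℝ))
    (I'' := 𝓘(ℝ, EM).prod 𝓘(ℝ, FP)) (f := fun x : M => (x, C.coordVec u)) u.proj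
    (C.mdifferentiableAt_param (q := (u.proj, C.coordVec u)) hu)
    (mdifferentiableAt_id.prodMk mdifferentiableAt_const)
  rw [mfderiv_prod_left] at h1
  exact congrArg (TotalSpace.mk (F := EM × FP) (C.constSection u u.proj)) (DFunLike.congr_fun h1 w)

/-- The vertical lift of `w` is the image of `(0, w_a)` under the parametrization. -/
theorem mk_vlift {u : TotalSpace FP P} (hu : u.proj ∈ C.U) (w : P u.proj) :
    (⟨u, vlift u w⟩ : TangentBundle (𝓘(ℝ, EM).prod 𝓘(ℝ, FP)) (TotalSpace FP P)) =
      tangentMap (𝓘(ℝ, EM).prod 𝓘(ℝ, Fin r → ℝ)) (𝓘(ℝ, EM).prod 𝓘(ℝ, FP)) C.param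
        ⟨(u.proj, C.coordVec u), ((0 : EM), fun a => C.frame_s.coeff a u.proj w)⟩ := by
  unfold vlift
  rw [mk_transport]
  set q : Fin r → ℝ := fun a => C.frame_s.coeff a u.proj w with hq
  have hcurve : (fun τ : ℝ => (⟨u.proj, u.2 + τ • w⟩ : TotalSpace FP P)) =
      C.param ∘ fun τ : ℝ => (u.proj, C.coordVec u + τ • q) := by
    funext τ
    have h1 := C.sum_coeff_s hu (u.2 + τ • w)
    simp only [param, Function.comp, coordVec, coord, hq, Pi.add_apply, Pi.smul_apply, smul_eq_mul]
    rw [← h1]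
    simp
  have hin : HasMFDerivAt 𝓘(ℝ, ℝ) (𝓘(ℝ, EM).prod 𝓘(ℝ, Fin r → ℝ))
      (fun τ : ℝ => (u.proj, C.coordVec u + τ • q)) 0
      ((0 : ℝ →L[ℝ] EM).prod ((ContinuousLinearMap.id ℝ ℝ).smulRight q)) := by
    refine (hasMFDerivAt_const u.proj (0 : ℝ)).prodMk ?_
    refine HasFDerivAt.hasMFDerivAt ?_
    exact ((hasFDerivAt_id (0 : ℝ)).smul_const q).const_add _
  change tangentMap 𝓘(ℝ, ℝ) (𝓘(ℝ, EM).prod 𝓘(ℝ, FP))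
    (fun τ : ℝ => (⟨u.proj, u.2 + τ • w⟩ : TotalSpace FP P)) ⟨0, (1 : ℝ)⟩ = _
  rw [hcurve, tangentMap_comp_at (I' := 𝓘(ℝ, EM).prod 𝓘(ℝ, Fin r → ℝ)) _
    (C.mdifferentiableAt_param (by exact hu)) hin.mdifferentiableAt]
  congr 1
  have h3 : tangentMap 𝓘(ℝ, ℝ) (𝓘(ℝ, EM).prod 𝓘(ℝ, Fin r → ℝ))
      (fun τ : ℝ => (u.proj, C.coordVec u + τ • q)) ⟨0, (1 : ℝ)⟩ =
      ⟨(u.proj, C.coordVec u + (0 : ℝ) • q), ((0 : EM), (1 : ℝ) • q)⟩ := by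
    unfold tangentMap
    rw [hin.mfderiv]
    rfl
  rw [h3, zero_smul, add_zero, one_smul]

theorem contMDiffOn_coord (a : Fin r) :
    ContMDiffOn (𝓘(ℝ, EM).prod 𝓘(ℝ, FP)) 𝓘(ℝ, ℝ) ∞ (C.coord a) C.dom :=
  contMDiffOn_coeff_along (V := P) (f := fun u : TotalSpace FP P => u.proj) C.frame_s C.isOpen_U
    (fun _ hu => hu) contMDiffOn_id a

theorem contMDiffOn_coordVec :
    ContMDiffOn (𝓘(ℝ, EM).prod 𝓘(ℝ, FP)) 𝓘(ℝ, Fin r → ℝ) ∞ C.coordVec C.dom :=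
  contMDiffOn_pi_space.2 fun a => C.contMDiffOn_coord a

theorem contMDiffOn_mk_modelSpace {EQ HQ Q W : Type*} [NormedAddCommGroup EQ] [NormedSpace ℝ EQ]
    [TopologicalSpace HQ] {IQ : ModelWithCorners ℝ EQ HQ} [TopologicalSpace Q] [ChartedSpace HQ Q]
    [NormedAddCommGroup W] [NormedSpace ℝ W] {f g : Q → W} {O : Set Q}
    (hf : ContMDiffOn IQ 𝓘(ℝ, W) ∞ f O) (hg : ContMDiffOn IQ 𝓘(ℝ, W) ∞ g O) :
    ContMDiffOn IQ 𝓘(ℝ, W).tangent ∞ (fun q => (⟨f q, g q⟩ : TangentBundle 𝓘(ℝ, W) W)) O := by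
  intro q hq
  refine contMDiffWithinAt_totalSpace.2 ⟨hf q hq, ?_⟩
  simpa [TangentBundle.trivializationAt_apply] using hg q hq

/-- A vector field on `P` is smooth if its components in the parametrization are smooth. -/
theorem contMDiffOn_tangentMap_param {O : Set (TotalSpace FP P)} (hO : O ⊆ C.dom)
    {X : ∀ u : TotalSpace FP P, TangentSpace 𝓘(ℝ, EM) u.proj} {Q : TotalSpace FP P → Fin r → ℝ}
    (hX : ContMDiffOn (𝓘(ℝ, EM).prod 𝓘(ℝ, FP)) 𝓘(ℝ, EM).tangent ∞
      (fun u => (⟨u.proj, X u⟩ : TangentBundle 𝓘(ℝ, EM) M)) O)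
    (hQ : ContMDiffOn (𝓘(ℝ, EM).prod 𝓘(ℝ, FP)) 𝓘(ℝ, Fin r → ℝ) ∞ Q O) :
    ContMDiffOn (𝓘(ℝ, EM).prod 𝓘(ℝ, FP)) (𝓘(ℝ, EM).prod 𝓘(ℝ, FP)).tangent ∞
      (fun u => tangentMap (𝓘(ℝ, EM).prod 𝓘(ℝ, Fin r → ℝ)) (𝓘(ℝ, EM).prod 𝓘(ℝ, FP)) C.param
        ⟨(u.proj, C.coordVec u), (X u, Q u)⟩) O := by
  have h1 : ContMDiffOn (𝓘(ℝ, EM).prod 𝓘(ℝ, FP)) (𝓘(ℝ, EM).prod 𝓘(ℝ, Fin r → ℝ)).tangent ∞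
      (fun u : TotalSpace FP P => (⟨(u.proj, C.coordVec u), (X u, Q u)⟩ :
        TangentBundle (𝓘(ℝ, EM).prod 𝓘(ℝ, Fin r → ℝ)) (M × (Fin r → ℝ)))) O :=
    (contMDiff_equivTangentBundleProd_symm (n := ∞)).comp_contMDiffOn
      (hX.prodMk (contMDiffOn_mk_modelSpace (C.contMDiffOn_coordVec.mono hO) hQ))
  have h2 := C.contMDiffOn_param.contMDiffOn_tangentMapWithin (m := ∞) (by simp)
    C.isOpen_param_source.uniqueMDiffOn
  refine (h2.comp h1 fun u hu => mk_mem_prod (hO hu) (mem_univ _)).congr fun u hu => ?_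
  have hmem : (u.proj, C.coordVec u) ∈ C.U ×ˢ (univ : Set (Fin r → ℝ)) := ⟨hO hu, mem_univ _⟩
  simp only [tangentMap, tangentMapWithin, Function.comp]
  rw [mfderivWithin_of_isOpen C.isOpen_param_source hmem]

theorem tangentMap_congr {E H B E' H' B' : Type*} [NormedAddCommGroup E] [NormedSpace ℝ E]
    [TopologicalSpace H] {I : ModelWithCorners ℝ E H} [TopologicalSpace B] [ChartedSpace H B]
    [NormedAddCommGroup E'] [NormedSpace ℝ E']
    [TopologicalSpace H'] {I' : ModelWithCorners ℝ E' H'} [TopologicalSpace B']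
    [ChartedSpace H' B'] {f g : B → B'} {z : TangentBundle I B} (hfg : f =ᶠ[𝓝 z.1] g) :
    tangentMap I I' f z = tangentMap I I' g z :=
  congrArg₂ (fun (y : B') (v : E') => (⟨y, v⟩ : TangentBundle I' B')) hfg.self_of_nhds
    (DFunLike.congr_fun hfg.mfderiv_eq z.2)

theorem mdifferentiableAt_coord (a : Fin r) {u : TotalSpace FP P} (hu : u.proj ∈ C.U) :
    MDifferentiableAt (𝓘(ℝ, EM).prod 𝓘(ℝ, FP)) 𝓘(ℝ, ℝ) (C.coord a) u :=
  ((C.contMDiffOn_coord a).contMDiffAt (C.isOpen_dom.mem_nhds hu)).mdifferentiableAt (by simp)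

theorem param_coordVec {u : TotalSpace FP P} (hu : u.proj ∈ C.U) :
    C.param (u.proj, C.coordVec u) = u := C.constSection_self u hu

theorem coord_param (a : Fin r) {q : M × (Fin r → ℝ)} (hq : q.1 ∈ C.U) :
    C.coord a (C.param q) = q.2 a := by
  change C.frame_s.coeff a q.1 (∑ b, q.2 b • C.s b q.1) = _
  simp [map_sum, coeff_frame C.frame_s hq]

/-- A tangent vector at `u` is given by its projection to `M` and its components
`∂/∂p_a`. -/
theorem mk_eq_tangentMap_param {u : TotalSpace FP P} (hu : u.proj ∈ C.U)
    (w : TangentSpace (𝓘(ℝ, EM).prod 𝓘(ℝ, FP)) u) :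
    (⟨u, w⟩ : TangentBundle (𝓘(ℝ, EM).prod 𝓘(ℝ, FP)) (TotalSpace FP P)) =
      tangentMap (𝓘(ℝ, EM).prod 𝓘(ℝ, Fin r → ℝ)) (𝓘(ℝ, EM).prod 𝓘(ℝ, FP)) C.param
        ⟨(u.proj, C.coordVec u), (dproj u w,
          mfderiv (𝓘(ℝ, EM).prod 𝓘(ℝ, FP)) 𝓘(ℝ, Fin r → ℝ) C.coordVec u w)⟩ := by
  have hcv : MDifferentiableAt (𝓘(ℝ, EM).prod 𝓘(ℝ, FP)) 𝓘(ℝ, Fin r → ℝ) C.coordVec u :=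
    (C.contMDiffOn_coordVec.contMDiffAt (C.isOpen_dom.mem_nhds hu)).mdifferentiableAt (by simp)
  have hpr : MDifferentiableAt (𝓘(ℝ, EM).prod 𝓘(ℝ, FP)) 𝓘(ℝ, EM) (π FP P) u :=
    mdifferentiableAt_proj P
  have h1 : (id : TotalSpace FP P → _) =ᶠ[𝓝 u]
      C.param ∘ fun v : TotalSpace FP P => (π FP P v, C.coordVec v) := by
    filter_upwards [C.eventually_dom hu] with v hv
    exact (C.param_coordVec hv).symm
  have h2 := tangentMap_congr (I := 𝓘(ℝ, EM).prod 𝓘(ℝ, FP)) (I' := 𝓘(ℝ, EM).prod 𝓘(ℝ, FP))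
    (z := ⟨u, w⟩) h1
  rw [tangentMap_id, id, tangentMap_comp_at (I' := 𝓘(ℝ, EM).prod 𝓘(ℝ, Fin r → ℝ)) _
    (C.mdifferentiableAt_param (by exact hu)) (hpr.prodMk hcv)] at h2
  rw [h2]
  congr 1
  unfold tangentMap
  rw [(hpr.hasMFDerivAt.prodMk hcv.hasMFDerivAt).mfderiv]
  rfl

/-- The differential of the coordinate `p_a` reads off the corresponding component. -/
theorem mfderiv_coord_of_mk_eq (a : Fin r) {u : TotalSpace FP P} (hu : u.proj ∈ C.U)
    {X : TangentSpace (𝓘(ℝ, EM).prod 𝓘(ℝ, FP)) u} {w : EM} {q : Fin r → ℝ}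
    (hX : (⟨u, X⟩ : TangentBundle (𝓘(ℝ, EM).prod 𝓘(ℝ, FP)) (TotalSpace FP P)) =
      tangentMap (𝓘(ℝ, EM).prod 𝓘(ℝ, Fin r → ℝ)) (𝓘(ℝ, EM).prod 𝓘(ℝ, FP)) C.param
        ⟨(u.proj, C.coordVec u), (w, q)⟩) :
    (mfderiv (𝓘(ℝ, EM).prod 𝓘(ℝ, FP)) 𝓘(ℝ, ℝ) (C.coord a) u X : ℝ) = q a := by
  have h1 := congrArg (tangentMap (𝓘(ℝ, EM).prod 𝓘(ℝ, FP)) 𝓘(ℝ, ℝ) (C.coord a)) hX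
  rw [← tangentMap_comp_at _ (C.mdifferentiableAt_coord a (by exact hu))
    (C.mdifferentiableAt_param (by exact hu))] at h1
  let ℓ := (ContinuousLinearMap.proj (R := ℝ) (φ := fun _ : Fin r => ℝ) a).comp
    (ContinuousLinearMap.snd ℝ EM (Fin r → ℝ))
  have h2 : C.coord a ∘ C.param =ᶠ[𝓝 (u.proj, C.coordVec u)] fun q => q.2 a := by
    filter_upwards [C.isOpen_param_source.mem_nhds ⟨hu, mem_univ _⟩] with q hq
    exact C.coord_param a hq.1
  rw [tangentMap_congr (z := ⟨(u.proj, C.coordVec u), (w, q)⟩) h2] at h1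
  have h3 : HasMFDerivAt (𝓘(ℝ, EM).prod 𝓘(ℝ, Fin r → ℝ)) 𝓘(ℝ, ℝ)
      (fun q : M × (Fin r → ℝ) => q.2 a) (u.proj, C.coordVec u) ℓ :=
    HasMFDerivAt.comp (I' := 𝓘(ℝ, Fin r → ℝ)) (I'' := 𝓘(ℝ, ℝ)) (u.proj, C.coordVec u)
      (g := fun v : Fin r → ℝ => v a)
      (ContinuousLinearMap.proj (R := ℝ) (φ := fun _ : Fin r => ℝ) a).hasFDerivAt.hasMFDerivAt
      (hasMFDerivAt_snd _)
  unfold tangentMap at h1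
  rw [h3.mfderiv] at h1
  exact congrArg (fun z : TangentBundle 𝓘(ℝ, ℝ) ℝ => (z.2 : ℝ)) h1

/-- Vectors tangent to the fibres are vertical lifts. -/
theorem exists_vlift_eq {u : TotalSpace FP P} (hu : u.proj ∈ C.U)
    {w : TangentSpace (𝓘(ℝ, EM).prod 𝓘(ℝ, FP)) u} (hw : dproj u w = 0) :
    ∃ z : P u.proj, w = vlift u z := by
  have h1 := C.mk_eq_tangentMap_param hu w
  set q : Fin r → ℝ := mfderiv (𝓘(ℝ, EM).prod 𝓘(ℝ, FP)) 𝓘(ℝ, Fin r → ℝ) C.coordVec u w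
  refine ⟨∑ a, q a • C.s a u.proj, ?_⟩
  have h2 := C.mk_vlift hu (∑ a, q a • C.s a u.proj)
  have h3 : (fun a => C.frame_s.coeff a u.proj (∑ a, q a • C.s a u.proj)) = q := by
    funext a
    exact C.coord_param a (q := (u.proj, q)) hu
  rw [h3] at h2
  rw [hw] at h1
  have h4 := h1.trans h2.symm
  simpa using h4

theorem vlift_zero (u : TotalSpace FP P) : vlift (EM := EM) u 0 = 0 := by
  refine transport_eq_of_mk_eq _ ?_
  have h1 : (fun τ : ℝ => (⟨u.proj, u.2 + τ • (0 : P u.proj)⟩ : TotalSpace FP P)) = fun _ => u := by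
    funext τ; simp
  rw [h1, mfderiv_const]
  simp
  rfl

end VChart

end Lifts

/-! ### Smooth functions on the total space -/

section Sections

variable (EM) in
/-- Smooth real functions on an open subset of `P`. -/
abbrev SmoothFunOn (f : TotalSpace FP P → ℝ) (O : Set (TotalSpace FP P)) : Prop :=
  ContMDiffOn (𝓘(ℝ, EM).prod 𝓘(ℝ, FP)) 𝓘(ℝ, ℝ) ∞ f O

variable (EM) in
/-- Differentiability at a point of a real function on `P`. -/
abbrev DiffFunAt (f : TotalSpace FP P → ℝ) (u : TotalSpace FP P) : Prop :=
  MDifferentiableAt (𝓘(ℝ, EM).prod 𝓘(ℝ, FP)) 𝓘(ℝ, ℝ) f u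

theorem SmoothFunOn.diffFunAt {f : TotalSpace FP P → ℝ} {O : Set (TotalSpace FP P)}
    (hf : SmoothFunOn EM f O) (hO : IsOpen O) {u : TotalSpace FP P} (hu : u ∈ O) :
    DiffFunAt EM f u :=
  (hf.contMDiffAt (hO.mem_nhds hu)).mdifferentiableAt (by simp)

variable {p r : ℕ} {A : GenLieAlgebroid FF F h η}

/-! ### Smooth sections of the generalized tangent bundle -/

namespace SmoothOn

variable {X Y : GSection A FP P} {O O' : Set (TotalSpace FP P)}

theorem mono (hX : SmoothOn X O) (hO : O' ⊆ O) : SmoothOn X O' :=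
  ⟨hX.fst.mono hO, hX.snd.mono hO⟩

theorem congr (hX : SmoothOn X O) (hXY : ∀ u ∈ O, Y u = X u) : SmoothOn Y O :=
  ⟨hX.fst.congr fun u hu => by rw [hXY u hu], hX.snd.congr fun u hu => by rw [hXY u hu]⟩

theorem add (hX : SmoothOn X O) (hY : SmoothOn Y O) : SmoothOn (fun u => X u + Y u) O :=
  ⟨contMDiffOn_add_along hX.fst hY.fst, contMDiffOn_add_along (f := fun u => u) hX.snd hY.snd⟩

theorem smul {f : TotalSpace FP P → ℝ} (hf : SmoothFunOn EM f O) (hX : SmoothOn X O) :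
    SmoothOn (fun u => f u • X u) O :=
  ⟨contMDiffOn_smul_along hf hX.fst, contMDiffOn_smul_along (f := fun u => u) hf hX.snd⟩

theorem contMDiffOn_base (O : Set (TotalSpace FP P)) :
    ContMDiffOn (𝓘(ℝ, EM).prod 𝓘(ℝ, FP)) 𝓘(ℝ, EN) ∞ (fun u : TotalSpace FP P => h u.proj) O :=
  (h.contMDiff.comp (contMDiff_proj P)).contMDiffOn

variable (A) in
theorem zero (O : Set (TotalSpace FP P)) : SmoothOn (fun _ => 0 : GSection A FP P) O :=
  ⟨contMDiffOn_zero_along (contMDiffOn_base O),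
    contMDiffOn_zero_along (f := fun u : TotalSpace FP P => u) contMDiffOn_id⟩

theorem sum {ι : Type*} (S : Finset ι) {X : ι → GSection A FP P}
    (hX : ∀ i, SmoothOn (X i) O) : SmoothOn (fun u => ∑ i ∈ S, X i u) O := by
  classical
  induction S using Finset.induction_on with
  | empty => exact (zero A O).congr fun u _ => by simp
  | insert i S hi ih => exact ((hX i).add ih).congr fun u _ => by simp [Finset.sum_insert hi]

/-- Smoothness is a local property. -/
theorem of_locally (hX : ∀ u ∈ O, ∃ O', IsOpen O' ∧ u ∈ O' ∧ SmoothOn X (O ∩ O')) :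
    SmoothOn X O := by
  constructor
  · intro u hu
    obtain ⟨O', h1, h2, h3⟩ := hX u hu
    exact (contMDiffWithinAt_inter (h1.mem_nhds h2)).1 (h3.fst u ⟨hu, h2⟩)
  · intro u hu
    obtain ⟨O', h1, h2, h3⟩ := hX u hu
    exact (contMDiffWithinAt_inter (h1.mem_nhds h2)).1 (h3.snd u ⟨hu, h2⟩)

end SmoothOn

/-! ### Derivatives along the anchor -/

variable (A) in
/-- `X ↦ ρ̃(X) f` as a linear form on the fibre at `u`. -/
def derivL (f : TotalSpace FP P → ℝ) (u : TotalSpace FP P) : gtb A u →ₗ[ℝ] ℝ :=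
  (mfderiv (𝓘(ℝ, EM).prod 𝓘(ℝ, FP)) 𝓘(ℝ, ℝ) f u).toLinearMap.comp
    ((LinearMap.snd ℝ _ _).comp (gtb A u).subtype)

theorem anchorDeriv_eq (f : TotalSpace FP P → ℝ) {u : TotalSpace FP P} (X : gtb A u) :
    anchorDeriv f X = derivL A f u X := rfl

theorem derivL_congr {f g : TotalSpace FP P → ℝ} {u : TotalSpace FP P} (hfg : f =ᶠ[𝓝 u] g) :
    derivL A f u = derivL A g u := by
  ext X
  exact DFunLike.congr_fun hfg.mfderiv_eq _

theorem derivL_const (c : ℝ) (u : TotalSpace FP P) : derivL A (fun _ => c) u = 0 := by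
  ext X
  exact DFunLike.congr_fun (mfderiv_const (I := 𝓘(ℝ, EM).prod 𝓘(ℝ, FP)) (I' := 𝓘(ℝ, ℝ))
    (c := c) (x := u)) _

theorem derivL_add {f g : TotalSpace FP P → ℝ} {u : TotalSpace FP P} (hf : DiffFunAt EM f u)
    (hg : DiffFunAt EM g u) :
    derivL A (fun v => f v + g v) u = derivL A f u + derivL A g u := by
  ext X
  exact DFunLike.congr_fun (hf.hasMFDerivAt.add hg.hasMFDerivAt).mfderiv _

theorem derivL_mul {f g : TotalSpace FP P → ℝ} {u : TotalSpace FP P} (hf : DiffFunAt EM f u)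
    (hg : DiffFunAt EM g u) :
    derivL A (fun v => f v * g v) u = f u • derivL A g u + g u • derivL A f u := by
  ext X
  exact DFunLike.congr_fun (hf.hasMFDerivAt.mul hg.hasMFDerivAt).mfderiv _

theorem DiffFunAt.add {f g : TotalSpace FP P → ℝ} {u : TotalSpace FP P} (hf : DiffFunAt EM f u)
    (hg : DiffFunAt EM g u) : DiffFunAt EM (fun v => f v + g v) u :=
  (hf.hasMFDerivAt.add hg.hasMFDerivAt).mdifferentiableAt

theorem DiffFunAt.mul {f g : TotalSpace FP P → ℝ} {u : TotalSpace FP P} (hf : DiffFunAt EM f u)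
    (hg : DiffFunAt EM g u) : DiffFunAt EM (fun v => f v * g v) u :=
  (hf.hasMFDerivAt.mul hg.hasMFDerivAt).mdifferentiableAt

theorem DiffFunAt.sum {ι : Type*} (S : Finset ι) {f : ι → TotalSpace FP P → ℝ}
    {u : TotalSpace FP P} (hf : ∀ i, DiffFunAt EM (f i) u) :
    DiffFunAt EM (fun v => ∑ i ∈ S, f i v) u := by
  classical
  induction S using Finset.induction_on with
  | empty => simpa using mdifferentiableAt_const
  | insert i S hi ih => simpa [Finset.sum_insert hi] using (hf i).add ih

theorem derivL_sum {ι : Type*} (S : Finset ι) {f : ι → TotalSpace FP P → ℝ}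
    {u : TotalSpace FP P} (hf : ∀ i, DiffFunAt EM (f i) u) :
    derivL A (fun v => ∑ i ∈ S, f i v) u = ∑ i ∈ S, derivL A (f i) u := by
  classical
  induction S using Finset.induction_on with
  | empty => simpa using derivL_const 0 u
  | insert i S hi ih =>
    simp only [Finset.sum_insert hi]
    rw [derivL_add (hf i) (DiffFunAt.sum S hf), ih]

theorem contMDiffOn_derivL {f : TotalSpace FP P → ℝ} {X : GSection A FP P}
    {O : Set (TotalSpace FP P)} (hO : IsOpen O) (hf : SmoothFunOn EM f O) (hX : SmoothOn X O) :
    SmoothFunOn EM (fun u => derivL A f u (X u)) O := by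
  have h1 := (hf.contMDiffOn_tangentMapWithin (m := ∞) (by simp) hO.uniqueMDiffOn).comp hX.snd
    fun u hu => hu
  intro u hu
  have h2 := (contMDiffWithinAt_totalSpace.1 (h1 u hu)).2
  refine h2.congr_of_eventuallyEq ?_ ?_
  · filter_upwards [self_mem_nhdsWithin] with v hv
    simp [tangentMapWithin, mfderivWithin_of_isOpen hO hv]
    rfl
  · simp [tangentMapWithin, mfderivWithin_of_isOpen hO hu]
    rfl

/-- On functions on the base the anchor of `(ρ, η)TP` acts through the anchor of `F`. -/
theorem derivL_comp_proj {f : M → ℝ} {u : TotalSpace FP P}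
    (hf : MDifferentiableAt 𝓘(ℝ, EM) 𝓘(ℝ, ℝ) f u.proj) (X : gtb A u) :
    derivL A (fun v => f v.proj) u X = A.baseDeriv f u.proj X.1.1 := by
  have h1 := mfderiv_comp (I := 𝓘(ℝ, EM).prod 𝓘(ℝ, FP)) (I' := 𝓘(ℝ, EM)) (I'' := 𝓘(ℝ, ℝ)) u hf
    (mdifferentiableAt_proj P)
  have h2 : dproj u X.1.2 = A.anchorAt u.proj X.1.1 := X.2
  change _ = mfderiv 𝓘(ℝ, EM) 𝓘(ℝ, ℝ) f u.proj (A.anchorAt u.proj X.1.1)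
  rw [← h2]
  exact DFunLike.congr_fun h1 _

/-- The derivative along a vertical vector of a function that is constant on the fibre. -/
theorem derivL_vert_eq_zero {f : TotalSpace FP P → ℝ} {u : TotalSpace FP P}
    (hf : DiffFunAt EM f u) (hc : ∀ v : TotalSpace FP P, v.proj = u.proj → f v = f u)
    (w : P u.proj) : derivL A f u (vert A u w) = 0 := by
  change (mfderiv (𝓘(ℝ, EM).prod 𝓘(ℝ, FP)) 𝓘(ℝ, ℝ) f u (vlift u w) : ℝ) = 0
  unfold vlift
  rw [mfderiv_transport_real]
  have e : (⟨u.proj, u.2 + (0 : ℝ) • w⟩ : TotalSpace FP P) = u := by simp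
  by_cases hd : MDifferentiableAt 𝓘(ℝ, ℝ) (𝓘(ℝ, EM).prod 𝓘(ℝ, FP))
      (fun τ : ℝ => (⟨u.proj, u.2 + τ • w⟩ : TotalSpace FP P)) 0
  · have h1 := mfderiv_comp (I := 𝓘(ℝ, ℝ)) (I' := 𝓘(ℝ, EM).prod 𝓘(ℝ, FP)) (I'' := 𝓘(ℝ, ℝ))
      (0 : ℝ) (f := fun τ : ℝ => (⟨u.proj, u.2 + τ • w⟩ : TotalSpace FP P)) (g := f)
      (by rw [e]; exact hf) hd
    have h2 : f ∘ (fun τ : ℝ => (⟨u.proj, u.2 + τ • w⟩ : TotalSpace FP P)) = fun _ => f u := by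
      funext τ
      exact hc _ rfl
    rw [h2, mfderiv_const] at h1
    exact (DFunLike.congr_fun h1 (1 : ℝ)).symm
  -- If the curve were not differentiable, its derivative would be zero by convention.
  · rw [mfderiv_zero_of_not_mdifferentiableAt hd]
    exact map_zero _

/-! ### The natural and the adapted base -/

namespace VChart

variable (C : VChart FF FP F P h p r)

theorem natH_fst (α : Fin p) {u : TotalSpace FP P} (hu : u.proj ∈ C.U) :
    (C.natH A α u).1.1 = C.t α (h u.proj) := by
  unfold natH; rw [dif_pos hu]

theorem natH_snd (α : Fin p) {u : TotalSpace FP P} (hu : u.proj ∈ C.U) :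
    (C.natH A α u).1.2 = C.hlift u hu (A.anchorAt u.proj (C.t α (h u.proj))) := by
  unfold natH; rw [dif_pos hu]

theorem smoothOn_natH (α : Fin p) : SmoothOn (C.natH A α) C.dom := by
  constructor
  · refine ContMDiffOn.congr (f := fun u : TotalSpace FP P =>
      (⟨h u.proj, C.t α (h u.proj)⟩ : TotalSpace FF F)) ?_ fun u hu => by rw [C.natH_fst α hu]
    exact (C.frame_t.contMDiffOn α).comp (SmoothOn.contMDiffOn_base C.dom)
      fun u hu => mem_image_of_mem h hu
  · refine (C.contMDiffOn_tangentMap_param (O := C.dom) subset_rfl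
      (X := fun u => A.anchorAt u.proj (C.t α (h u.proj))) (Q := fun _ => 0) ?_
      contMDiffOn_const).congr fun u hu => ?_
    · exact (A.contMDiffOn_anchorAt C.isOpen_U (C.frame_t.contMDiffOn α)).comp
        (contMDiff_proj P).contMDiffOn fun u hu => hu
    · rw [C.natH_snd α hu]
      exact C.mk_hlift hu _

theorem smoothOn_natV (a : Fin r) : SmoothOn (C.natV A a) C.dom := by
  constructor
  · exact contMDiffOn_zero_along (SmoothOn.contMDiffOn_base C.dom)
  · refine (C.contMDiffOn_tangentMap_param (O := C.dom) subset_rfl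
      (X := fun u => (0 : EM)) (Q := fun _ b => if b = a then 1 else 0) ?_
      contMDiffOn_const).congr fun u hu => ?_
    · exact contMDiffOn_zero_along (contMDiff_proj P).contMDiffOn
    · have h1 := C.mk_vlift hu (C.s a u.proj)
      simp only [coeff_frame C.frame_s hu] at h1
      exact h1

variable (Γ : RhoConnection FP P A)

theorem contMDiffOn_gam (b : Fin r) (α : Fin p) : SmoothFunOn EM (C.gam Γ b α) C.dom :=
  (contMDiffOn_coeff_along (V := P) (f := fun u : TotalSpace FP P => u.proj) C.frame_s
    C.isOpen_U (fun _ hu => hu) (Γ.smooth _ _ C.isOpen_dom (C.smoothOn_natH α)) b).neg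

theorem smoothOn_delta (α : Fin p) : SmoothOn (C.delta Γ α) C.dom :=
  (C.smoothOn_natH α).add
    (SmoothOn.sum _ fun b => (C.smoothOn_natV b).smul (C.contMDiffOn_gam Γ b α))

theorem delta_fst (α : Fin p) {u : TotalSpace FP P} (hu : u.proj ∈ C.U) :
    (C.delta Γ α u).1.1 = C.t α (h u.proj) := by
  have h1 : (∑ b, C.gam Γ b α u • C.natV A b u).1.1 = 0 := by
    rw [Submodule.coe_sum, Prod.fst_sum]
    exact Finset.sum_eq_zero fun b _ => smul_zero _
  change (C.natH A α u).1.1 + (∑ b, C.gam Γ b α u • C.natV A b u).1.1 = _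
  rw [h1, add_zero, C.natH_fst α hu]

theorem toFun_natV (a : Fin r) (u : TotalSpace FP P) : Γ.toFun u (C.natV A a u) = C.s a u.proj :=
  Γ.toFun_vert u _

theorem toFun_delta (α : Fin p) {u : TotalSpace FP P} (hu : u.proj ∈ C.U) :
    Γ.toFun u (C.delta Γ α u) = 0 := by
  unfold delta
  rw [map_add, map_sum]
  simp only [map_smul, toFun_natV]
  have h1 := C.sum_coeff_s hu (Γ.toFun u (C.natH A α u))
  simp only [gam, neg_smul, Finset.sum_neg_distrib]
  rw [h1, add_neg_cancel]

theorem delta_mem_horizontal (α : Fin p) {u : TotalSpace FP P} (hu : u.proj ∈ C.U) :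
    C.delta Γ α u ∈ Γ.horizontal u := C.toFun_delta Γ α hu

theorem natV_mem_vertical (a : Fin r) (u : TotalSpace FP P) : C.natV A a u ∈ vertical A u := rfl

variable (A) in
/-- The coefficient of `δ_α`. -/
def coeffH (α : Fin p) (u : TotalSpace FP P) : gtb A u →ₗ[ℝ] ℝ :=
  (C.frame_t.coeff α (h u.proj)).comp ((LinearMap.fst ℝ _ _).comp (gtb A u).subtype)

/-- The coefficient of `∂^a` in the adapted base. -/
def coeffV (a : Fin r) (u : TotalSpace FP P) : gtb A u →ₗ[ℝ] ℝ :=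
  (C.frame_s.coeff a u.proj).comp (Γ.toFun u)

theorem coeffH_apply (α : Fin p) {u : TotalSpace FP P} (X : gtb A u) :
    C.coeffH A α u X = C.frame_t.coeff α (h u.proj) X.1.1 := rfl

theorem coeffV_apply (a : Fin r) {u : TotalSpace FP P} (X : gtb A u) :
    C.coeffV Γ a u X = C.frame_s.coeff a u.proj (Γ.toFun u X) := rfl

theorem coeffH_delta (α β : Fin p) {u : TotalSpace FP P} (hu : u.proj ∈ C.U) :
    C.coeffH A α u (C.delta Γ β u) = if α = β then 1 else 0 := by
  rw [coeffH_apply, C.delta_fst Γ β hu, coeff_frame C.frame_t (mem_image_of_mem h hu)]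

theorem coeffH_natV (α : Fin p) (a : Fin r) (u : TotalSpace FP P) :
    C.coeffH A α u (C.natV A a u) = 0 :=
  map_zero (C.frame_t.coeff α (h u.proj))

theorem coeffV_delta (a : Fin r) (β : Fin p) {u : TotalSpace FP P} (hu : u.proj ∈ C.U) :
    C.coeffV Γ a u (C.delta Γ β u) = 0 := by
  rw [coeffV_apply, C.toFun_delta Γ β hu, map_zero]

theorem coeffV_natV (a b : Fin r) {u : TotalSpace FP P} (hu : u.proj ∈ C.U) :
    C.coeffV Γ a u (C.natV A b u) = if a = b then 1 else 0 := by
  rw [coeffV_apply, C.toFun_natV, coeff_frame C.frame_s hu]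

/-- Two elements of a fibre of `(ρ, η)TP` agree if they have the same component in `F` and the same
vertical part. -/
theorem gtb_ext {u : TotalSpace FP P} (hu : u.proj ∈ C.U) {X Y : gtb A u}
    (h1 : X.1.1 = Y.1.1) (h2 : Γ.toFun u X = Γ.toFun u Y) : X = Y := by
  have h3 : dproj u (X - Y).1.2 = A.anchorAt u.proj (X - Y).1.1 := (X - Y).2
  have h4 : (X - Y).1.1 = 0 := sub_eq_zero.2 h1
  rw [h4, map_zero] at h3
  obtain ⟨z, hz⟩ := C.exists_vlift_eq hu h3
  have h5 : X - Y = vert A u z := Subtype.ext (Prod.ext h4 hz)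
  have h6 := Γ.toFun_vert u z
  rw [← h5, map_sub, h2, sub_self] at h6
  have h7 : X - Y = 0 := by
    rw [h5, ← h6]
    exact Subtype.ext (Prod.ext rfl (vlift_zero u))
  exact sub_eq_zero.1 h7

/-- The adapted base is a base. -/
theorem eq_sum {u : TotalSpace FP P} (hu : u.proj ∈ C.U) (X : gtb A u) :
    X = ∑ α, C.coeffH A α u X • C.delta Γ α u + ∑ a, C.coeffV Γ a u X • C.natV A a u := by
  refine C.gtb_ext Γ hu ?_ ?_
  · have h1 : ∀ Y Z : gtb A u, (Y + Z).1.1 = Y.1.1 + Z.1.1 := fun _ _ => rfl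
    have h2 : (∑ a, C.coeffV Γ a u X • C.natV A a u).1.1 = 0 := by
      rw [Submodule.coe_sum, Prod.fst_sum]
      exact Finset.sum_eq_zero fun b _ => smul_zero _
    have h3 : (∑ α, C.coeffH A α u X • C.delta Γ α u).1.1 = X.1.1 := by
      rw [Submodule.coe_sum, Prod.fst_sum]
      refine Eq.trans (Finset.sum_congr rfl fun α _ => ?_)
        (C.sum_coeff_t (mem_image_of_mem h hu) X.1.1)
      change C.coeffH A α u X • (C.delta Γ α u).1.1 = _
      rw [C.delta_fst Γ α hu]
      rfl
    rw [h1, h2, h3, add_zero]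
  · rw [map_add, map_sum, map_sum]
    simp only [map_smul, C.toFun_natV, C.toFun_delta Γ _ hu, smul_zero, Finset.sum_const_zero,
      zero_add]
    exact (C.sum_coeff_s hu _).symm

theorem contMDiffOn_coeffH {X : GSection A FP P} {O : Set (TotalSpace FP P)} (hX : SmoothOn X O)
    (hO : O ⊆ C.dom) (α : Fin p) : SmoothFunOn EM (fun u => C.coeffH A α u (X u)) O :=
  contMDiffOn_coeff_along C.frame_t C.isOpen_image (fun _ hu => mem_image_of_mem h (hO hu))
    hX.fst α

theorem contMDiffOn_coeffV {X : GSection A FP P} {O : Set (TotalSpace FP P)} (hO' : IsOpen O)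
    (hX : SmoothOn X O) (hO : O ⊆ C.dom) (a : Fin r) :
    SmoothFunOn EM (fun u => C.coeffV Γ a u (X u)) O :=
  contMDiffOn_coeff_along (V := P) (f := fun u : TotalSpace FP P => u.proj) C.frame_s C.isOpen_U
    (fun _ hu => hO hu) (Γ.smooth O X hO' hX) a

theorem coeffV_eq_zero {u : TotalSpace FP P} {X : gtb A u} (hX : X ∈ Γ.horizontal u) (a : Fin r) :
    C.coeffV Γ a u X = 0 := by
  have : Γ.toFun u X = 0 := hX
  rw [coeffV_apply, this, map_zero]

theorem coeffH_eq_zero {u : TotalSpace FP P} {X : gtb A u} (hX : X ∈ vertical A u) (α : Fin p) :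
    C.coeffH A α u X = 0 := by
  have : X.1.1 = 0 := hX
  rw [coeffH_apply, this, map_zero]

theorem derivL_coord_natH (a : Fin r) (α : Fin p) {u : TotalSpace FP P} (hu : u.proj ∈ C.U) :
    derivL A (C.coord a) u (C.natH A α u) = 0 := by
  change (mfderiv (𝓘(ℝ, EM).prod 𝓘(ℝ, FP)) 𝓘(ℝ, ℝ) (C.coord a) u (C.natH A α u).1.2 : ℝ) = 0
  rw [C.natH_snd α hu]
  exact C.mfderiv_coord_of_mk_eq a hu (C.mk_hlift hu _)

theorem derivL_coord_natV (a b : Fin r) {u : TotalSpace FP P} (hu : u.proj ∈ C.U) :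
    derivL A (C.coord a) u (C.natV A b u) = if a = b then 1 else 0 := by
  change (mfderiv (𝓘(ℝ, EM).prod 𝓘(ℝ, FP)) 𝓘(ℝ, ℝ) (C.coord a) u
    (vlift u (C.s b u.proj)) : ℝ) = _
  rw [C.mfderiv_coord_of_mk_eq a hu (C.mk_vlift hu _), coeff_frame C.frame_s hu]

theorem derivL_coord_delta (a : Fin r) (α : Fin p) {u : TotalSpace FP P} (hu : u.proj ∈ C.U) :
    derivL A (C.coord a) u (C.delta Γ α u) = C.gam Γ a α u := by
  unfold delta
  rw [map_add, map_sum, C.derivL_coord_natH a α hu]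
  simp only [map_smul, C.derivL_coord_natV _ _ hu, smul_eq_mul]
  simp

end VChart

end Sections

section Change

open Matrix

variable {p r : ℕ} {A : GenLieAlgebroid FF F h η}

/-! ### Matrices of functions -/

section MatrixFunctions

variable {n : ℕ}

/-- The values at `u` of a matrix of functions on `P`. -/
def valMat (f : Fin n → Fin n → TotalSpace FP P → ℝ) (u : TotalSpace FP P) :
    Matrix (Fin n) (Fin n) ℝ :=
  Matrix.of fun i j => f i j u

variable (A) in
/-- The derivative along the anchor of a matrix of functions on `P`. -/
def derivMat (f : Fin n → Fin n → TotalSpace FP P → ℝ) (u : TotalSpace FP P) :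
    gtb A u →ₗ[ℝ] Matrix (Fin n) (Fin n) ℝ where
  toFun X := Matrix.of fun i j => derivL A (f i j) u X
  map_add' X Y := by ext; simp
  map_smul' c X := by ext; simp

variable {f f' Λ : Fin n → Fin n → TotalSpace FP P → ℝ} {u : TotalSpace FP P}

theorem derivMat_apply (X : gtb A u) (i j : Fin n) :
    derivMat A f u X i j = derivL A (f i j) u X := rfl

/-- The relation `f' = Λᵀ f Λ` for matrices of functions, evaluated at a point. -/
theorem valMat_congruence
    (h : ∀ i j, f' i j u = ∑ k, ∑ l, Λ k i u * f k l u * Λ l j u) :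
    valMat f' u = (valMat Λ u)ᵀ * valMat f u * valMat Λ u := by
  ext i j
  simp only [valMat, Matrix.mul_apply, Matrix.of_apply, Matrix.transpose_apply, h,
    Finset.sum_mul]
  exact Finset.sum_comm

/-- The derivative of the relation `f' = Λᵀ f Λ`. -/
theorem derivMat_congruence (hf : ∀ i j, DiffFunAt EM (f i j) u)
    (hΛ : ∀ i j, DiffFunAt EM (Λ i j) u)
    (h : ∀ i j, ∀ᶠ v in 𝓝 u, f' i j v = ∑ k, ∑ l, Λ k i v * f k l v * Λ l j v) (X : gtb A u) :
    derivMat A f' u X = (derivMat A Λ u X)ᵀ * valMat f u * valMat Λ u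
      + (valMat Λ u)ᵀ * derivMat A f u X * valMat Λ u
      + (valMat Λ u)ᵀ * valMat f u * derivMat A Λ u X := by
  ext i j
  rw [derivMat_apply, derivL_congr (h i j),
    derivL_sum _ fun k => DiffFunAt.sum _ fun l => ((hΛ k i).mul (hf k l)).mul (hΛ l j)]
  simp only [Matrix.add_apply, Matrix.mul_apply, Matrix.transpose_apply, Finset.sum_mul]
  rw [Finset.sum_comm (f := fun x i_1 => derivMat A Λ u X i_1 i * _ * _),
    Finset.sum_comm (f := fun x i_1 => valMat Λ u i_1 i * derivMat A f u X _ _ * _),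
    Finset.sum_comm (f := fun x i_1 => valMat Λ u i_1 i * valMat f u _ _ * _),
    ← Finset.sum_add_distrib, ← Finset.sum_add_distrib, LinearMap.sum_apply]
  refine Finset.sum_congr rfl fun k _ => ?_
  rw [derivL_sum _ fun l => ((hΛ k i).mul (hf k l)).mul (hΛ l j), LinearMap.sum_apply,
    ← Finset.sum_add_distrib, ← Finset.sum_add_distrib]
  refine Finset.sum_congr rfl fun l _ => ?_
  rw [derivL_mul ((hΛ k i).mul (hf k l)) (hΛ l j), derivL_mul (hΛ k i) (hf k l)]
  simp only [LinearMap.add_apply, LinearMap.smul_apply, smul_eq_mul, derivMat_apply, valMat,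
    Matrix.of_apply]
  ring

end MatrixFunctions

namespace VChart

variable (C : VChart FF FP F P h p r) {Γ : RhoConnection FP P A} (G : PseudoMetric Γ)

/-! ### The components of the metric -/

theorem contMDiffOn_gH (α β : Fin p) : SmoothFunOn EM (C.gH G α β) C.dom :=
  G.smooth _ _ _ C.isOpen_dom (C.smoothOn_delta Γ α) (C.smoothOn_delta Γ β)

theorem contMDiffOn_gV (a b : Fin r) : SmoothFunOn EM (C.gV G a b) C.dom :=
  G.smooth _ _ _ C.isOpen_dom (C.smoothOn_natV a) (C.smoothOn_natV b)

theorem gH_symm (α β : Fin p) (u : TotalSpace FP P) : C.gH G α β u = C.gH G β α u := G.symm _ _ _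

theorem gV_symm (a b : Fin r) (u : TotalSpace FP P) : C.gV G a b u = C.gV G b a u := G.symm _ _ _

theorem transpose_valMat_gH (u : TotalSpace FP P) :
    (valMat (C.gH G) u)ᵀ = valMat (C.gH G) u := by
  ext i j
  exact C.gH_symm G j i u

theorem transpose_valMat_gV (u : TotalSpace FP P) :
    (valMat (C.gV G) u)ᵀ = valMat (C.gV G) u := by
  ext i j
  exact C.gV_symm G j i u

theorem transpose_derivMat_gH (u : TotalSpace FP P) (X : gtb A u) :
    (derivMat A (C.gH G) u X)ᵀ = derivMat A (C.gH G) u X := by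
  ext i j
  have : C.gH G j i = C.gH G i j := funext fun v => C.gH_symm G j i v
  simp only [transpose_apply, derivMat_apply, this]

theorem transpose_derivMat_gV (u : TotalSpace FP P) (X : gtb A u) :
    (derivMat A (C.gV G) u X)ᵀ = derivMat A (C.gV G) u X := by
  ext i j
  have : C.gV G j i = C.gV G i j := funext fun v => C.gV_symm G j i v
  simp only [transpose_apply, derivMat_apply, this]

/-- `G` is nondegenerate on the horizontal subbundle, so the matrix `(g_{αβ})` is invertible. -/
theorem isUnit_det_gH {u : TotalSpace FP P} (hu : u.proj ∈ C.U) :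
    IsUnit (valMat (C.gH G) u).det := by
  rw [isUnit_iff_ne_zero]
  intro hdet
  obtain ⟨v, hv, hv0⟩ := Matrix.exists_mulVec_eq_zero_iff.2 hdet
  have hX : (∑ α, v α • C.delta Γ α u) = 0 := by
    refine G.nondeg_horizontal u _ (Submodule.sum_mem _ fun α _ =>
      Submodule.smul_mem _ _ (C.delta_mem_horizontal Γ α hu)) fun Y hY => ?_
    rw [C.eq_sum Γ hu Y]
    simp only [C.coeffV_eq_zero Γ hY, zero_smul, Finset.sum_const_zero, add_zero, map_sum,
      map_smul, smul_eq_mul, LinearMap.sum_apply, LinearMap.smul_apply]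
    refine Finset.sum_eq_zero fun β _ => ?_
    have h1 := congrFun hv0 β
    simp only [mulVec, dotProduct, valMat, of_apply, Pi.zero_apply, gH] at h1
    have h2 : ∑ x, v x * (G.form u (C.delta Γ x u)) (C.delta Γ β u) = 0 := by
      rw [← h1]
      exact Finset.sum_congr rfl fun x _ => by rw [G.symm]; ring
    rw [h2, mul_zero]
  refine hv (funext fun β => ?_)
  have h1 := congrArg (C.coeffH A β u) hX
  simpa [map_sum, C.coeffH_delta Γ β _ hu] using h1

/-- `G` is nondegenerate on the vertical subbundle, so the matrix `(g^{ab})` is invertible. -/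
theorem isUnit_det_gV {u : TotalSpace FP P} (hu : u.proj ∈ C.U) :
    IsUnit (valMat (C.gV G) u).det := by
  rw [isUnit_iff_ne_zero]
  intro hdet
  obtain ⟨v, hv, hv0⟩ := Matrix.exists_mulVec_eq_zero_iff.2 hdet
  have hX : (∑ a, v a • C.natV A a u) = 0 := by
    refine G.nondeg_vertical u _ (Submodule.sum_mem _ fun a _ =>
      Submodule.smul_mem _ _ (C.natV_mem_vertical a u)) fun Y hY => ?_
    rw [C.eq_sum Γ hu Y]
    simp only [C.coeffH_eq_zero hY, zero_smul, Finset.sum_const_zero, zero_add, map_sum,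
      map_smul, smul_eq_mul, LinearMap.sum_apply, LinearMap.smul_apply]
    refine Finset.sum_eq_zero fun β _ => ?_
    have h1 := congrFun hv0 β
    simp only [mulVec, dotProduct, valMat, of_apply, Pi.zero_apply, gV] at h1
    have h2 : ∑ x, v x * (G.form u (C.natV A x u)) (C.natV A β u) = 0 := by
      rw [← h1]
      exact Finset.sum_congr rfl fun x _ => by rw [G.symm]; ring
    rw [h2, mul_zero]
  refine hv (funext fun β => ?_)
  have h1 := congrArg (C.coeffV Γ β u) hX
  simpa [map_sum, C.coeffV_natV Γ β _ hu] using h1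

/-! ### The connection forms -/

/-- The matrix `(H^α_{βγ})_{αβ}`. -/
def matHh (γ : Fin p) (u : TotalSpace FP P) : Matrix (Fin p) (Fin p) ℝ :=
  Matrix.of fun α β => C.cHh G α β γ u

/-- The matrix `(V^{αc}_β)_{αβ}`. -/
def matVh (c : Fin r) (u : TotalSpace FP P) : Matrix (Fin p) (Fin p) ℝ :=
  Matrix.of fun α β => C.cVh G α β c u

/-- The matrix `(H^a_{bγ})_{ba}`. -/
def matHv (γ : Fin p) (u : TotalSpace FP P) : Matrix (Fin r) (Fin r) ℝ :=
  Matrix.of fun b a => C.cHv G a b γ u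

/-- The matrix `(V^{ac}_b)_{ba}`. -/
def matVv (c : Fin r) (u : TotalSpace FP P) : Matrix (Fin r) (Fin r) ℝ :=
  Matrix.of fun b a => C.cVv G a b c u

variable (Γ) in
/-- The matrix `(B^a_{bγ})_{ba}` of the Berwald connection. -/
def matB (γ : Fin p) (u : TotalSpace FP P) : Matrix (Fin r) (Fin r) ℝ :=
  Matrix.of fun b a => C.berwald Γ a b γ u

/-- The connection form on the horizontal subbundle: its value at `X = X^γ δ_γ + X_c ∂^c` is the
matrix `(X^γ H^α_{βγ} + X_c V^{αc}_β)_{αβ}`. -/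
def formH (u : TotalSpace FP P) : gtb A u →ₗ[ℝ] Matrix (Fin p) (Fin p) ℝ :=
  ∑ γ, (C.coeffH A γ u).smulRight (C.matHh G γ u) +
    ∑ c, (C.coeffV Γ c u).smulRight (C.matVh G c u)

/-- The connection form on the vertical subbundle: its value at `X = X^γ δ_γ + X_c ∂^c` is the
matrix `(X^γ H^a_{bγ} + X_c V^{ac}_b)_{ba}`. -/
def formV (u : TotalSpace FP P) : gtb A u →ₗ[ℝ] Matrix (Fin r) (Fin r) ℝ :=
  ∑ γ, (C.coeffH A γ u).smulRight (C.matHv G γ u) +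
    ∑ c, (C.coeffV Γ c u).smulRight (C.matVv G c u)

variable {u : TotalSpace FP P}

theorem formH_delta (hu : u.proj ∈ C.U) (γ : Fin p) :
    C.formH G u (C.delta Γ γ u) = C.matHh G γ u := by
  simp [formH, C.coeffH_delta Γ _ γ hu, C.coeffV_delta Γ _ γ hu]

theorem formH_natV (hu : u.proj ∈ C.U) (c : Fin r) :
    C.formH G u (C.natV A c u) = C.matVh G c u := by
  simp [formH, C.coeffH_natV, C.coeffV_natV Γ _ c hu]

theorem formV_delta (hu : u.proj ∈ C.U) (γ : Fin p) :
    C.formV G u (C.delta Γ γ u) = C.matHv G γ u := by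
  simp [formV, C.coeffH_delta Γ _ γ hu, C.coeffV_delta Γ _ γ hu]

theorem formV_natV (hu : u.proj ∈ C.U) (c : Fin r) :
    C.formV G u (C.natV A c u) = C.matVv G c u := by
  simp [formV, C.coeffH_natV, C.coeffV_natV Γ _ c hu]

theorem matHh_eq (γ : Fin p) (u : TotalSpace FP P) :
    C.matHh G γ u = leviCivita (valMat (C.gH G) u)
      (fun γ => derivMat A (C.gH G) u (C.delta Γ γ u))
      (fun θ α β => C.structFun A θ α β (h u.proj)) γ := rfl

theorem matVv_eq (c : Fin r) (u : TotalSpace FP P) :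
    C.matVv G c u = leviCivita (valMat (C.gV G) u)
      (fun c => derivMat A (C.gV G) u (C.natV A c u)) (fun _ _ _ => 0) c := by
  ext b a
  simp [leviCivita, matVv, cVv, gVinv, valMat, derivMat_apply, dP, anchorDeriv_eq]

theorem matVh_eq (c : Fin r) (u : TotalSpace FP P) :
    C.matVh G c u = metrize (valMat (C.gH G) u) (derivMat A (C.gH G) u (C.natV A c u)) 0 := by
  ext α β
  simp [metrize, matVh, cVh, gHinv, valMat, derivMat_apply, dP, anchorDeriv_eq, Matrix.mul_apply]

theorem matHv_eq (γ : Fin p) (u : TotalSpace FP P) :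
    C.matHv G γ u = metrize (valMat (C.gV G) u) (derivMat A (C.gV G) u (C.delta Γ γ u))
      (C.matB Γ γ u) := by
  ext b a
  simp only [metrize, matHv, cHv, gVinv, valMat, derivMat_apply, dDelta, anchorDeriv_eq,
    Matrix.mul_apply, gVBerwald, matB, Matrix.add_apply, Matrix.smul_apply, Matrix.of_apply,
    Matrix.sub_apply, Matrix.transpose_apply, smul_eq_mul]
  simp only [mul_comm]

/-- A property of vectors that is stable under linear combinations holds for all vectors if it
holds for the adapted base. -/
theorem adapted_induction (hu : u.proj ∈ C.U) {φ : gtb A u → Prop} (h0 : φ 0)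
    (hadd : ∀ X Y, φ X → φ Y → φ (X + Y)) (hsmul : ∀ (c : ℝ) X, φ X → φ (c • X))
    (hδ : ∀ γ, φ (C.delta Γ γ u)) (hV : ∀ c, φ (C.natV A c u)) (X : gtb A u) : φ X := by
  rw [C.eq_sum Γ hu X]
  exact hadd _ _ (Finset.sum_induction _ φ hadd h0 fun α _ => hsmul _ _ (hδ α))
    (Finset.sum_induction _ φ hadd h0 fun a _ => hsmul _ _ (hV a))

/-- The connection form on the horizontal subbundle is compatible with the metric. -/
theorem formH_metric (hu : u.proj ∈ C.U) (X : gtb A u) :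
    (C.formH G u X)ᵀ * valMat (C.gH G) u + valMat (C.gH G) u * C.formH G u X =
      derivMat A (C.gH G) u X := by
  refine C.adapted_induction (Γ := Γ) hu (φ := fun X =>
    (C.formH G u X)ᵀ * valMat (C.gH G) u + valMat (C.gH G) u * C.formH G u X =
      derivMat A (C.gH G) u X) (by simp) (fun X Y hX hY => ?_) (fun c X hX => ?_) (fun γ => ?_)
    (fun c => ?_) X
  · rw [map_add, map_add, ← hX, ← hY, transpose_add, Matrix.add_mul, Matrix.mul_add]
    abel
  · rw [map_smul, map_smul, ← hX, transpose_smul, Matrix.smul_mul, Matrix.mul_smul, smul_add]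
  · rw [C.formH_delta G hu, matHh_eq, leviCivita_metric (C.isUnit_det_gH G hu)
      (C.transpose_valMat_gH G u) (fun γ => C.transpose_derivMat_gH G u _)
      (fun θ α β => C.structFun_skew A θ α β (mem_image_of_mem h hu))]
  · rw [C.formH_natV G hu, matVh_eq, metrize_metric (C.isUnit_det_gH G hu)
      (C.transpose_valMat_gH G u) (C.transpose_derivMat_gH G u _)]

/-- The connection form on the vertical subbundle is compatible with the metric. -/
theorem formV_metric (hu : u.proj ∈ C.U) (X : gtb A u) :
    (C.formV G u X)ᵀ * valMat (C.gV G) u + valMat (C.gV G) u * C.formV G u X =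
      derivMat A (C.gV G) u X := by
  refine C.adapted_induction (Γ := Γ) hu (φ := fun X =>
    (C.formV G u X)ᵀ * valMat (C.gV G) u + valMat (C.gV G) u * C.formV G u X =
      derivMat A (C.gV G) u X) (by simp) (fun X Y hX hY => ?_) (fun c X hX => ?_) (fun γ => ?_)
    (fun c => ?_) X
  · rw [map_add, map_add, ← hX, ← hY, transpose_add, Matrix.add_mul, Matrix.mul_add]
    abel
  · rw [map_smul, map_smul, ← hX, transpose_smul, Matrix.smul_mul, Matrix.mul_smul, smul_add]
  · rw [C.formV_delta G hu, matHv_eq, metrize_metric (C.isUnit_det_gV G hu)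
      (C.transpose_valMat_gV G u) (C.transpose_derivMat_gV G u _)]
  · rw [C.formV_natV G hu, matVv_eq, leviCivita_metric (C.isUnit_det_gV G hu)
      (C.transpose_valMat_gV G u) (fun γ => C.transpose_derivMat_gV G u _) (by simp)]

end VChart

end Change

/-! ### Transition functions between charts -/

section ChangeOfChart

open Matrix

variable {p r : ℕ} {A : GenLieAlgebroid FF F h η}

namespace VChart

variable (C C' : VChart FF FP F P h p r) {Γ : RhoConnection FP P A}

/-- The transition functions between the frames of `P`: `s'_a = sTrans b a • s_b`. -/
def sTrans (b a : Fin r) (x : M) : ℝ := C.frame_s.coeff b x (C'.s a x)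

/-- The transition functions between the horizontal parts of the adapted bases,
`δ'_γ = lamH α γ • δ_α`, as functions on `P`. -/
def lamH (α γ : Fin p) (v : TotalSpace FP P) : ℝ := C.tTrans C' α γ (h v.proj)

/-- The transition functions between the vertical parts of the adapted bases,
`∂'^a = lamV b a • ∂^b`, as functions on `P`. -/
def lamV (b a : Fin r) (v : TotalSpace FP P) : ℝ := C.sTrans C' b a v.proj

theorem contMDiffOn_sTrans (b a : Fin r) :
    ContMDiffOn 𝓘(ℝ, EM) 𝓘(ℝ, ℝ) ∞ (C.sTrans C' b a) (C.U ∩ C'.U) :=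
  contMDiffOn_coeff_along (f := fun x : M => x) C.frame_s C.isOpen_U (fun _ hq => hq.1)
    ((C'.frame_s.contMDiffOn a).mono inter_subset_right) b

theorem contMDiffOn_lamH (α γ : Fin p) :
    SmoothFunOn EM (C.lamH C' α γ : TotalSpace FP P → ℝ) (C.dom ∩ C'.dom) :=
  (C.contMDiffOn_tTrans C' α γ).comp (SmoothOn.contMDiffOn_base _)
    fun _ hu => ⟨mem_image_of_mem h hu.1, mem_image_of_mem h hu.2⟩

theorem contMDiffOn_lamV (b a : Fin r) :
    SmoothFunOn EM (C.lamV C' b a : TotalSpace FP P → ℝ) (C.dom ∩ C'.dom) :=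
  (C.contMDiffOn_sTrans C' b a).comp (contMDiff_proj P).contMDiffOn fun _ hu => hu

variable {u : TotalSpace FP P}

theorem diffFunAt_lamH (hu : u.proj ∈ C.U) (hu' : u.proj ∈ C'.U) (α γ : Fin p) :
    DiffFunAt EM (C.lamH C' α γ) u :=
  (C.contMDiffOn_lamH C' α γ).diffFunAt (C.isOpen_dom.inter C'.isOpen_dom) ⟨hu, hu'⟩

theorem diffFunAt_lamV (hu : u.proj ∈ C.U) (hu' : u.proj ∈ C'.U) (b a : Fin r) :
    DiffFunAt EM (C.lamV C' b a) u :=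
  (C.contMDiffOn_lamV C' b a).diffFunAt (C.isOpen_dom.inter C'.isOpen_dom) ⟨hu, hu'⟩

variable (Γ) in
theorem delta_change (hu : u.proj ∈ C.U) (hu' : u.proj ∈ C'.U) (γ : Fin p) :
    C'.delta Γ γ u = ∑ ν, C.lamH C' ν γ u • C.delta Γ ν u := by
  have h1 := C.eq_sum Γ hu (C'.delta Γ γ u)
  simp only [coeffH_apply, coeffV_apply, C'.delta_fst Γ γ hu', C'.toFun_delta Γ γ hu', map_zero,
    zero_smul, Finset.sum_const_zero, add_zero] at h1
  exact h1

theorem natV_change (Γ : RhoConnection FP P A) (hu : u.proj ∈ C.U) (a : Fin r) :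
    C'.natV A a u = ∑ b, C.lamV C' b a u • C.natV A b u := by
  have h1 := C.eq_sum Γ hu (C'.natV A a u)
  simp only [C.coeffH_eq_zero (C'.natV_mem_vertical a u), coeffV_apply, C'.toFun_natV,
    zero_smul, Finset.sum_const_zero, zero_add] at h1
  exact h1

theorem isUnit_det_lamH (hu : u.proj ∈ C.U) (hu' : u.proj ∈ C'.U) :
    IsUnit (valMat (C.lamH C') u).det := by
  refine Matrix.isUnit_det_of_right_inverse (B := valMat (C'.lamH C) u) ?_
  ext α β
  have h1 := congrArg (C.frame_t.coeff α (h u.proj))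
    (C'.t_eq_sum C β (mem_image_of_mem h hu'))
  rw [coeff_frame C.frame_t (mem_image_of_mem h hu), map_sum] at h1
  rw [Matrix.one_apply, h1, Matrix.mul_apply]
  refine Finset.sum_congr rfl fun γ _ => ?_
  rw [map_smul, smul_eq_mul, mul_comm]
  rfl

theorem isUnit_det_lamV (hu : u.proj ∈ C.U) (hu' : u.proj ∈ C'.U) :
    IsUnit (valMat (C.lamV C') u).det := by
  refine Matrix.isUnit_det_of_right_inverse (B := valMat (C'.lamV C) u) ?_
  ext a b
  have h1 := congrArg (C.frame_s.coeff a u.proj) (C'.sum_coeff_s hu' (C.s b u.proj))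
  rw [coeff_frame C.frame_s hu, map_sum] at h1
  rw [Matrix.one_apply, ← h1, Matrix.mul_apply]
  refine Finset.sum_congr rfl fun γ _ => ?_
  rw [map_smul, smul_eq_mul, mul_comm]
  rfl

variable (A) in
theorem derivMat_lamH_natV (hu : u.proj ∈ C.U) (hu' : u.proj ∈ C'.U) (w : P u.proj) :
    derivMat A (C.lamH C') u (vert A u w) = 0 := by
  ext α γ
  exact derivL_vert_eq_zero (C.diffFunAt_lamH C' hu hu' α γ)
    (fun v hv => by simp only [lamH, hv]) w

variable (A) in
theorem derivMat_lamV_natV (hu : u.proj ∈ C.U) (hu' : u.proj ∈ C'.U) (w : P u.proj) :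
    derivMat A (C.lamV C') u (vert A u w) = 0 := by
  ext b a
  refine derivL_vert_eq_zero (C.diffFunAt_lamV C' hu hu' b a) (fun v hv => ?_) w
  obtain ⟨x, z⟩ := v
  subst hv
  rfl

theorem derivMat_lamH_apply (hu : u.proj ∈ C.U) (hu' : u.proj ∈ C'.U) (X : gtb A u)
    (α γ : Fin p) : derivMat A (C.lamH C') u X α γ =
      A.baseDeriv (fun x => C.tTrans C' α γ (h x)) u.proj X.1.1 := by
  refine derivL_comp_proj (f := fun x => C.tTrans C' α γ (h x)) ?_ X
  have h1 : ContMDiffOn 𝓘(ℝ, EM) 𝓘(ℝ, ℝ) ∞ (fun x => C.tTrans C' α γ (h x)) (C.U ∩ C'.U) :=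
    (C.contMDiffOn_tTrans C' α γ).comp h.contMDiff.contMDiffOn
      fun _ hu => ⟨mem_image_of_mem h hu.1, mem_image_of_mem h hu.2⟩
  exact (h1.contMDiffAt ((C.isOpen_U.inter C'.isOpen_U).mem_nhds ⟨hu, hu'⟩)).mdifferentiableAt
    (by simp)

theorem eventually_dom_inter (hu : u.proj ∈ C.U) (hu' : u.proj ∈ C'.U) :
    ∀ᶠ v : TotalSpace FP P in 𝓝 u, v.proj ∈ C.U ∧ v.proj ∈ C'.U :=
  (C.eventually_dom hu).and (C'.eventually_dom hu')

/-! ### The metric in two charts -/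

variable (G : PseudoMetric Γ)

theorem gH_change (hu : u.proj ∈ C.U) (hu' : u.proj ∈ C'.U) (i j : Fin p) :
    C'.gH G i j u = ∑ k, ∑ l, C.lamH C' k i u * C.gH G k l u * C.lamH C' l j u := by
  simp only [gH, C.delta_change C' Γ hu hu', map_sum, map_smul, LinearMap.sum_apply,
    LinearMap.smul_apply, smul_eq_mul, Finset.mul_sum]
  rw [Finset.sum_comm]
  exact Finset.sum_congr rfl fun _ _ => Finset.sum_congr rfl fun _ _ => by ring

theorem gV_change (hu : u.proj ∈ C.U) (i j : Fin r) :
    C'.gV G i j u = ∑ k, ∑ l, C.lamV C' k i u * C.gV G k l u * C.lamV C' l j u := by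
  simp only [gV, C.natV_change C' Γ hu, map_sum, map_smul, LinearMap.sum_apply,
    LinearMap.smul_apply, smul_eq_mul, Finset.mul_sum]
  rw [Finset.sum_comm]
  exact Finset.sum_congr rfl fun _ _ => Finset.sum_congr rfl fun _ _ => by ring

theorem valMat_gH_change (hu : u.proj ∈ C.U) (hu' : u.proj ∈ C'.U) :
    valMat (C'.gH G) u = (valMat (C.lamH C') u)ᵀ * valMat (C.gH G) u * valMat (C.lamH C') u :=
  valMat_congruence (C.gH_change C' G hu hu')

theorem valMat_gV_change (hu : u.proj ∈ C.U) :
    valMat (C'.gV G) u = (valMat (C.lamV C') u)ᵀ * valMat (C.gV G) u * valMat (C.lamV C') u :=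
  valMat_congruence (C.gV_change C' G hu)

theorem derivMat_gH_change (hu : u.proj ∈ C.U) (hu' : u.proj ∈ C'.U) (X : gtb A u) :
    derivMat A (C'.gH G) u X =
      (derivMat A (C.lamH C') u X)ᵀ * valMat (C.gH G) u * valMat (C.lamH C') u
      + (valMat (C.lamH C') u)ᵀ * derivMat A (C.gH G) u X * valMat (C.lamH C') u
      + (valMat (C.lamH C') u)ᵀ * valMat (C.gH G) u * derivMat A (C.lamH C') u X :=
  derivMat_congruence (fun i j => (C.contMDiffOn_gH G i j).diffFunAt C.isOpen_dom hu)
    (fun i j => C.diffFunAt_lamH C' hu hu' i j) (fun i j =>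
      (C.eventually_dom_inter C' hu hu').mono fun _ hv => C.gH_change C' G hv.1 hv.2 i j) X

theorem derivMat_gV_change (hu : u.proj ∈ C.U) (hu' : u.proj ∈ C'.U) (X : gtb A u) :
    derivMat A (C'.gV G) u X =
      (derivMat A (C.lamV C') u X)ᵀ * valMat (C.gV G) u * valMat (C.lamV C') u
      + (valMat (C.lamV C') u)ᵀ * derivMat A (C.gV G) u X * valMat (C.lamV C') u
      + (valMat (C.lamV C') u)ᵀ * valMat (C.gV G) u * derivMat A (C.lamV C') u X :=
  derivMat_congruence (fun i j => (C.contMDiffOn_gV G i j).diffFunAt C.isOpen_dom hu)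
    (fun i j => C.diffFunAt_lamV C' hu hu' i j) (fun i j =>
      (C.eventually_dom hu).mono fun _ hv => C.gV_change C' G hv i j) X

/-! ### The Berwald connection in two charts -/

theorem coord_change (hu' : u.proj ∈ C'.U) (b : Fin r) :
    C.coord b u = ∑ a, C.lamV C' b a u * C'.coord a u := by
  have h1 := congrArg (C.frame_s.coeff b u.proj) (C'.sum_coeff_s hu' u.2)
  rw [map_sum] at h1
  simp only [map_smul, smul_eq_mul] at h1
  rw [coord, ← h1]
  exact Finset.sum_congr rfl fun _ _ => mul_comm _ _

variable (Γ) in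
/-- The transformation law of the functions `Γ_{bγ}`: differentiate `p_b = Λ_{ba} p'_a` along
`δ'_γ`, using `δ_γ p_b = Γ_{bγ}`. -/
theorem gam_change (hu : u.proj ∈ C.U) (hu' : u.proj ∈ C'.U) (b : Fin r) (γ : Fin p) :
    ∑ ν, C.lamH C' ν γ u * C.gam Γ b ν u =
      ∑ a, (C.lamV C' b a u * C'.gam Γ a γ u +
        C'.coord a u * derivL A (C.lamV C' b a) u (C'.delta Γ γ u)) := by
  have hd : ∀ a, DiffFunAt EM (fun v => C.lamV C' b a v * C'.coord a v) u := fun a =>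
    (C.diffFunAt_lamV C' hu hu' b a).mul (C'.mdifferentiableAt_coord a hu')
  have h1 : derivL A (C.coord b) u = derivL A (fun v => ∑ a, C.lamV C' b a v * C'.coord a v) u :=
    derivL_congr ((C.eventually_dom_inter C' hu hu').mono fun _ hv =>
      C.coord_change C' hv.2 b)
  have h2 := DFunLike.congr_fun h1 (C'.delta Γ γ u)
  rw [derivL_sum _ hd, LinearMap.sum_apply] at h2
  have h3 : derivL A (C.coord b) u (C'.delta Γ γ u) = ∑ ν, C.lamH C' ν γ u * C.gam Γ b ν u := by
    rw [C.delta_change C' Γ hu hu', map_sum]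
    simp only [map_smul, C.derivL_coord_delta Γ b _ hu, smul_eq_mul]
  rw [← h3, h2]
  refine Finset.sum_congr rfl fun a _ => ?_
  rw [derivL_mul (C.diffFunAt_lamV C' hu hu' b a) (C'.mdifferentiableAt_coord a hu'),
    LinearMap.add_apply, LinearMap.smul_apply, LinearMap.smul_apply,
    C'.derivL_coord_delta Γ a γ hu', smul_eq_mul, smul_eq_mul]

variable (Γ) in
theorem matB_apply (γ : Fin p) (a b : Fin r) (u : TotalSpace FP P) :
    C.matB Γ γ u b a = -derivL A (C.gam Γ b γ) u (C.natV A a u) := rfl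

variable (Γ) in
/-- The Berwald connection is independent of the chart: differentiate the transformation law of the
functions `Γ_{bγ}` in the direction of the fibres. -/
theorem matB_change (hu : u.proj ∈ C.U) (hu' : u.proj ∈ C'.U) (γ : Fin p) :
    valMat (C.lamV C') u * C'.matB Γ γ u = derivMat A (C.lamV C') u (C'.delta Γ γ u)
      + (∑ ν, C.lamH C' ν γ u • C.matB Γ ν u) * valMat (C.lamV C') u := by
  ext b c
  set X : gtb A u := C'.natV A c u with hX
  have hO : IsOpen (C.dom ∩ C'.dom : Set (TotalSpace FP P)) := C.isOpen_dom.inter C'.isOpen_dom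
  have hlV : ∀ b a, derivL A (C.lamV C' b a) u X = 0 := fun b a =>
    congrFun (congrFun (C.derivMat_lamV_natV A C' hu hu' (C'.s c u.proj)) b) a
  have hlH : ∀ b a, derivL A (C.lamH C' b a) u X = 0 := fun b a =>
    congrFun (congrFun (C.derivMat_lamH_natV A C' hu hu' (C'.s c u.proj)) b) a
  have hgam : ∀ b γ, DiffFunAt EM (C.gam Γ b γ) u := fun b γ =>
    (C.contMDiffOn_gam Γ b γ).diffFunAt C.isOpen_dom hu
  have hgam' : ∀ b γ, DiffFunAt EM (C'.gam Γ b γ) u := fun b γ =>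
    (C'.contMDiffOn_gam Γ b γ).diffFunAt C'.isOpen_dom hu'
  have hk : ∀ a, DiffFunAt EM (fun v => derivL A (C.lamV C' b a) v (C'.delta Γ γ v)) u := fun a =>
    (contMDiffOn_derivL hO (C.contMDiffOn_lamV C' b a)
      ((C'.smoothOn_delta Γ γ).mono inter_subset_right)).diffFunAt hO ⟨hu, hu'⟩
  -- The derivative of `Λ` along `δ'_γ` depends only on the base point.
  have hkX : ∀ a, derivL A (fun v => derivL A (C.lamV C' b a) v (C'.delta Γ γ v)) u X = 0 := by
    intro a
    refine derivL_vert_eq_zero (hk a) (fun v hv => ?_) _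
    have hs : ∀ v : TotalSpace FP P, v.proj ∈ C.U → v.proj ∈ C'.U →
        derivL A (C.lamV C' b a) v (C'.delta Γ γ v) =
          A.baseDeriv (C.sTrans C' b a) v.proj (C'.t γ (h v.proj)) := by
      intro v h1 h2
      rw [← C'.delta_fst Γ γ h2]
      exact derivL_comp_proj (((C.contMDiffOn_sTrans C' b a).contMDiffAt
        ((C.isOpen_U.inter C'.isOpen_U).mem_nhds ⟨h1, h2⟩)).mdifferentiableAt (by simp)) _
    rw [hs v (by rwa [hv]) (by rwa [hv]), hs u hu hu', hv]
  have h1 : derivL A (fun v => ∑ ν, C.lamH C' ν γ v * C.gam Γ b ν v) u =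
      derivL A (fun v => ∑ a, (C.lamV C' b a v * C'.gam Γ a γ v +
        C'.coord a v * derivL A (C.lamV C' b a) v (C'.delta Γ γ v))) u :=
    derivL_congr ((C.eventually_dom_inter C' hu hu').mono fun _ hv =>
      C.gam_change C' Γ hv.1 hv.2 b γ)
  have h2 := DFunLike.congr_fun h1 X
  rw [derivL_sum _ fun ν => (C.diffFunAt_lamH C' hu hu' ν γ).mul (hgam b ν),
    derivL_sum (f := fun a v => C.lamV C' b a v * C'.gam Γ a γ v +
        C'.coord a v * derivL A (C.lamV C' b a) v (C'.delta Γ γ v)) _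
      fun a => ((C.diffFunAt_lamV C' hu hu' b a).mul (hgam' a γ)).add
        (DiffFunAt.mul (C'.mdifferentiableAt_coord a hu') (hk a)), LinearMap.sum_apply,
    LinearMap.sum_apply] at h2
  have h3 : ∀ ν, derivL A (fun v => C.lamH C' ν γ v * C.gam Γ b ν v) u X =
      -∑ a, C.lamH C' ν γ u * C.matB Γ ν u b a * C.lamV C' a c u := by
    intro ν
    rw [derivL_mul (C.diffFunAt_lamH C' hu hu' ν γ) (hgam b ν), LinearMap.add_apply,
      LinearMap.smul_apply, LinearMap.smul_apply, hlH, smul_zero, add_zero, hX,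
      C.natV_change C' Γ hu, map_sum, Finset.smul_sum, ← Finset.sum_neg_distrib]
    refine Finset.sum_congr rfl fun a _ => ?_
    rw [map_smul, matB_apply, smul_eq_mul, smul_eq_mul]
    ring
  have h4 : ∀ a, derivL A (fun v => C.lamV C' b a v * C'.gam Γ a γ v +
        C'.coord a v * derivL A (C.lamV C' b a) v (C'.delta Γ γ v)) u X =
      -(C.lamV C' b a u * C'.matB Γ γ u a c) +
        (if a = c then derivL A (C.lamV C' b a) u (C'.delta Γ γ u) else 0) := by
    intro a
    rw [derivL_add ((C.diffFunAt_lamV C' hu hu' b a).mul (hgam' a γ))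
      (DiffFunAt.mul (C'.mdifferentiableAt_coord a hu') (hk a)),
      derivL_mul (C.diffFunAt_lamV C' hu hu' b a) (hgam' a γ),
      derivL_mul (C'.mdifferentiableAt_coord a hu') (hk a)]
    simp only [LinearMap.add_apply, LinearMap.smul_apply, hlV, hkX, smul_eq_mul,
      matB_apply]
    rw [hX, C'.derivL_coord_natV a c hu']
    simp
  simp only [h3, h4, Finset.sum_add_distrib, Finset.sum_ite_eq', Finset.mem_univ, if_true,
    Finset.sum_neg_distrib] at h2
  simp only [Matrix.add_apply, Matrix.mul_apply, Matrix.sum_apply, Matrix.smul_apply, smul_eq_mul,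
    Finset.sum_mul, valMat, Matrix.of_apply, derivMat_apply]
  linarith

/-! ### The connection forms in two charts -/

/-- The transformation law of the connection form on the horizontal subbundle. -/
theorem formH_change (hu : u.proj ∈ C.U) (hu' : u.proj ∈ C'.U) (X : gtb A u) :
    valMat (C.lamH C') u * C'.formH G u X =
      derivMat A (C.lamH C') u X + C.formH G u X * valMat (C.lamH C') u := by
  refine C'.adapted_induction (Γ := Γ) hu' (φ := fun X => valMat (C.lamH C') u * C'.formH G u X =
    derivMat A (C.lamH C') u X + C.formH G u X * valMat (C.lamH C') u) (by simp)
    (fun X Y hX hY => ?_) (fun c X hX => ?_) (fun γ => ?_) (fun c => ?_) X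
  · simp only [map_add, Matrix.mul_add, Matrix.add_mul, hX, hY]
    abel
  · simp only [map_smul, Matrix.mul_smul, Matrix.smul_mul, hX, smul_add]
  · have h1 : C.formH G u (C'.delta Γ γ u) = ∑ ν, valMat (C.lamH C') u ν γ • C.matHh G ν u := by
      rw [C.delta_change C' Γ hu hu', map_sum]
      simp only [map_smul, C.formH_delta G hu]
      rfl
    rw [C'.formH_delta G hu', h1]
    simp only [matHh_eq]
    refine leviCivita_change (dΛs := fun γ => derivMat A (C.lamH C') u (C'.delta Γ γ u))
      (C.isUnit_det_gH G hu) (C.transpose_valMat_gH G u) (fun γ => C.transpose_derivMat_gH G u _)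
      (fun θ α β => C.structFun_skew A θ α β (mem_image_of_mem h hu))
      (C.isUnit_det_lamH C' hu hu') (C.valMat_gH_change C' G hu hu') (fun γ => ?_)
      (fun μ γ β => ?_) γ
    · rw [C.derivMat_gH_change C' G hu hu']
      congr 4
      rw [C.delta_change C' Γ hu hu', map_sum]
      simp only [map_smul]
      rfl
    · rw [C.derivMat_lamH_apply C' hu hu', C.derivMat_lamH_apply C' hu hu', C'.delta_fst Γ γ hu',
        C'.delta_fst Γ β hu']
      exact C.structFun_change A C' μ γ β hu hu'
  · have h0 := C.derivMat_lamH_natV A C' hu hu' (C'.s c u.proj)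
    have h1 : C.formH G u (C'.natV A c u) =
        metrize (valMat (C.gH G) u) (derivMat A (C.gH G) u (C'.natV A c u)) 0 := by
      have h2 := metrize_sum (valMat (C.gH G) u) (fun b => C.lamV C' b c u)
        (fun b => derivMat A (C.gH G) u (C.natV A b u)) fun _ => 0
      simp only [smul_zero, Finset.sum_const_zero, ← matVh_eq] at h2
      rw [C.natV_change C' Γ hu, map_sum, map_sum]
      simp only [map_smul, C.formH_natV G hu]
      exact h2.symm
    rw [C'.formH_natV G hu', h1, matVh_eq]
    refine metrize_change (C.isUnit_det_gH G hu) (C.transpose_valMat_gH G u)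
      (C.isUnit_det_lamH C' hu hu') (C.valMat_gH_change C' G hu hu')
      (C.derivMat_gH_change C' G hu hu' _) ?_
    rw [Matrix.mul_zero, Matrix.zero_mul, add_zero]
    exact h0.symm

/-- The transformation law of the connection form on the vertical subbundle. -/
theorem formV_change (hu : u.proj ∈ C.U) (hu' : u.proj ∈ C'.U) (X : gtb A u) :
    valMat (C.lamV C') u * C'.formV G u X =
      derivMat A (C.lamV C') u X + C.formV G u X * valMat (C.lamV C') u := by
  refine C'.adapted_induction (Γ := Γ) hu' (φ := fun X => valMat (C.lamV C') u * C'.formV G u X =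
    derivMat A (C.lamV C') u X + C.formV G u X * valMat (C.lamV C') u) (by simp)
    (fun X Y hX hY => ?_) (fun c X hX => ?_) (fun γ => ?_) (fun c => ?_) X
  · simp only [map_add, Matrix.mul_add, Matrix.add_mul, hX, hY]
    abel
  · simp only [map_smul, Matrix.mul_smul, Matrix.smul_mul, hX, smul_add]
  · have h1 : C.formV G u (C'.delta Γ γ u) =
        metrize (valMat (C.gV G) u) (derivMat A (C.gV G) u (C'.delta Γ γ u))
          (∑ ν, C.lamH C' ν γ u • C.matB Γ ν u) := by
      rw [C.delta_change C' Γ hu hu', map_sum, map_sum]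
      simp only [map_smul, C.formV_delta G hu, matHv_eq, metrize_sum]
    rw [C'.formV_delta G hu', h1, matHv_eq]
    exact metrize_change (C.isUnit_det_gV G hu) (C.transpose_valMat_gV G u)
      (C.isUnit_det_lamV C' hu hu') (C.valMat_gV_change C' G hu)
      (C.derivMat_gV_change C' G hu hu' _) (C.matB_change C' Γ hu hu' γ)
  · have h0 := fun c => C.derivMat_lamV_natV A C' hu hu' (C'.s c u.proj)
    have h1 : C.formV G u (C'.natV A c u) = ∑ b, valMat (C.lamV C') u b c • C.matVv G b u := by
      rw [C.natV_change C' Γ hu, map_sum]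
      simp only [map_smul, C.formV_natV G hu]
      rfl
    rw [C'.formV_natV G hu', h1]
    simp only [matVv_eq]
    refine leviCivita_change (dΛs := fun c => derivMat A (C.lamV C') u (C'.natV A c u))
      (C.isUnit_det_gV G hu) (C.transpose_valMat_gV G u) (fun γ => C.transpose_derivMat_gV G u _)
      (by simp) (C.isUnit_det_lamV C' hu hu') (C.valMat_gV_change C' G hu) (fun γ => ?_)
      (fun μ γ β => ?_) c
    · rw [C.derivMat_gV_change C' G hu hu']
      congr 4
      rw [C.natV_change C' Γ hu, map_sum]
      simp only [map_smul]
      rfl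
    · have h2 : ∀ c, derivMat A (C.lamV C') u (C'.natV A c u) = 0 := h0
      simp [h2]

end VChart

end ChangeOfChart

section Components

variable {p r : ℕ} {A : GenLieAlgebroid FF F h η}

/-! ### Smoothness of the components -/

namespace SmoothFunOn

variable {f g : TotalSpace FP P → ℝ} {O : Set (TotalSpace FP P)}

theorem add (hf : SmoothFunOn EM f O) (hg : SmoothFunOn EM g O) :
    SmoothFunOn EM (fun u => f u + g u) O := ContMDiffOn.add hf hg

theorem sub (hf : SmoothFunOn EM f O) (hg : SmoothFunOn EM g O) :
    SmoothFunOn EM (fun u => f u - g u) O := ContMDiffOn.sub hf hg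

theorem neg (hf : SmoothFunOn EM f O) : SmoothFunOn EM (fun u => -f u) O := ContMDiffOn.neg hf

theorem mul (hf : SmoothFunOn EM f O) (hg : SmoothFunOn EM g O) :
    SmoothFunOn EM (fun u => f u * g u) O := ContMDiffOn.mul hf hg

theorem const_mul (c : ℝ) (hf : SmoothFunOn EM f O) : SmoothFunOn EM (fun u => c * f u) O :=
  mul contMDiffOn_const hf

theorem sum {ι : Type*} (S : Finset ι) {f : ι → TotalSpace FP P → ℝ}
    (hf : ∀ i, SmoothFunOn EM (f i) O) : SmoothFunOn EM (fun u => ∑ i ∈ S, f i u) O :=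
  contMDiffOn_finsetSum fun i _ => hf i

theorem det {n : ℕ} {f : Fin n → Fin n → TotalSpace FP P → ℝ}
    (hf : ∀ i j, SmoothFunOn EM (f i j) O) : SmoothFunOn EM (fun u => (valMat f u).det) O := by
  simp only [Matrix.det_apply']
  exact SmoothFunOn.sum _ fun σ => const_mul _ (contMDiffOn_finsetProd fun i _ => hf _ _)

/-- The entries of the inverse of a matrix of smooth functions are smooth, by Cramer's rule. -/
theorem inv {n : ℕ} {f : Fin n → Fin n → TotalSpace FP P → ℝ}
    (hf : ∀ i j, SmoothFunOn EM (f i j) O) (hd : ∀ u ∈ O, IsUnit (valMat f u).det)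
    (i j : Fin n) : SmoothFunOn EM (fun u => (valMat f u)⁻¹ i j) O := by
  have h1 : SmoothFunOn EM (fun u => ((valMat f u).updateRow j (Pi.single i 1)).det) O := by
    have h2 := SmoothFunOn.det (EM := EM) (O := O) (f := fun k l (u : TotalSpace FP P) =>
      if k = j then (Pi.single i 1 : Fin n → ℝ) l else f k l u) (fun k l => by
        by_cases hk : k = j
        · simpa only [hk, if_true] using contMDiffOn_const
        · simpa only [hk, if_false] using hf k l)
    refine h2.congr fun u _ => congrArg Matrix.det ?_
    ext k l
    simp [Matrix.updateRow_apply, valMat]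
  have h3 : SmoothFunOn EM (fun u => ((valMat f u).det)⁻¹) O :=
    (SmoothFunOn.det hf).inv₀ fun u hu => (hd u hu).ne_zero
  refine (h3.mul h1).congr fun u _ => ?_
  simp [Matrix.inv_def, Matrix.adjugate_apply]

end SmoothFunOn

namespace VChart

variable (C : VChart FF FP F P h p r) {Γ : RhoConnection FP P A} (G : PseudoMetric Γ)

theorem contMDiffOn_gHinv (α β : Fin p) : SmoothFunOn EM (C.gHinv G α β) C.dom :=
  SmoothFunOn.inv (C.contMDiffOn_gH G) (fun _ hu => C.isUnit_det_gH G hu) α β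

theorem contMDiffOn_gVinv (a b : Fin r) : SmoothFunOn EM (C.gVinv G a b) C.dom :=
  SmoothFunOn.inv (C.contMDiffOn_gV G) (fun _ hu => C.isUnit_det_gV G hu) a b

variable (Γ) in
theorem contMDiffOn_dDelta {f : TotalSpace FP P → ℝ} (hf : SmoothFunOn EM f C.dom) (γ : Fin p) :
    SmoothFunOn EM (C.dDelta Γ γ f) C.dom :=
  contMDiffOn_derivL C.isOpen_dom hf (C.smoothOn_delta Γ γ)

variable (A) in
theorem contMDiffOn_dP {f : TotalSpace FP P → ℝ} (hf : SmoothFunOn EM f C.dom) (c : Fin r) :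
    SmoothFunOn EM (C.dP A c f) C.dom :=
  contMDiffOn_derivL C.isOpen_dom hf (C.smoothOn_natV (A := A) c)

variable (Γ) in
theorem contMDiffOn_berwald (a b : Fin r) (γ : Fin p) :
    SmoothFunOn EM (C.berwald Γ a b γ) C.dom :=
  (C.contMDiffOn_dP A (C.contMDiffOn_gam Γ b γ) a).neg

theorem contMDiffOn_gVBerwald (e a : Fin r) (γ : Fin p) :
    SmoothFunOn EM (C.gVBerwald G e a γ) C.dom :=
  ((C.contMDiffOn_dDelta Γ (C.contMDiffOn_gV G e a) γ).sub
    (SmoothFunOn.sum _ fun d => (C.contMDiffOn_berwald Γ e d γ).mul (C.contMDiffOn_gV G d a))).sub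
    (SmoothFunOn.sum _ fun d => (C.contMDiffOn_berwald Γ a d γ).mul (C.contMDiffOn_gV G e d))

variable (A) in
theorem contMDiffOn_structFun_base (θ α β : Fin p) :
    SmoothFunOn EM (fun u : TotalSpace FP P => C.structFun A θ α β (h u.proj)) C.dom :=
  (C.contMDiffOn_structFun A θ α β).comp (SmoothOn.contMDiffOn_base _)
    fun _ hu => mem_image_of_mem h hu

theorem contMDiffOn_bracketTerm (ε β γ : Fin p) :
    SmoothFunOn EM (C.bracketTerm G ε β γ) C.dom :=
  SmoothFunOn.sum _ fun θ =>
    (((C.contMDiffOn_gH G θ ε).mul (C.contMDiffOn_structFun_base A θ γ β)).sub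
      ((C.contMDiffOn_gH G β θ).mul (C.contMDiffOn_structFun_base A θ γ ε))).sub
      ((C.contMDiffOn_gH G θ γ).mul (C.contMDiffOn_structFun_base A θ β ε))

theorem contMDiffOn_cHh (α β γ : Fin p) : SmoothFunOn EM (C.cHh G α β γ) C.dom :=
  SmoothFunOn.const_mul _ <| SmoothFunOn.sum _ fun ε => (C.contMDiffOn_gHinv G α ε).mul <|
    (((C.contMDiffOn_dDelta Γ (C.contMDiffOn_gH G ε β) γ).add
      (C.contMDiffOn_dDelta Γ (C.contMDiffOn_gH G ε γ) β)).sub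
      (C.contMDiffOn_dDelta Γ (C.contMDiffOn_gH G β γ) ε)).add (C.contMDiffOn_bracketTerm G ε β γ)

theorem contMDiffOn_cHv (a b : Fin r) (γ : Fin p) : SmoothFunOn EM (C.cHv G a b γ) C.dom :=
  (C.contMDiffOn_berwald Γ a b γ).add <| SmoothFunOn.const_mul _ <| SmoothFunOn.sum _ fun e =>
    (C.contMDiffOn_gVinv G b e).mul (C.contMDiffOn_gVBerwald G e a γ)

theorem contMDiffOn_cVh (α β : Fin p) (c : Fin r) : SmoothFunOn EM (C.cVh G α β c) C.dom :=
  SmoothFunOn.const_mul _ <| SmoothFunOn.sum _ fun ε =>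
    (C.contMDiffOn_gHinv G α ε).mul (C.contMDiffOn_dP A (C.contMDiffOn_gH G ε β) c)

theorem contMDiffOn_cVv (a b c : Fin r) : SmoothFunOn EM (C.cVv G a b c) C.dom :=
  SmoothFunOn.const_mul _ <| SmoothFunOn.sum _ fun e => (C.contMDiffOn_gVinv G b e).mul <|
    ((C.contMDiffOn_dP A (C.contMDiffOn_gV G e a) c).add
      (C.contMDiffOn_dP A (C.contMDiffOn_gV G e c) a)).sub
      (C.contMDiffOn_dP A (C.contMDiffOn_gV G a c) e)

theorem formH_apply (u : TotalSpace FP P) (X : gtb A u) (α β : Fin p) :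
    C.formH G u X α β = ∑ γ, C.coeffH A γ u X * C.cHh G α β γ u +
      ∑ c, C.coeffV Γ c u X * C.cVh G α β c u := by
  simp [formH, Matrix.sum_apply, matHh, matVh]

theorem formV_apply (u : TotalSpace FP P) (X : gtb A u) (b a : Fin r) :
    C.formV G u X b a = ∑ γ, C.coeffH A γ u X * C.cHv G a b γ u +
      ∑ c, C.coeffV Γ c u X * C.cVv G a b c u := by
  simp [formV, Matrix.sum_apply, matHv, matVv]

variable {O : Set (TotalSpace FP P)} {X : GSection A FP P}

theorem contMDiffOn_formH (hO' : IsOpen O) (hO : O ⊆ C.dom) (hX : SmoothOn X O) (α β : Fin p) :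
    SmoothFunOn EM (fun u => C.formH G u (X u) α β) O := by
  simp only [formH_apply]
  exact (SmoothFunOn.sum _ fun γ =>
    (C.contMDiffOn_coeffH hX hO γ).mul ((C.contMDiffOn_cHh G α β γ).mono hO)).add
    (SmoothFunOn.sum _ fun c =>
      (C.contMDiffOn_coeffV Γ hO' hX hO c).mul ((C.contMDiffOn_cVh G α β c).mono hO))

theorem contMDiffOn_formV (hO' : IsOpen O) (hO : O ⊆ C.dom) (hX : SmoothOn X O) (b a : Fin r) :
    SmoothFunOn EM (fun u => C.formV G u (X u) b a) O := by
  simp only [formV_apply]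
  exact (SmoothFunOn.sum _ fun γ =>
    (C.contMDiffOn_coeffH hX hO γ).mul ((C.contMDiffOn_cHv G a b γ).mono hO)).add
    (SmoothFunOn.sum _ fun c =>
      (C.contMDiffOn_coeffV Γ hO' hX hO c).mul ((C.contMDiffOn_cVv G a b c).mono hO))

end VChart

/-! ### Existence of charts -/

variable (FF F FP P h) in
/-- Local trivializations of `P` at `x` and of `F` at `h x` give a chart around `x`. -/
theorem VChart.exists_mem (x : M) :
    ∃ C : VChart FF FP F P h (Module.finrank ℝ FF) (Module.finrank ℝ FP), x ∈ C.U := by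
  refine ⟨{
    U := (trivializationAt FP P x).baseSet ∩ h ⁻¹' (trivializationAt FF F (h x)).baseSet
    isOpen_U := (trivializationAt FP P x).open_baseSet.inter
      ((trivializationAt FF F (h x)).open_baseSet.preimage h.continuous)
    s := (trivializationAt FP P x).localFrame (Module.finBasis ℝ FP)
    t := (trivializationAt FF F (h x)).localFrame (Module.finBasis ℝ FF)
    frame_s := ((trivializationAt FP P x).isLocalFrameOn_localFrame_baseSet 𝓘(ℝ, EM) ∞ _).mono
      inter_subset_left
    frame_t := ((trivializationAt FF F (h x)).isLocalFrameOn_localFrame_baseSet 𝓘(ℝ, EN) ∞ _).mono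
      (image_subset_iff.2 inter_subset_right) }, ?_⟩
  exact ⟨mem_baseSet_trivializationAt FP P x, mem_baseSet_trivializationAt FF F (h x)⟩

/-- The numbers `p` and `r` are the ranks of the bundles, so they agree for charts with a common
point. -/
theorem VChart.size_eq {p' r' : ℕ} (C : VChart FF FP F P h p r) (C' : VChart FF FP F P h p' r')
    {x : M} (hx : x ∈ C.U) (hx' : x ∈ C'.U) : p = p' ∧ r = r' :=
  ⟨Fin.equiv_iff_eq.1 ⟨(C.frame_t.toBasisAt (mem_image_of_mem h hx)).indexEquiv
    (C'.frame_t.toBasisAt (mem_image_of_mem h hx'))⟩,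
    Fin.equiv_iff_eq.1 ⟨(C.frame_s.toBasisAt hx).indexEquiv (C'.frame_s.toBasisAt hx')⟩⟩

end Components

section CovariantDerivative

open Matrix

variable {p r : ℕ} {A : GenLieAlgebroid FF F h η}

/-! ### Covariant derivatives in a frame -/

section CovCoeff

variable {n : ℕ} {u : TotalSpace FP P}

/-- The coefficients `X ↦ dy^i(X) + κ^i_j(X) y^j` of the covariant derivative of a section with
coefficients `y`, for the connection form `κ`. -/
def covCoeff (κ : gtb A u →ₗ[ℝ] Matrix (Fin n) (Fin n) ℝ) (y : Fin n → TotalSpace FP P → ℝ) :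
    gtb A u →ₗ[ℝ] (Fin n → ℝ) where
  toFun X := fun i => derivL A (y i) u X + (κ X *ᵥ fun j => y j u) i
  map_add' X Y := by
    ext i
    simp only [map_add, Matrix.add_mulVec, Pi.add_apply]
    ring
  map_smul' c X := by
    ext i
    simp only [map_smul, Matrix.smul_mulVec, Pi.smul_apply, smul_eq_mul, RingHom.id_apply]
    ring

variable {κ κ' : gtb A u →ₗ[ℝ] Matrix (Fin n) (Fin n) ℝ} {y y' : Fin n → TotalSpace FP P → ℝ}

theorem covCoeff_apply (X : gtb A u) (i : Fin n) :
    covCoeff κ y X i = derivL A (y i) u X + ∑ j, κ X i j * y j u := rfl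

theorem covCoeff_congr (hy : ∀ i, y i =ᶠ[𝓝 u] y' i) : covCoeff κ y = covCoeff κ y' := by
  ext X i
  rw [covCoeff_apply, covCoeff_apply, derivL_congr (hy i)]
  simp only [fun j => (hy j).eq_of_nhds]

theorem covCoeff_const (c : Fin n → ℝ) (X : gtb A u) :
    covCoeff κ (fun i _ => c i) X = κ X *ᵥ c := by
  ext i
  rw [covCoeff_apply, derivL_const]
  simp [mulVec, dotProduct]

theorem covCoeff_add (hy : ∀ i, DiffFunAt EM (y i) u) (hy' : ∀ i, DiffFunAt EM (y' i) u) :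
    covCoeff κ (fun i v => y i v + y' i v) = covCoeff κ y + covCoeff κ y' := by
  ext X i
  simp only [LinearMap.add_apply, Pi.add_apply, covCoeff_apply, derivL_add (hy i) (hy' i),
    mul_add, Finset.sum_add_distrib]
  ring

theorem covCoeff_smul {f : TotalSpace FP P → ℝ} (hf : DiffFunAt EM f u)
    (hy : ∀ i, DiffFunAt EM (y i) u) (X : gtb A u) (i : Fin n) :
    covCoeff κ (fun i v => f v * y i v) X i =
      f u * covCoeff κ y X i + derivL A f u X * y i u := by
  simp only [covCoeff_apply, derivL_mul hf (hy i), LinearMap.add_apply, LinearMap.smul_apply,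
    smul_eq_mul, mul_add, Finset.mul_sum]
  rw [Finset.sum_congr rfl fun j _ => mul_left_comm (f u) (κ X i j) (y j u)]
  ring

/-- The covariant derivative is independent of the frame, if the connection forms in the two frames
are related by the transition functions `Λ` in the usual way. -/
theorem covCoeff_change {Λ : Fin n → Fin n → TotalSpace FP P → ℝ}
    (hΛ : ∀ i j, DiffFunAt EM (Λ i j) u) (hy' : ∀ i, DiffFunAt EM (y' i) u)
    (hy : ∀ i, ∀ᶠ v in 𝓝 u, y i v = ∑ j, Λ i j v * y' j v) {X : gtb A u}
    (hκ : valMat Λ u * κ' X = derivMat A Λ u X + κ X * valMat Λ u) :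
    covCoeff κ y X = valMat Λ u *ᵥ covCoeff κ' y' X := by
  have h1 : covCoeff κ' y' X = (fun i => derivL A (y' i) u X) + κ' X *ᵥ fun j => y' j u := rfl
  have h2 : (fun j => y j u) = valMat Λ u *ᵥ fun j => y' j u :=
    funext fun j => (hy j).self_of_nhds
  rw [h1, mulVec_add, mulVec_mulVec, hκ, add_mulVec, ← mulVec_mulVec, ← h2]
  ext i
  have h3 : derivL A (y i) u X = ∑ j, (Λ i j u * derivL A (y' j) u X +
      derivL A (Λ i j) u X * y' j u) := by
    rw [derivL_congr (hy i), derivL_sum _ fun j => (hΛ i j).mul (hy' j), LinearMap.sum_apply]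
    refine Finset.sum_congr rfl fun j _ => ?_
    rw [derivL_mul (hΛ i j) (hy' j), LinearMap.add_apply, LinearMap.smul_apply,
      LinearMap.smul_apply, smul_eq_mul, smul_eq_mul, mul_comm (y' j u)]
  rw [covCoeff_apply, h3, Finset.sum_add_distrib, add_assoc]
  rfl

/-- The product rule for a metric that is compatible with the connection. -/
theorem derivL_metric {z : Fin n → TotalSpace FP P → ℝ} {g : Fin n → Fin n → TotalSpace FP P → ℝ}
    (hg : ∀ i j, DiffFunAt EM (g i j) u) (hy : ∀ i, DiffFunAt EM (y i) u)
    (hz : ∀ i, DiffFunAt EM (z i) u) {X : gtb A u}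
    (hκ : (κ X)ᵀ * valMat g u + valMat g u * κ X = derivMat A g u X) :
    derivL A (fun v => ∑ i, ∑ j, g i j v * (y i v * z j v)) u X =
      ∑ i, ∑ j, g i j u * (covCoeff κ y X i * z j u) +
        ∑ i, ∑ j, g i j u * (y i u * covCoeff κ z X j) := by
  have h1 : ∀ i j, derivL A (g i j) u X = ∑ k, κ X k i * g k j u + ∑ k, g i k u * κ X k j :=
    fun i j => (congrFun (congrFun hκ i) j).symm
  rw [derivL_sum _ fun i => DiffFunAt.sum _ fun j => (hg i j).mul ((hy i).mul (hz j)),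
    LinearMap.sum_apply]
  have h2 : ∀ i, derivL A (fun v => ∑ j, g i j v * (y i v * z j v)) u X =
      ∑ j, (g i j u * (derivL A (y i) u X * z j u) + g i j u * (y i u * derivL A (z j) u X) +
        (∑ k, κ X k i * g k j u * y i u * z j u + ∑ k, g i k u * κ X k j * y i u * z j u)) := by
    intro i
    rw [derivL_sum _ fun j => (hg i j).mul ((hy i).mul (hz j)), LinearMap.sum_apply]
    refine Finset.sum_congr rfl fun j _ => ?_
    rw [derivL_mul (hg i j) ((hy i).mul (hz j)), derivL_mul (hy i) (hz j)]
    simp only [LinearMap.add_apply, LinearMap.smul_apply, smul_eq_mul, h1, ← Finset.sum_mul]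
    ring
  simp only [h2, covCoeff_apply, add_mul, mul_add, Finset.sum_add_distrib, Finset.sum_mul,
    Finset.mul_sum]
  have h3 : ∑ i, ∑ j, ∑ k, κ X k i * g k j u * y i u * z j u =
      ∑ i, ∑ j, ∑ k, g i j u * (κ X i k * y k u * z j u) := by
    rw [Finset.sum_comm, Finset.sum_comm (f := fun i j => ∑ k, g i j u * (κ X i k * y k u * z j u))]
    refine Finset.sum_congr rfl fun j _ => ?_
    rw [Finset.sum_comm]
    exact Finset.sum_congr rfl fun _ _ => Finset.sum_congr rfl fun _ _ => by ring
  have h4 : ∑ i, ∑ j, ∑ k, g i k u * κ X k j * y i u * z j u =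
      ∑ i, ∑ j, ∑ k, g i j u * (y i u * (κ X j k * z k u)) := by
    refine Finset.sum_congr rfl fun i _ => ?_
    rw [Finset.sum_comm]
    exact Finset.sum_congr rfl fun _ _ => Finset.sum_congr rfl fun _ _ => by ring
  rw [h3, h4]
  ring

end CovCoeff

namespace VChart

variable (C C' : VChart FF FP F P h p r) {Γ : RhoConnection FP P A} (G : PseudoMetric Γ)

/-- The covariant derivative of `Y` at `u` computed in the chart `C`. -/
def cov (Y : GSection A FP P) (u : TotalSpace FP P) : gtb A u →ₗ[ℝ] gtb A u :=
  ∑ α, ((LinearMap.proj α).comp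
      (covCoeff (C.formH G u) fun β v => C.coeffH A β v (Y v))).smulRight (C.delta Γ α u) +
    ∑ b, ((LinearMap.proj b).comp
      (covCoeff (C.formV G u) fun a v => C.coeffV Γ a v (Y v))).smulRight (C.natV A b u)

theorem cov_apply (Y : GSection A FP P) (u : TotalSpace FP P) (X : gtb A u) :
    C.cov G Y u X =
      ∑ α, covCoeff (C.formH G u) (fun β v => C.coeffH A β v (Y v)) X α • C.delta Γ α u +
      ∑ b, covCoeff (C.formV G u) (fun a v => C.coeffV Γ a v (Y v)) X b • C.natV A b u := by
  simp [cov]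

variable {u : TotalSpace FP P} {O : Set (TotalSpace FP P)} {Y Z : GSection A FP P}

theorem diffFunAt_coeffH (hu : u.proj ∈ C.U) (hO : IsOpen O) (hY : SmoothOn Y O) (huO : u ∈ O)
    (α : Fin p) : DiffFunAt EM (fun v => C.coeffH A α v (Y v)) u :=
  (C.contMDiffOn_coeffH (hY.mono inter_subset_left) inter_subset_right α).diffFunAt
    (hO.inter C.isOpen_dom) ⟨huO, hu⟩

theorem diffFunAt_coeffV (hu : u.proj ∈ C.U) (hO : IsOpen O) (hY : SmoothOn Y O) (huO : u ∈ O)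
    (a : Fin r) : DiffFunAt EM (fun v => C.coeffV Γ a v (Y v)) u :=
  (C.contMDiffOn_coeffV Γ (hO.inter C.isOpen_dom) (hY.mono inter_subset_left) inter_subset_right
    a).diffFunAt (hO.inter C.isOpen_dom) ⟨huO, hu⟩

theorem coeffH_change (hu' : u.proj ∈ C'.U) (X : gtb A u) (α : Fin p) :
    C.coeffH A α u X = ∑ γ, C.lamH C' α γ u * C'.coeffH A γ u X := by
  have h1 := congrArg (C.frame_t.coeff α (h u.proj))
    (C'.sum_coeff_t (mem_image_of_mem h hu') X.1.1)
  rw [map_sum] at h1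
  rw [coeffH_apply, ← h1]
  exact Finset.sum_congr rfl fun γ _ => (map_smul _ _ _).trans (mul_comm _ _)

theorem coeffV_change (hu' : u.proj ∈ C'.U) (X : gtb A u) (b : Fin r) :
    C.coeffV Γ b u X = ∑ a, C.lamV C' b a u * C'.coeffV Γ a u X := by
  have h1 := congrArg (C.frame_s.coeff b u.proj) (C'.sum_coeff_s hu' (Γ.toFun u X))
  rw [map_sum] at h1
  rw [coeffV_apply, ← h1]
  exact Finset.sum_congr rfl fun γ _ => (map_smul _ _ _).trans (mul_comm _ _)

/-- On overlaps of charts the covariant derivatives agree. -/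
theorem cov_change (hu : u.proj ∈ C.U) (hu' : u.proj ∈ C'.U) (hO : IsOpen O) (hY : SmoothOn Y O)
    (huO : u ∈ O) : C.cov G Y u = C'.cov G Y u := by
  ext1 X
  rw [cov_apply, cov_apply]
  congr 1
  · rw [covCoeff_change (fun i j => C.diffFunAt_lamH C' hu hu' i j)
      (fun i => C'.diffFunAt_coeffH hu' hO hY huO i)
      (fun i => (C'.eventually_dom hu').mono fun v hv => C.coeffH_change C' hv (Y v) i)
      (C.formH_change C' G hu hu' X)]
    simp only [C.delta_change C' Γ hu hu', mulVec, dotProduct, Finset.sum_smul, Finset.smul_sum,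
      smul_smul]
    rw [Finset.sum_comm]
    exact Finset.sum_congr rfl fun _ _ => Finset.sum_congr rfl fun _ _ => by rw [mul_comm]; rfl
  · rw [covCoeff_change (fun i j => C.diffFunAt_lamV C' hu hu' i j)
      (fun i => C'.diffFunAt_coeffV hu' hO hY huO i)
      (fun i => (C'.eventually_dom hu').mono fun v hv => C.coeffV_change C' hv (Y v) i)
      (C.formV_change C' G hu hu' X)]
    simp only [C.natV_change C' Γ hu, mulVec, dotProduct, Finset.sum_smul, Finset.smul_sum,
      smul_smul]
    rw [Finset.sum_comm]
    exact Finset.sum_congr rfl fun _ _ => Finset.sum_congr rfl fun _ _ => by rw [mul_comm]; rfl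

theorem cov_add (hu : u.proj ∈ C.U) (hO : IsOpen O) (hY : SmoothOn Y O) (hZ : SmoothOn Z O)
    (huO : u ∈ O) : C.cov G (fun v => Y v + Z v) u = C.cov G Y u + C.cov G Z u := by
  ext1 X
  simp only [LinearMap.add_apply, cov_apply, map_add,
    covCoeff_add (fun i => C.diffFunAt_coeffH hu hO hY huO i)
      (fun i => C.diffFunAt_coeffH hu hO hZ huO i),
    covCoeff_add (fun i => C.diffFunAt_coeffV hu hO hY huO i)
      (fun i => C.diffFunAt_coeffV hu hO hZ huO i), Pi.add_apply, add_smul,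
    Finset.sum_add_distrib]
  abel

theorem cov_smul (hu : u.proj ∈ C.U) (hO : IsOpen O) {f : TotalSpace FP P → ℝ}
    (hf : DiffFunAt EM f u) (hY : SmoothOn Y O) (huO : u ∈ O) (X : gtb A u) :
    C.cov G (fun v => f v • Y v) u X = f u • C.cov G Y u X + derivL A f u X • Y u := by
  conv_rhs => rw [C.eq_sum Γ hu (Y u)]
  simp only [cov_apply, map_smul, smul_eq_mul,
    covCoeff_smul hf (fun i => C.diffFunAt_coeffH hu hO hY huO i),
    covCoeff_smul hf (fun i => C.diffFunAt_coeffV hu hO hY huO i), add_smul,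
    Finset.sum_add_distrib, smul_add, Finset.smul_sum, smul_smul]
  abel

theorem contMDiffOn_covCoeff {n : ℕ} {κ : ∀ u : TotalSpace FP P, gtb A u →ₗ[ℝ]
    Matrix (Fin n) (Fin n) ℝ} {y : Fin n → TotalSpace FP P → ℝ} {X : GSection A FP P}
    (hO : IsOpen O) (hX : SmoothOn X O) (hκ : ∀ i j, SmoothFunOn EM (fun u => κ u (X u) i j) O)
    (hy : ∀ i, SmoothFunOn EM (y i) O) (i : Fin n) :
    SmoothFunOn EM (fun u => covCoeff (κ u) y (X u) i) O := by
  simp only [covCoeff_apply]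
  exact (contMDiffOn_derivL hO (hy i) hX).add
    (SmoothFunOn.sum _ fun j => (hκ i j).mul (hy j))

theorem smoothOn_cov {X : GSection A FP P} (hO' : IsOpen O) (hO : O ⊆ C.dom) (hX : SmoothOn X O)
    (hY : SmoothOn Y O) : SmoothOn (fun u => C.cov G Y u (X u)) O := by
  simp only [cov_apply]
  exact (SmoothOn.sum _ fun α => ((C.smoothOn_delta Γ α).mono hO).smul
    (contMDiffOn_covCoeff hO' hX (C.contMDiffOn_formH G hO' hO hX)
      (fun β => C.contMDiffOn_coeffH hY hO β) α)).add
    (SmoothOn.sum _ fun b => ((C.smoothOn_natV b).mono hO).smul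
      (contMDiffOn_covCoeff hO' hX (C.contMDiffOn_formV G hO' hO hX)
        (fun a => C.contMDiffOn_coeffV Γ hO' hY hO a) b))

theorem cov_mem_horizontal (hu : u.proj ∈ C.U) (hY : ∀ᶠ v in 𝓝 u, Y v ∈ Γ.horizontal v)
    (X : gtb A u) : C.cov G Y u X ∈ Γ.horizontal u := by
  have h1 : covCoeff (C.formV G u) (fun a v => C.coeffV Γ a v (Y v)) X = 0 := by
    rw [covCoeff_congr (y' := fun _ _ => 0)
      fun a => hY.mono fun v hv => C.coeffV_eq_zero Γ hv a, covCoeff_const (fun _ => 0)]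
    exact mulVec_zero _
  rw [cov_apply, h1]
  simp only [Pi.zero_apply, zero_smul, Finset.sum_const_zero, add_zero]
  exact Submodule.sum_mem _ fun α _ => Submodule.smul_mem _ _ (C.delta_mem_horizontal Γ α hu)

theorem cov_mem_vertical (hY : ∀ᶠ v in 𝓝 u, Y v ∈ vertical A v) (X : gtb A u) :
    C.cov G Y u X ∈ vertical A u := by
  have h1 : covCoeff (C.formH G u) (fun a v => C.coeffH A a v (Y v)) X = 0 := by
    rw [covCoeff_congr (y' := fun _ _ => 0)
      fun a => hY.mono fun v hv => C.coeffH_eq_zero hv a, covCoeff_const (fun _ => 0)]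
    exact mulVec_zero _
  rw [cov_apply, h1]
  simp only [Pi.zero_apply, zero_smul, Finset.sum_const_zero, zero_add]
  exact Submodule.sum_mem _ fun b _ => Submodule.smul_mem _ _ (C.natV_mem_vertical b u)

theorem cov_delta (hu : u.proj ∈ C.U) (β : Fin p) (X : gtb A u) :
    C.cov G (C.delta Γ β) u X = ∑ α, C.formH G u X α β • C.delta Γ α u := by
  rw [cov_apply, covCoeff_congr (κ := C.formH G u) (y' := fun α _ => if α = β then 1 else 0)
      fun α => (C.eventually_dom hu).mono fun v hv => C.coeffH_delta Γ α β hv,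
    covCoeff_congr (κ := C.formV G u) (y' := fun _ _ => 0)
      fun a => (C.eventually_dom hu).mono fun v hv => C.coeffV_delta Γ a β hv,
    covCoeff_const (fun α => if α = β then 1 else 0), covCoeff_const (fun _ => 0)]
  simp [mulVec, dotProduct]

theorem cov_natV (hu : u.proj ∈ C.U) (a : Fin r) (X : gtb A u) :
    C.cov G (C.natV A a) u X = ∑ b, C.formV G u X b a • C.natV A b u := by
  rw [cov_apply, covCoeff_congr (κ := C.formV G u) (y' := fun b _ => if b = a then 1 else 0)
      fun b => (C.eventually_dom hu).mono fun v hv => C.coeffV_natV Γ b a hv,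
    covCoeff_congr (κ := C.formH G u) (y' := fun _ _ => 0)
      fun α => (C.eventually_dom hu).mono fun v _ => C.coeffH_natV α a v,
    covCoeff_const (fun b => if b = a then 1 else 0), covCoeff_const (fun _ => 0)]
  simp [mulVec, dotProduct]

/-- The form `G` in the adapted base. -/
theorem form_eq_sum (hu : u.proj ∈ C.U) (X X' : gtb A u) :
    G.form u X X' = ∑ α, ∑ β, C.gH G α β u * (C.coeffH A α u X * C.coeffH A β u X') +
      ∑ a, ∑ b, C.gV G a b u * (C.coeffV Γ a u X * C.coeffV Γ b u X') := by
  have h1 : ∀ α a, G.form u (C.delta Γ α u) (C.natV A a u) = 0 := fun α a =>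
    G.distinguished u _ (C.delta_mem_horizontal Γ α hu) _ (C.natV_mem_vertical a u)
  have h2 : ∀ α a, G.form u (C.natV A a u) (C.delta Γ α u) = 0 := fun α a =>
    (G.symm u _ _).trans (h1 α a)
  conv_lhs => rw [C.eq_sum Γ hu X, C.eq_sum Γ hu X']
  simp only [map_add, map_sum, map_smul, LinearMap.add_apply, LinearMap.sum_apply,
    LinearMap.smul_apply, smul_eq_mul, h1, h2, mul_zero, Finset.sum_const_zero, add_zero,
    zero_add, Finset.mul_sum]
  rw [Finset.sum_comm, Finset.sum_comm (f := fun a b => C.coeffV Γ a u X' * _)]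
  congr 1 <;>
    exact Finset.sum_congr rfl fun _ _ => Finset.sum_congr rfl fun _ _ => by
      simp only [gH, gV]; ring

theorem coeffH_cov (hu : u.proj ∈ C.U) (X : gtb A u) (α : Fin p) :
    C.coeffH A α u (C.cov G Y u X) =
      covCoeff (C.formH G u) (fun β v => C.coeffH A β v (Y v)) X α := by
  rw [cov_apply, map_add, map_sum, map_sum]
  simp [C.coeffH_delta Γ α _ hu, C.coeffH_natV]

theorem coeffV_cov (hu : u.proj ∈ C.U) (X : gtb A u) (b : Fin r) :
    C.coeffV Γ b u (C.cov G Y u X) =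
      covCoeff (C.formV G u) (fun a v => C.coeffV Γ a v (Y v)) X b := by
  rw [cov_apply, map_add, map_sum, map_sum]
  simp [C.coeffV_natV Γ b _ hu, C.coeffV_delta Γ b _ hu]

/-- The covariant derivative is compatible with `G`. -/
theorem cov_metric (hu : u.proj ∈ C.U) (hO : IsOpen O) (hY : SmoothOn Y O) (hZ : SmoothOn Z O)
    (huO : u ∈ O) (X : gtb A u) :
    derivL A (fun v => G.form v (Y v) (Z v)) u X =
      G.form u (C.cov G Y u X) (Z u) + G.form u (Y u) (C.cov G Z u X) := by
  have hyH := fun i => C.diffFunAt_coeffH hu hO hY huO i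
  have hzH := fun i => C.diffFunAt_coeffH hu hO hZ huO i
  have hyV := fun i => C.diffFunAt_coeffV (Γ := Γ) hu hO hY huO i
  have hzV := fun i => C.diffFunAt_coeffV (Γ := Γ) hu hO hZ huO i
  have hgH := fun i j => (C.contMDiffOn_gH G i j).diffFunAt C.isOpen_dom hu
  have hgV := fun i j => (C.contMDiffOn_gV G i j).diffFunAt C.isOpen_dom hu
  rw [derivL_congr ((C.eventually_dom hu).mono fun v hv => C.form_eq_sum G hv (Y v) (Z v)),
    derivL_add
      (DiffFunAt.sum _ fun i => DiffFunAt.sum _ fun j => (hgH i j).mul ((hyH i).mul (hzH j)))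
      (DiffFunAt.sum _ fun i => DiffFunAt.sum _ fun j => (hgV i j).mul ((hyV i).mul (hzV j))),
    LinearMap.add_apply, derivL_metric hgH hyH hzH (C.formH_metric G hu X),
    derivL_metric hgV hyV hzV (C.formV_metric G hu X), C.form_eq_sum G hu, C.form_eq_sum G hu]
  simp only [C.coeffH_cov G hu, C.coeffV_cov G hu]
  ring

end VChart

end CovariantDerivative

section MetricConnection

variable {p r : ℕ} {A : GenLieAlgebroid FF F h η} {Γ : RhoConnection FP P A}

/-! ### The metric connection -/

namespace PseudoMetric

variable (G : PseudoMetric Γ)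

theorem cov_eq_cov {p' r' : ℕ} (C : VChart FF FP F P h p r) (C' : VChart FF FP F P h p' r')
    {u : TotalSpace FP P} {O : Set (TotalSpace FP P)} {Y : GSection A FP P} (hu : u.proj ∈ C.U)
    (hu' : u.proj ∈ C'.U) (hO : IsOpen O) (hY : SmoothOn Y O) (huO : u ∈ O) :
    C.cov G Y u = C'.cov G Y u := by
  obtain ⟨rfl, rfl⟩ := C.size_eq C' hu hu'
  exact C.cov_change C' G hu hu' hO hY huO

/-- The covariant derivative at `u`, computed in some chart around `π u`. For sections that are
smooth near `u` the choice of the chart is immaterial, by `nabla_eq`; for other sections the value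
has no meaning. -/
def nabla (Y : GSection A FP P) (u : TotalSpace FP P) : gtb A u →ₗ[ℝ] gtb A u :=
  (VChart.exists_mem FF FP F P h u.proj).choose.cov G Y u

theorem nabla_eq (C : VChart FF FP F P h p r) {u : TotalSpace FP P} {O : Set (TotalSpace FP P)}
    {Y : GSection A FP P} (hu : u.proj ∈ C.U) (hO : IsOpen O) (hY : SmoothOn Y O) (huO : u ∈ O) :
    G.nabla Y u = C.cov G Y u :=
  G.cov_eq_cov _ C (VChart.exists_mem FF FP F P h u.proj).choose_spec hu hO hY huO

/-- The distinguished linear connection whose components in every chart are `cHh`, `cHv`, `cVh` and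
`cVv`. -/
def metricConnection : DistLinConnection Γ where
  D := G.nabla
  add O Y Z hO hY hZ u hu := by
    obtain ⟨C, hC⟩ := VChart.exists_mem FF FP F P h u.proj
    rw [G.nabla_eq C hC hO hY hu, G.nabla_eq C hC hO hZ hu, G.nabla_eq C hC hO (hY.add hZ) hu,
      C.cov_add G hC hO hY hZ hu]
  leibniz O f Y hO hf hY u hu X := by
    obtain ⟨C, hC⟩ := VChart.exists_mem FF FP F P h u.proj
    rw [G.nabla_eq C hC hO hY hu, G.nabla_eq C hC hO (hY.smul hf) hu,
      C.cov_smul G hC hO (SmoothFunOn.diffFunAt hf hO hu) hY hu, anchorDeriv_eq]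
  smooth O X Y hO hX hY := by
    refine SmoothOn.of_locally fun u hu => ?_
    obtain ⟨C, hC⟩ := VChart.exists_mem FF FP F P h u.proj
    exact ⟨C.dom, C.isOpen_dom, hC, (C.smoothOn_cov G (hO.inter C.isOpen_dom) inter_subset_right
      (hX.mono inter_subset_left) (hY.mono inter_subset_left)).congr
        fun v hv => by rw [G.nabla_eq C hv.2 hO hY hv.1]⟩
  horizontal O Y hO hY hh u hu X := by
    obtain ⟨C, hC⟩ := VChart.exists_mem FF FP F P h u.proj
    rw [G.nabla_eq C hC hO hY hu]
    exact C.cov_mem_horizontal G hC (Filter.mem_of_superset (hO.mem_nhds hu) hh) X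
  vertical O Y hO hY hv u hu X := by
    obtain ⟨C, hC⟩ := VChart.exists_mem FF FP F P h u.proj
    rw [G.nabla_eq C hC hO hY hu]
    exact C.cov_mem_vertical G (Filter.mem_of_superset (hO.mem_nhds hu) hv) X

theorem metricConnection_hasComponents (C : VChart FF FP F P h p r) :
    G.metricConnection.HasComponents C (C.cHh G) (C.cHv G) (C.cVh G) (C.cVv G) where
  hh u hu β γ := by
    change G.nabla _ u _ = _
    rw [G.nabla_eq C hu C.isOpen_dom (C.smoothOn_delta Γ β) hu, C.cov_delta G hu,
      C.formH_delta G hu]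
    rfl
  hv u hu a γ := by
    change G.nabla _ u _ = _
    rw [G.nabla_eq C hu C.isOpen_dom (C.smoothOn_natV a) hu, C.cov_natV G hu,
      C.formV_delta G hu]
    rfl
  vh u hu β c := by
    change G.nabla _ u _ = _
    rw [G.nabla_eq C hu C.isOpen_dom (C.smoothOn_delta Γ β) hu, C.cov_delta G hu,
      C.formH_natV G hu]
    rfl
  vv u hu a c := by
    change G.nabla _ u _ = _
    rw [G.nabla_eq C hu C.isOpen_dom (C.smoothOn_natV a) hu, C.cov_natV G hu,
      C.formV_natV G hu]
    rfl

theorem isParallel_metricConnection : G.IsParallel G.metricConnection := by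
  intro O Y Z hO hY hZ u hu X
  obtain ⟨C, hC⟩ := VChart.exists_mem FF FP F P h u.proj
  change anchorDeriv _ X - G.form u (G.nabla Y u X) (Z u) - G.form u (Y u) (G.nabla Z u X) = 0
  rw [G.nabla_eq C hC hO hY hu, G.nabla_eq C hC hO hZ hu, anchorDeriv_eq,
    C.cov_metric G hC hO hY hZ hu]
  ring

end PseudoMetric

/-! ### The Riemannian case -/

namespace VChart

variable (C : VChart FF FP F P h p r) (G : PseudoMetric Γ)

variable {u : TotalSpace FP P}

/-- If the `g_{αβ}` depend only on the base point in some chart, then they do so in every chart,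
because the transition functions depend only on the base point. -/
theorem gH_eq_of_isHRiemannian (hG : G.IsHRiemannian) (hu : u.proj ∈ C.U) {v : TotalSpace FP P}
    (hv : v.proj = u.proj) (α β : Fin p) : C.gH G α β v = C.gH G α β u := by
  obtain ⟨p', r', C', hx, hC'⟩ := hG u.proj
  obtain ⟨rfl, rfl⟩ := C.size_eq C' hu hx
  rw [C'.gH_change C G (u := v) (by rwa [hv]) (by rwa [hv]), C'.gH_change C G hx hu]
  simp only [lamH, hv, hC' u v hx hv.symm]

theorem gV_eq_of_isVRiemannian (hG : G.IsVRiemannian) (hu : u.proj ∈ C.U) {v : TotalSpace FP P}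
    (hv : v.proj = u.proj) (a b : Fin r) : C.gV G a b v = C.gV G a b u := by
  obtain ⟨p', r', C', hx, hC'⟩ := hG u.proj
  obtain ⟨rfl, rfl⟩ := C.size_eq C' hu hx
  rw [C'.gV_change C G (u := v) (by rwa [hv]), C'.gV_change C G hx]
  simp only [lamV, hv, hC' u v hx hv.symm]

theorem dP_gH_eq_zero (hG : G.IsHRiemannian) (hu : u.proj ∈ C.U) (α β : Fin p) (c : Fin r) :
    C.dP A c (C.gH G α β) u = 0 :=
  derivL_vert_eq_zero (A := A) ((C.contMDiffOn_gH G α β).diffFunAt C.isOpen_dom hu)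
    (fun _ hv => C.gH_eq_of_isHRiemannian G hG hu hv α β) _

theorem dP_gV_eq_zero (hG : G.IsVRiemannian) (hu : u.proj ∈ C.U) (a b c : Fin r) :
    C.dP A c (C.gV G a b) u = 0 :=
  derivL_vert_eq_zero (A := A) ((C.contMDiffOn_gV G a b).diffFunAt C.isOpen_dom hu)
    (fun _ hv => C.gV_eq_of_isVRiemannian G hG hu hv a b) _

variable (Γ) in
theorem dDelta_eq_dX {f : TotalSpace FP P → ℝ} (hf : ∀ c, C.dP A c f u = 0) (γ : Fin p) :
    C.dDelta Γ γ f u = C.dX A γ f u := by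
  have hf' : ∀ c, derivL A f u (C.natV A c u) = 0 := hf
  simp only [dDelta, dX, anchorDeriv_eq, delta, map_add, map_sum, map_smul, hf', smul_zero,
    Finset.sum_const_zero, add_zero]

theorem cHh_eq_rHh (hG : G.IsHRiemannian) (hu : u.proj ∈ C.U) (α β γ : Fin p) :
    C.cHh G α β γ u = C.rHh G α β γ u := by
  simp only [cHh, rHh, C.dDelta_eq_dX Γ fun c => C.dP_gH_eq_zero G hG hu _ _ c]

theorem cHv_eq_rHv (hG : G.IsVRiemannian) (hu : u.proj ∈ C.U) (a b : Fin r) (γ : Fin p) :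
    C.cHv G a b γ u = C.rHv G a b γ u := by
  simp only [cHv, rHv, gVBerwald, berwald, C.dDelta_eq_dX Γ fun c => C.dP_gV_eq_zero G hG hu _ _ c,
    neg_mul, Finset.sum_neg_distrib, sub_neg_eq_add]

theorem cVh_eq_zero (hG : G.IsHRiemannian) (hu : u.proj ∈ C.U) (α β : Fin p) (c : Fin r) :
    C.cVh G α β c u = 0 := by
  simp [cVh, C.dP_gH_eq_zero G hG hu]

theorem cVv_eq_zero (hG : G.IsVRiemannian) (hu : u.proj ∈ C.U) (a b c : Fin r) :
    C.cVv G a b c u = 0 := by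
  simp [cVv, C.dP_gV_eq_zero G hG hu]

end VChart

theorem PseudoMetric.metricConnection_hasComponents_of_isRiemannian (G : PseudoMetric Γ)
    (hH : G.IsHRiemannian) (hV : G.IsVRiemannian) (C : VChart FF FP F P h p r) :
    G.metricConnection.HasComponents C (C.rHh G) (C.rHv G) (fun _ _ _ _ => 0)
      (fun _ _ _ _ => 0) where
  hh u hu β γ := by
    rw [(G.metricConnection_hasComponents C).hh u hu]
    simp only [C.cHh_eq_rHh G hH hu]
  hv u hu a γ := by
    rw [(G.metricConnection_hasComponents C).hv u hu]
    simp only [C.cHv_eq_rHv G hV hu]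
  vh u hu β c := by
    rw [(G.metricConnection_hasComponents C).vh u hu]
    simp only [C.cVh_eq_zero G hH hu]
  vv u hu a c := by
    rw [(G.metricConnection_hasComponents C).vv u hu]
    simp only [C.cVv_eq_zero G hV hu]

end MetricConnection

end GeneralizedTangentBundle

end GenTangent

theorem theorem5p2
    {EM EN FE FF : Type*}
    [NormedAddCommGroup EM] [NormedSpace ℝ EM] [FiniteDimensional ℝ EM]
    [NormedAddCommGroup EN] [NormedSpace ℝ EN] [FiniteDimensional ℝ EN]
    [NormedAddCommGroup FE] [NormedSpace ℝ FE] [FiniteDimensional ℝ FE]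
    [NormedAddCommGroup FF] [NormedSpace ℝ FF] [FiniteDimensional ℝ FF]
    {M N : Type*}
    [TopologicalSpace M] [T2Space M] [SecondCountableTopology M]
    [ChartedSpace EM M] [IsManifold 𝓘(ℝ, EM) ∞ M]
    [TopologicalSpace N] [T2Space N] [SecondCountableTopology N]
    [ChartedSpace EN N] [IsManifold 𝓘(ℝ, EN) ∞ N]
    -- the vector bundle `E → M`
    {E : M → Type*} [TopologicalSpace (TotalSpace FE E)]
    [∀ x, AddCommGroup (E x)] [∀ x, Module ℝ (E x)] [∀ x, TopologicalSpace (E x)]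
    [FiberBundle FE E] [VectorBundle ℝ FE E] [ContMDiffVectorBundle ∞ FE E 𝓘(ℝ, EM)]
    -- the generalized Lie algebroid `F → N`
    {F : N → Type*} [TopologicalSpace (TotalSpace FF F)]
    [∀ y, AddCommGroup (F y)] [∀ y, Module ℝ (F y)] [∀ y, TopologicalSpace (F y)]
    [FiberBundle FF F] [VectorBundle ℝ FF F] [ContMDiffVectorBundle ∞ FF F 𝓘(ℝ, EN)]
    (h : M ≃ₘ^∞⟮𝓘(ℝ, EM), 𝓘(ℝ, EN)⟯ N) (η : N ≃ₘ^∞⟮𝓘(ℝ, EN), 𝓘(ℝ, EM)⟯ M)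
    (A : GenTangent.GenLieAlgebroid FF F h η)
    -- a `(ρ, η)`-connection for the dual bundle `E*`, and a pseudometrical structure
    (Γ : GenTangent.RhoConnection (FE →L[ℝ] ℝ) (fun x : M => E x →L[ℝ] Bundle.Trivial M ℝ x) A)
    (G : GenTangent.PseudoMetric Γ) :
    (∃ D : GenTangent.DistLinConnection Γ,
      (∀ (p r : ℕ) (C : GenTangent.VChart FF (FE →L[ℝ] ℝ) F
          (fun x : M => E x →L[ℝ] Bundle.Trivial M ℝ x) h p r),
        D.HasComponents C (C.cHh G) (C.cHv G) (C.cVh G) (C.cVv G)) ∧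
      G.IsParallel D) ∧
    (G.IsHRiemannian → G.IsVRiemannian →
      ∃ D : GenTangent.DistLinConnection Γ,
        (∀ (p r : ℕ) (C : GenTangent.VChart FF (FE →L[ℝ] ℝ) F
            (fun x : M => E x →L[ℝ] Bundle.Trivial M ℝ x) h p r),
          D.HasComponents C (C.rHh G) (C.rHv G) (fun _ _ _ _ => 0) (fun _ _ _ _ => 0)) ∧
        G.IsParallel D) :=
  ⟨⟨G.metricConnection, fun _ _ C => G.metricConnection_hasComponents C,
      G.isParallel_metricConnection⟩,
    fun hH hV => ⟨G.metricConnection,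
      fun _ _ C => G.metricConnection_hasComponents_of_isRiemannian hH hV C,
      G.isParallel_metricConnection⟩⟩
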